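/- **Model.** A decision maker chooses between actions $r,\ell$; the state is $R$ or $L$, and action $x$ pays $u_x^\omega$ in state $\omega$, where $u_r^R>\max\{0,u_\ell^R\}$ and $u_\ell^L>\max\{0,u_r^L\}$. Let $\lambda>0$, discount rate $\rho\ge 0$, flow cost $c\ge 0$, with $\rho,c$ not both zero. For a belief $p\in[0,1]$ (the probability of $R$) let $U(p)=\max\{pu_r^R+(1-p)u_r^L,\;pu_\ell^R+(1-p)u_\ell^L\}$. A strategy at the prior $p_0\in[0,1]$ consists of a measurable $\alpha:[0,\infty)\to[0,1]$ and a deadline $T\in[0,\infty]$; with $\beta_t=1-\alpha_t$ its belief path (absent breakthroughs) solves $\dot p_t=-\lambda(2\alpha_t-1)p_t(1-p_t)$, and $P_t=p_0e^{-\lambda\int_0^t\alpha_s ds}+(1-p_0)e^{-\lambda\int_0^t\beta_s ds}$. It is optimal if it maximizes, over all strategies at $p_0$, $$\int_0^{T}e^{-\rho t}P_t\left[p_t\lambda\alpha_tu_r^R+(1-p_t)\lambda\beta_tu_\ell^L-c\right]dt+e^{-\rho T}P_TU(p_T)$$ (the last term is absent if $T=\infty$; the objective is $-\infty$ if the expected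 cost is infinite). A policy prescribes at each belief either to take an optimal immediate action or to learn with some attention $\alpha(p)\in[0,1]$. An execution of a policy from $p_0$ is a strategy that uses the prescribed attention at every $t<T$, with $p_t$ having the corresponding velocity as its right derivative, and acts at $T$ (if $T<\infty$) where the policy prescribes action. Strategies are identified if they have the same $T$ and a.e. the same $\alpha_t$ on $[0,T)$. Call a policy optimal if from every prior it has exactly one execution and this is an optimal strategy. Put $A=u_r^R-u_\ell^R$, $B=u_\ell^L-u_r^L$, and $$\overline c=\max\Bigl\{0,\tfrac{\lambda AB-\rho(u_r^Ru_\ell^L-u_\ell^Ru_r^L)}{A+B}\Bigr\},\qquad \underline c=\max\{0,\min\{\overline c,\tilde c\}\},$$ where $\tilde c=\min\Bigl\{\tfrac{(\rho+\lambda)A}{1+K}-\rho u_r^R,\ \tfrac{(\rho+\lambda)B}{1+K}-\rho u_\ell^L\Bigr\}$ with $K=\bigl(\tfrac{2\rho+\lambda}{\lambda}\bigr)^{\lambda/\rho}$ if $\rho>0$, and $\tilde c=\tfrac{\lambda}{1+e^2}\min\{A,B\}$ if $\rho=0$. Put $$\underline p^*=\tfrac{\rho u_\ell^L+c}{\rho(u_\ell^L-u_\ell^R)+\lambda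 A},\qquad \overline p^*=\tfrac{\lambda B-\rho u_r^L-c}{\rho(u_r^R-u_r^L)+\lambda B},\qquad p^*=\tfrac{\rho u_\ell^L+c}{(\rho u_r^R+c)+(\rho u_\ell^L+c)}.$$ **Theorem.** $\overline c\ge\underline c\ge 0$, and, for given utilities and $\lambda$, $\overline c>\underline c>0$ for all sufficiently small $\rho\ge0$. Moreover: (a) If $c\ge\overline c$, immediate action at every belief is an optimal policy, and the only optimal strategy at each prior is to act immediately. (b) If $\underline c\le c<\overline c$, there is $\check p$ with $0<\underline p^*<\check p<\overline p^*<1$ such that it is an optimal policy to set $\alpha=1$ on $(\underline p^*,\check p)$, $\alpha=0$ on $[\check p,\overline p^*)$, and act immediately at $p\notin(\underline p^*,\overline p^*)$; the same policy with $\alpha(\check p)=1$ is also optimal. If $c\ne\tilde c$, the optimal strategies at every prior are exactly the executions of these two policies. If $c=\tilde c$, every optimal strategy uses the attention prescribed by the policy at almost every time before its deadline at which its belief differs from $p^*$, and if its deadline is finite, its belief there lies outside $(\underline p^*,\overline p^*)$. (c) If $c<\underline c$, there are $\underline p,\overline p$ with $0<\underline p^*<\underline p<p^*<\overline p<\overline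 p^*<1$ such that it is an optimal policy to set $\alpha=1$ on $(\underline p^*,\underline p)$, $\alpha=0$ on $[\underline p,p^*)$, $\alpha=\tfrac12$ at $p^*$, $\alpha=1$ on $(p^*,\overline p]$, $\alpha=0$ on $(\overline p,\overline p^*)$, and act immediately at $p\notin(\underline p^*,\overline p^*)$. The policies that differ from it only by $\alpha(\underline p)=1$ and/or $\alpha(\overline p)=0$ are also optimal, and the optimal strategies at every prior are exactly the executions of these four policies. -/

import Mathlib

open MeasureTheory
open scoped ENNReal

noncomputable section

namespace Attention

/-- The four payoffs: `xW` is the payoff of action `x ∈ {r, l}` in state `W ∈ {R, L}`. -/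
structure Payoffs where
  rR : ℝ
  rL : ℝ
  lR : ℝ
  lL : ℝ

/-- Expected payoff of an optimal immediate action at belief `p`, the probability of state `R`. -/
def Payoffs.immediate (u : Payoffs) (p : ℝ) : ℝ :=
  max (p * u.rR + (1 - p) * u.rL) (p * u.lR + (1 - p) * u.lL)

/-- A strategy at prior `p₀`: a measurable attention function with values in `[0, 1]` (the share of
attention paid to the `L`-biased source), a deadline in `[0, ∞]` for acting if there is no
breakthrough, and the belief path that the attention function induces while there is no
breakthrough. The path is the (unique) solution of
`p' = - lam (2 α - 1) p (1 - p)`, `p 0 = p₀`, in integral form since `α` is only measurable. -/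
structure Strategy (lam p₀ : ℝ) where
  att : ℝ → ℝ
  measurable_att : Measurable att
  att_mem : ∀ t, att t ∈ Set.Icc (0 : ℝ) 1
  deadline : ℝ≥0∞
  belief : ℝ → ℝ
  continuousOn_belief : ContinuousOn belief (Set.Ici 0)
  belief_eq : ∀ t, 0 ≤ t → belief t =
    p₀ + ∫ s in (0 : ℝ)..t, -(lam * (2 * att s - 1) * belief s * (1 - belief s))

namespace Strategy

variable {lam p₀ : ℝ}

/-- The times before the deadline. -/
def learningTimes (σ : Strategy lam p₀) : Set ℝ :=
  {t | 0 ≤ t ∧ ENNReal.ofReal t < σ.deadline}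

/-- The probability that there is no breakthrough by time `t`. -/
def survival (σ : Strategy lam p₀) (t : ℝ) : ℝ :=
  p₀ * Real.exp (-(lam * ∫ s in (0 : ℝ)..t, σ.att s)) +
    (1 - p₀) * Real.exp (-(lam * ∫ s in (0 : ℝ)..t, (1 - σ.att s)))

/-- Expected discounted payoff from actions taken after a breakthrough before the deadline. -/
def breakthroughPayoff (u : Payoffs) (rho : ℝ) (σ : Strategy lam p₀) : ℝ :=
  ∫ t in σ.learningTimes, Real.exp (-(rho * t)) * σ.survival t *
    (σ.belief t * lam * σ.att t * u.rR + (1 - σ.belief t) * lam * (1 - σ.att t) * u.lL)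

/-- Expected discounted payoff from the action taken at the deadline. With an infinite deadline
there is no such action. -/
def deadlinePayoff (u : Payoffs) (rho : ℝ) (σ : Strategy lam p₀) : ℝ :=
  if σ.deadline = ∞ then 0
  else Real.exp (-(rho * σ.deadline.toReal)) * σ.survival σ.deadline.toReal *
    u.immediate (σ.belief σ.deadline.toReal)

/-- Expected discounted flow cost, in `[0, ∞]`: it can be infinite if `rho = 0` and the deadline is
infinite. -/
def flowCost (rho c : ℝ) (σ : Strategy lam p₀) : ℝ≥0∞ :=
  ∫⁻ t in σ.learningTimes, ENNReal.ofReal (Real.exp (-(rho * t)) * σ.survival t * c)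

/-- The objective of the decision maker, with value `-∞` if the expected cost is infinite. -/
def payoff (u : Payoffs) (rho c : ℝ) (σ : Strategy lam p₀) : EReal :=
  ((σ.breakthroughPayoff u rho + σ.deadlinePayoff u rho : ℝ) : EReal) -
    ((σ.flowCost rho c : ℝ≥0∞) : EReal)

/-- `σ` attains the maximum of the objective over all strategies with the same prior. -/
def IsOptimal (u : Payoffs) (rho c : ℝ) (σ : Strategy lam p₀) : Prop :=
  ∀ τ : Strategy lam p₀, τ.payoff u rho c ≤ σ.payoff u rho c

/-- Same deadline, and same attention at almost all times before it. -/
def Same (σ τ : Strategy lam p₀) : Prop :=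
  σ.deadline = τ.deadline ∧ ∀ᵐ t, t ∈ σ.learningTimes → σ.att t = τ.att t

end Strategy

/-- What to do at a belief: take an optimal immediate action, or learn with attention `α`. -/
inductive Decision where
  | act : Decision
  | learn (α : ℝ) : Decision

/-- A (Markov) policy: a decision for each belief. -/
abbrev Policy := ℝ → Decision

/-- The strategy `σ` is an execution of the policy `π`: at all times before the deadline `π`
prescribes the attention that `σ` chooses and the belief moves (forward in time) with the velocity
belonging to it, and `π` prescribes action at the deadline, if it is finite. -/
def Executes {lam p₀ : ℝ} (π : Policy) (σ : Strategy lam p₀) : Prop :=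
  (∀ t ∈ σ.learningTimes, π (σ.belief t) = Decision.learn (σ.att t) ∧
    HasDerivWithinAt σ.belief
      (-(lam * (2 * σ.att t - 1) * σ.belief t * (1 - σ.belief t))) (Set.Ici t) t) ∧
  (σ.deadline ≠ ∞ → π (σ.belief σ.deadline.toReal) = Decision.act)

/-- `σ` agrees with the policy `π` at almost all times at which the belief is not `q`. -/
def FollowsOff {lam p₀ : ℝ} (q : ℝ) (π : Policy) (σ : Strategy lam p₀) : Prop :=
  (∀ᵐ t, t ∈ σ.learningTimes → σ.belief t ≠ q → π (σ.belief t) = Decision.learn (σ.att t)) ∧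
  (σ.deadline ≠ ∞ → π (σ.belief σ.deadline.toReal) = Decision.act)

/-- The policy is admissible (from every prior it has exactly one execution, up to null sets of
times), and its executions are optimal at every prior. -/
def IsOptimalPolicy (u : Payoffs) (lam rho c : ℝ) (π : Policy) : Prop :=
  ∀ p₀ ∈ Set.Icc (0 : ℝ) 1,
    (∃ σ : Strategy lam p₀, Executes π σ ∧ ∀ τ : Strategy lam p₀, Executes π τ → τ.Same σ) ∧
    ∀ σ : Strategy lam p₀, Executes π σ → σ.IsOptimal u rho c

/-- At every prior, each optimal strategy is, up to null sets of times, an execution of one of the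
given policies. -/
def OptimaComeFrom (u : Payoffs) (lam rho c : ℝ) (S : Set Policy) : Prop :=
  ∀ p₀ ∈ Set.Icc (0 : ℝ) 1, ∀ σ : Strategy lam p₀, σ.IsOptimal u rho c →
    ∃ π ∈ S, ∃ τ : Strategy lam p₀, Executes π τ ∧ σ.Same τ

/-- Immediate action at every belief. -/
def actPolicy : Policy := fun _ => Decision.act

/-- Own-biased learning on `(lo, hi)` with switch point `k`, at which attention is `a`; immediate
action outside `(lo, hi)`. -/
def ownPolicy (lo k hi a : ℝ) : Policy := fun p =>
  if p ≤ lo ∨ hi ≤ p then Decision.act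
  else if p < k then Decision.learn 1
  else if p = k then Decision.learn a
  else Decision.learn 0

/-- Own-biased learning on `(lo, kl)` and `(kr, hi)`, opposite-biased learning with reference belief
`q` on `(kl, kr)`, attention `a` at `kl` and `b` at `kr`; immediate action outside `(lo, hi)`. -/
def mixedPolicy (lo kl q kr hi a b : ℝ) : Policy := fun p =>
  if p ≤ lo ∨ hi ≤ p then Decision.act
  else if p < kl then Decision.learn 1
  else if p = kl then Decision.learn a
  else if p < q then Decision.learn 0
  else if p = q then Decision.learn (1 / 2)
  else if p < kr then Decision.learn 1
  else if p = kr then Decision.learn b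
  else Decision.learn 0

/-- The upper cost cutoff. -/
def cUpper (u : Payoffs) (lam rho : ℝ) : ℝ :=
  max 0 ((lam * (u.rR - u.lR) * (u.lL - u.rL) - rho * (u.rR * u.lL - u.lR * u.rL)) /
    ((u.rR - u.lR) + (u.lL - u.rL)))

/-- The lower cost cutoff before truncation to `[0, cUpper]`. -/
def cKnife (u : Payoffs) (lam rho : ℝ) : ℝ :=
  if 0 < rho then
    min ((rho + lam) * (u.rR - u.lR) / (1 + ((2 * rho + lam) / lam) ^ (lam / rho)) - rho * u.rR)
      ((rho + lam) * (u.lL - u.rL) / (1 + ((2 * rho + lam) / lam) ^ (lam / rho)) - rho * u.lL)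
  else lam / (1 + Real.exp 2) * min (u.rR - u.lR) (u.lL - u.rL)

/-- The lower cost cutoff. -/
def cLower (u : Payoffs) (lam rho : ℝ) : ℝ :=
  max 0 (min (cUpper u lam rho) (cKnife u lam rho))

/-- The lower boundary of the experimentation region. -/
def pLow (u : Payoffs) (lam rho c : ℝ) : ℝ :=
  (u.lL * rho + c) / (rho * (u.lL - u.lR) + (u.rR - u.lR) * lam)

/-- The upper boundary of the experimentation region. -/
def pHigh (u : Payoffs) (lam rho c : ℝ) : ℝ :=
  ((u.lL - u.rL) * lam - u.rL * rho - c) / (rho * (u.rR - u.rL) + (u.lL - u.rL) * lam)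

/-- The absorbing belief of opposite-biased learning. -/
def pStar (u : Payoffs) (rho c : ℝ) : ℝ :=
  (u.lL * rho + c) / ((u.rR * rho + c) + (u.lL * rho + c))

end Attention

end

/-! In terms of the log-likelihood ratio z of the belief, attention α moves z with velocity λθ,
where θ = 1 − 2α lies in [−1, 1]. The payoff of a strategy is the payoff of knowing the state minus
an expected loss (`Strategy.payoff_eq`). Up to a factor depending only on an interior prior, this
loss is ∫ e^{−rt} S(z_t) dt + e^{−rT} ψ(z_T), with r = ρ + λ/2, S(z) = a e^{z/2} + b e^{−z/2}, ψ(z)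
= min(A e^{z/2}, B e^{−z/2}), a = ρ u_r^R + c and b = ρ u_ℓ^L + c (`Strategy.loss_eq`). So the
problem is deterministic: move on a line with speed at most λ and choose when to stop. The priors 0
and 1 are treated separately (`Strategy.isOptimal_iff_of_known`).

Verification. If rφ + λ|φ'| ≤ S for both one-sided derivatives of φ, then accumulated cost plus
discounted φ never decreases along any path (`monotone_total`). If also 0 ≤ φ ≤ ψ and φ is bounded,
φ is a lower bound for the cost (`ofReal_le_regret`). A path attains the bound iff the total is
constant before the deadline and φ = ψ at a finite deadline (`total_eq_of_regret_le`,
`regret_le_of_total_eq`).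

Value functions. If c is at least the upper cutoff, ψ itself is such a subsolution. Otherwise there
are points lo < hi at which stopping smoothly pastes to moving outwards; `leftValue` and
`rightValue` are the costs of moving down to lo and up to hi. Let q minimize S; it corresponds to
p*. If waiting at q for ever, at cost S(q)/r, does not beat both of them at q, the value is their
lower envelope, with one switch k (`exists_isOwnValue`). If waiting beats both, the costs of moving
to q and waiting there take over between two switches (`exists_isMixedValue`). All pieces solve
linear first-order equations, so single crossings and inequalities follow by multiplying differences
with an exponential. Explicit solutions show that waiting beats `leftValue` at q iff q − lo exceeds
log K (`leftValue_flow_iff`), and this, with its mirror image, is the condition c < c̃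
(`lt_cKnife_iff`).

Uniqueness. Along an optimal path φ changes at the rate rφ − S. This rate is unattainable in the
interior of the stopping region, forces full speed in the downhill direction of φ where φ' ≠ 0 and
the dynamic programming equation holds, and forbids resting where rφ < S. A concave kink can
therefore only be a starting point, and is left at once to one side. If c = c̃ and φ attains S/r at
q, the path may rest there for a while, so only the weaker description of optima is obtained. -/

noncomputable section

open Set Filter Topology

namespace Attention

/-! ### Controls and the Lipschitz paths they generate. -/

/-- A measurable control with values in `[-1, 1]`. -/
structure IsControl (θ : ℝ → ℝ) : Prop where
  measurable : Measurable θ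
  abs_le_one : ∀ t, |θ t| ≤ 1

/-- The position at time `t` of a point that starts at `z₀` and moves with velocity `lam * θ`. -/
def path (lam z₀ : ℝ) (θ : ℝ → ℝ) (t : ℝ) : ℝ := z₀ + lam * ∫ s in (0 : ℝ)..t, θ s

namespace IsControl

variable {θ : ℝ → ℝ} {lam z₀ : ℝ}

theorem neg (h : IsControl θ) : IsControl (fun t => -θ t) :=
  ⟨h.measurable.neg, fun t => by simpa using h.abs_le_one t⟩

theorem locallyIntegrable (h : IsControl θ) : LocallyIntegrable θ volume := by
  refine (locallyIntegrable_const (1 : ℝ)).mono h.measurable.aestronglyMeasurable ?_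
  exact Eventually.of_forall fun t => by simpa using h.abs_le_one t

theorem intervalIntegrable (h : IsControl θ) (s t : ℝ) : IntervalIntegrable θ volume s t :=
  (h.locallyIntegrable.integrableOn_isCompact isCompact_uIcc).mono_set
    uIoc_subset_uIcc |> intervalIntegrable_iff.mpr

theorem path_sub (h : IsControl θ) (s t : ℝ) :
    path lam z₀ θ t - path lam z₀ θ s = lam * ∫ v in s..t, θ v := by
  have := intervalIntegral.integral_interval_sub_left (h.intervalIntegrable 0 t)
    (h.intervalIntegrable 0 s)
  simp only [path, ← this]
  ring

theorem abs_path_sub_le (h : IsControl θ) (hlam : 0 < lam) (s t : ℝ) :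
    |path lam z₀ θ t - path lam z₀ θ s| ≤ lam * |t - s| := by
  rw [h.path_sub, abs_mul, abs_of_pos hlam]
  have := intervalIntegral.norm_integral_le_of_norm_le_const (a := s) (b := t) (f := θ) (C := 1)
    fun x _ => by simpa using h.abs_le_one x
  have h' : |∫ v in s..t, θ v| ≤ |t - s| := by simpa using this
  gcongr

theorem lipschitzWith_path (h : IsControl θ) (hlam : 0 < lam) :
    LipschitzWith (Real.toNNReal lam) (path lam z₀ θ) :=
  LipschitzWith.of_dist_le_mul fun s t => by
    rw [Real.dist_eq, Real.dist_eq, Real.coe_toNNReal _ hlam.le]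
    exact h.abs_path_sub_le hlam t s

theorem continuous_path (h : IsControl θ) (hlam : 0 < lam) : Continuous (path lam z₀ θ) :=
  (h.lipschitzWith_path hlam).continuous

theorem ae_hasDerivAt_path (h : IsControl θ) :
    ∀ᵐ t, HasDerivAt (path lam z₀ θ) (lam * θ t) t := by
  filter_upwards [_root_.LocallyIntegrable.ae_hasDerivAt_integral h.locallyIntegrable] with t ht
  exact ((ht 0).const_mul lam).const_add z₀

theorem hasDerivWithinAt_path (h : IsControl θ) {t : ℝ} (hc : ContinuousWithinAt θ (Ici t) t) :
    HasDerivWithinAt (path lam z₀ θ) (lam * θ t) (Ici t) t := by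
  have := intervalIntegral.integral_hasDerivWithinAt_right (s := Ici t) (t := Ioi t)
    (h.intervalIntegrable 0 t)
    (h.measurable.stronglyMeasurable.stronglyMeasurableAtFilter) (hc.mono Ioi_subset_Ici_self)
  exact (this.const_mul lam).const_add z₀

/-- The control is only measurable, so the chain rule holds only almost everywhere. But a
continuously differentiable function of a Lipschitz path is absolutely continuous on compact
intervals, which restores the fundamental theorem of calculus. The belief equation and the exact
integration of payoffs both rest on this. -/
theorem integral_deriv_comp_path (h : IsControl θ) (hlam : 0 < lam) {F F' : ℝ → ℝ}
    (hF : ∀ z, HasDerivAt F (F' z) z) (hF' : Continuous F') (s t : ℝ) :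
    ∫ v in s..t, F' (path lam z₀ θ v) * (lam * θ v) =
      F (path lam z₀ θ t) - F (path lam z₀ θ s) := by
  have hd : deriv F = F' := funext fun z => (hF z).deriv
  have hF1 : ContDiff ℝ 1 F := by
    rw [contDiff_one_iff_deriv, hd]
    exact ⟨fun z => (hF z).differentiableAt, hF'⟩
  have hζ := h.continuous_path (z₀ := z₀) hlam
  obtain ⟨C, hC⟩ := (isCompact_uIcc (a := s) (b := t)).exists_bound_of_continuousOn
    hζ.continuousOn
  obtain ⟨K, hK⟩ := hF1.contDiffOn.exists_lipschitzOnWith (s := Icc (-C) C) (by decide)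
    (convex_Icc _ _) isCompact_Icc
  have hmaps : MapsTo (path lam z₀ θ) (uIcc s t) (Icc (-C) C) := fun v hv =>
    abs_le.1 (by simpa using hC v hv)
  have hac : AbsolutelyContinuousOnInterval (fun v => F (path lam z₀ θ v)) s t :=
    (hK.comp (h.lipschitzWith_path hlam).lipschitzOnWith hmaps).absolutelyContinuousOnInterval
  rw [← hac.integral_deriv_eq_sub]
  apply intervalIntegral.integral_congr_ae
  filter_upwards [h.ae_hasDerivAt_path (lam := lam) (z₀ := z₀)] with v hv _
  exact ((hF _).comp v hv).deriv.symm

theorem path_le_of_ae_nonpos (h : IsControl θ) (hlam : 0 < lam) {s t : ℝ} (hst : s ≤ t)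
    (hθ : ∀ᵐ v, v ∈ Ioo s t → θ v ≤ 0) : path lam z₀ θ t ≤ path lam z₀ θ s := by
  have : ∫ v in s..t, θ v ≤ 0 := by
    rw [intervalIntegral.integral_of_le hst, integral_Ioc_eq_integral_Ioo]
    exact setIntegral_nonpos_ae measurableSet_Ioo hθ
  have h2 := h.path_sub (lam := lam) (z₀ := z₀) s t
  nlinarith

/-- If the control does not push up just above the level `q`, then `q` cannot be crossed upwards. -/
theorem path_le_of_barrier (h : IsControl θ) (hlam : 0 < lam) {s t q q' : ℝ}
    (hq : q < q') (hs : path lam z₀ θ s ≤ q)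
    (hθ : ∀ᵐ v, v ∈ Ioo s t → q < path lam z₀ θ v → path lam z₀ θ v < q' → θ v ≤ 0) :
    ∀ v ∈ Icc s t, path lam z₀ θ v ≤ q := by
  have hζ := h.continuous_path (z₀ := z₀) hlam
  have hcl : IsClosed {v | path lam z₀ θ v ≤ q} := isClosed_le hζ continuous_const
  -- Continuous induction: from a time at which the path is at most `q`, another such time is found
  -- arbitrarily soon afterwards.
  refine (hcl.inter isClosed_Icc).Icc_subset_of_forall_exists_gt (a := s) (b := t)
    (s := {v | path lam z₀ θ v ≤ q}) hs ?_
  rintro v ⟨hv, hvs, hvt⟩ y hy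
  have hnear : ∀ᶠ w in 𝓝[>] v, path lam z₀ θ w < q' :=
    ((hζ.tendsto v).mono_left inf_le_left).eventually
      (gt_mem_nhds (lt_of_le_of_lt hv hq))
  obtain ⟨e, he, hev⟩ := mem_nhdsGT_iff_exists_Ioo_subset.1 hnear
  set w := min y (min ((v + e) / 2) t) with hw
  have hve : v < (v + e) / 2 := by linarith [mem_Ioi.1 he]
  have hvw : v < w := lt_min hy (lt_min hve hvt)
  have hwe : w < e := lt_of_le_of_lt (min_le_right _ _)
    (lt_of_le_of_lt (min_le_left _ _) (by linarith [mem_Ioi.1 he]))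
  have hwt : w ≤ t := (min_le_right _ _).trans (min_le_right _ _)
  refine ⟨w, ?_, hvw, min_le_left _ _⟩
  -- `m` is the last time in `[v, w]` with the path at or below `q`. Between `m` and `w` the path
  -- would lie in `(q, q')`, where the control does not push up, so it is not above `q` at `w`
  -- either.
  obtain ⟨m, ⟨hmq, hm⟩, hmax⟩ := ((isCompact_Icc (a := v) (b := w)).inter_left hcl).exists_isGreatest
    ⟨v, hv, left_mem_Icc.2 hvw.le⟩
  refine le_trans (h.path_le_of_ae_nonpos hlam hm.2 ?_) hmq
  filter_upwards [hθ] with x hx hxm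
  refine hx ⟨hvs.trans_lt (hm.1.trans_lt hxm.1), hxm.2.trans_le hwt⟩ ?_
    (hev ⟨hm.1.trans_lt hxm.1, hxm.2.trans hwe⟩)
  by_contra hcon
  exact absurd (hmax ⟨not_lt.1 hcon, hm.1.trans hxm.1.le, hxm.2.le⟩) (not_le.2 hxm.1)

end IsControl

theorem path_zero (lam z₀ : ℝ) (θ : ℝ → ℝ) : path lam z₀ θ 0 = z₀ := by simp [path]

theorem path_neg (lam z₀ : ℝ) (θ : ℝ → ℝ) (t : ℝ) :
    path lam (-z₀) (fun t => -θ t) t = -path lam z₀ θ t := by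
  simp only [path, intervalIntegral.integral_neg]
  ring

theorem IsControl.le_path_of_barrier {θ : ℝ → ℝ} {lam z₀ : ℝ} (h : IsControl θ) (hlam : 0 < lam)
    {s t q q' : ℝ} (hq : q' < q) (hs : q ≤ path lam z₀ θ s)
    (hθ : ∀ᵐ v, v ∈ Ioo s t → path lam z₀ θ v < q → q' < path lam z₀ θ v → 0 ≤ θ v) :
    ∀ v ∈ Icc s t, q ≤ path lam z₀ θ v := by
  intro v hv
  have := h.neg.path_le_of_barrier (z₀ := -z₀) (q := -q) (q' := -q') hlam (neg_lt_neg hq)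
    (s := s) (t := t) (by rw [path_neg]; linarith)
    (by
      filter_upwards [hθ] with w hw h1 h2 h3
      rw [path_neg] at h2 h3
      have := hw h1 (by linarith) (by linarith)
      linarith) v hv
  rw [path_neg] at this
  linarith

theorem path_eq_of_ae {lam z₀ k : ℝ} {θ : ℝ → ℝ} {s t : ℝ} (h : IsControl θ) (hst : s ≤ t)
    (hθ : ∀ᵐ v, v ∈ Ioo s t → θ v = k) :
    path lam z₀ θ t = path lam z₀ θ s + lam * k * (t - s) := by
  have h1 := h.path_sub (lam := lam) (z₀ := z₀) s t
  have h2 : ∫ v in s..t, θ v = ∫ _ in s..t, k := by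
    rw [intervalIntegral.integral_of_le hst, intervalIntegral.integral_of_le hst,
      integral_Ioc_eq_integral_Ioo, integral_Ioc_eq_integral_Ioo]
    exact setIntegral_congr_ae measurableSet_Ioo hθ
  rw [h2, intervalIntegral.integral_const, smul_eq_mul] at h1
  linarith

/-! ### Deadlines, cost of a trajectory, and subsolutions of the dynamic programming equation. -/

/-- The times before the deadline `T`. -/
def before (T : ℝ≥0∞) : Set ℝ := {t | 0 ≤ t ∧ ENNReal.ofReal t < T}

theorem measurableSet_before (T : ℝ≥0∞) : MeasurableSet (before T) :=
  measurableSet_Ici.inter (measurableSet_lt ENNReal.measurable_ofReal measurable_const)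

theorem before_top : before ∞ = Ici 0 := by
  ext t; simp [before]

theorem before_of_ne_top {T : ℝ≥0∞} (hT : T ≠ ∞) : before T = Ico 0 T.toReal := by
  ext t
  simp only [before, mem_ofPred_eq, mem_Ico]
  exact and_congr_right fun ht => ENNReal.ofReal_lt_iff_lt_toReal ht hT

theorem before_mono {T : ℝ≥0∞} {s t : ℝ} (ht : t ∈ before T) (hs : 0 ≤ s) (hst : s ≤ t) :
    s ∈ before T :=
  ⟨hs, (ENNReal.ofReal_le_ofReal hst).trans_lt ht.2⟩

/-- This room to the right is what makes right derivatives available at every time before the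
deadline, including time 0. -/
theorem exists_gt_mem_before {T : ℝ≥0∞} {t : ℝ} (ht : t ∈ before T) :
    ∃ t' > t, t' ∈ before T := by
  by_cases hT : T = ∞
  · subst hT
    exact ⟨t + 1, by linarith, by rw [before_top]; exact add_nonneg ht.1 zero_le_one⟩
  · rw [before_of_ne_top hT] at ht ⊢
    obtain ⟨t', h1, h2⟩ := exists_between ht.2
    exact ⟨t', h1, ht.1.trans h1.le, h2⟩

/-- The discounted cost of a trajectory `ζ` with running cost `S` that is stopped at cost `ψ` at the
deadline `T`. -/
def regret (r : ℝ) (S ψ ζ : ℝ → ℝ) (T : ℝ≥0∞) : ℝ≥0∞ :=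
  (∫⁻ t in before T, ENNReal.ofReal (Real.exp (-(r * t)) * S (ζ t))) +
    if T = ∞ then 0 else ENNReal.ofReal (Real.exp (-(r * T.toReal)) * ψ (ζ T.toReal))

/-- At `z`, both one-sided derivatives of `φ` satisfy `r φ + lam |φ'| ≤ S`. -/
def SubAt (lam r : ℝ) (S φ : ℝ → ℝ) (z : ℝ) : Prop :=
  (∃ d, HasDerivWithinAt φ d (Iic z) z ∧ r * φ z + lam * |d| ≤ S z) ∧
    ∃ d, HasDerivWithinAt φ d (Ici z) z ∧ r * φ z + lam * |d| ≤ S z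

theorem SubAt.of_hasDerivAt {lam r d z : ℝ} {S φ : ℝ → ℝ} (h : HasDerivAt φ d z)
    (hd : r * φ z + lam * |d| ≤ S z) : SubAt lam r S φ z :=
  ⟨⟨d, h.hasDerivWithinAt, hd⟩, ⟨d, h.hasDerivWithinAt, hd⟩⟩

theorem SubAt.continuousAt {lam r z : ℝ} {S φ : ℝ → ℝ} (h : SubAt lam r S φ z) :
    ContinuousAt φ z := by
  obtain ⟨⟨d, h1, -⟩, ⟨e, h2, -⟩⟩ := h
  exact continuousAt_iff_continuous_left_right.2 ⟨h1.continuousWithinAt, h2.continuousWithinAt⟩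

theorem SubAt.mul_le {lam r z : ℝ} {S φ : ℝ → ℝ} (hlam : 0 < lam) (h : SubAt lam r S φ z) :
    r * φ z ≤ S z := by
  obtain ⟨⟨d, -, h1⟩, -⟩ := h
  nlinarith [abs_nonneg d]

theorem eventually_abs_sub_le_of_hasDerivWithinAt {φ : ℝ → ℝ} {d z e : ℝ} {s : Set ℝ}
    (h : HasDerivWithinAt φ d s z) (he : 0 < e) :
    ∀ᶠ w in 𝓝[s] z, |φ w - φ z| ≤ (|d| + e) * |w - z| := by
  have h' := (hasDerivWithinAt_iff_isLittleO.1 h).def he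
  filter_upwards [h'] with w hw
  simp only [Real.norm_eq_abs, smul_eq_mul] at hw
  have h3 : |φ w - φ z| ≤ |φ w - φ z - (w - z) * d| + |(w - z) * d| := by
    have := abs_add_le (φ w - φ z - (w - z) * d) ((w - z) * d)
    simpa using this
  rw [abs_mul] at h3
  nlinarith

/-- The two one-sided slope bounds merge into one local Lipschitz bound at `z`, which is all that
`monotone_total` needs. Hence a kink at `z` does no harm. -/
theorem SubAt.eventually_abs_sub_le {lam r z e : ℝ} {S φ : ℝ → ℝ} (hlam : 0 < lam)
    (h : SubAt lam r S φ z) (he : 0 < e) :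
    ∀ᶠ w in 𝓝 z, lam * |φ w - φ z| ≤ (S z - r * φ z + e) * |w - z| := by
  obtain ⟨⟨d, h1, h1'⟩, ⟨d', h2, h2'⟩⟩ := h
  have key : ∀ d, r * φ z + lam * |d| ≤ S z → ∀ w, |φ w - φ z| ≤ (|d| + e / lam) * |w - z| →
      lam * |φ w - φ z| ≤ (S z - r * φ z + e) * |w - z| := by
    intro d hd w hw
    calc lam * |φ w - φ z| ≤ lam * ((|d| + e / lam) * |w - z|) := by gcongr
      _ = (lam * |d| + e) * |w - z| := by field_simp
      _ ≤ _ := by gcongr; linarith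
  rw [← nhdsLE_sup_nhdsGE, eventually_sup]
  exact ⟨(eventually_abs_sub_le_of_hasDerivWithinAt h1 (by positivity)).mono (key d h1'),
    (eventually_abs_sub_le_of_hasDerivWithinAt h2 (by positivity)).mono (key d' h2')⟩

/-! ### Verification: the total cost along a trajectory. -/

section Verification

variable {lam r z₀ : ℝ} {S ψ φ θ : ℝ → ℝ}

/-- The cost accumulated until time `t` plus the discounted continuation value. -/
def total (r : ℝ) (S φ ζ : ℝ → ℝ) (t : ℝ) : ℝ :=
  (∫ s in (0 : ℝ)..t, Real.exp (-(r * s)) * S (ζ s)) + Real.exp (-(r * t)) * φ (ζ t)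

/-- A path of speed at most `lam` lets `φ` fall at rate at most `S − rφ`, exactly what the running
cost and the discounting of `φ` compensate. Since `φ` has kinks and the path is only Lipschitz, the
composition need not be differentiable; the argument uses right difference quotients of `−total` and
the mean value inequality for them. -/
theorem monotone_total (hlam : 0 < lam) (hS : Continuous S) (hφ : ∀ z, SubAt lam r S φ z)
    {ζ : ℝ → ℝ} (hζc : Continuous ζ) (hζ : ∀ s t, |ζ t - ζ s| ≤ lam * |t - s|) :
    Monotone (total r S φ ζ) := by
  have hφc : Continuous φ := continuous_iff_continuousAt.2 fun z => (hφ z).continuousAt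
  have hint : Continuous fun s => Real.exp (-(r * s)) * S (ζ s) := by fun_prop
  have hIc : ∀ t, HasDerivAt (fun t => ∫ s in (0 : ℝ)..t, Real.exp (-(r * s)) * S (ζ s))
      (Real.exp (-(r * t)) * S (ζ t)) t := fun t =>
    (hint.integral_hasStrictDerivAt 0 t).hasDerivAt
  have hIcont : Continuous fun t => ∫ s in (0 : ℝ)..t, Real.exp (-(r * s)) * S (ζ s) :=
    continuous_iff_continuousAt.2 fun t => (hIc t).continuousAt
  have hEc : Continuous (total r S φ ζ) := by unfold total; fun_prop
  intro p q hpq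
  have := image_le_of_liminf_slope_right_le_deriv_boundary (f := fun t => -total r S φ ζ t)
    (a := p) (b := q) (B := fun _ => -total r S φ ζ p) (B' := fun _ => 0)
    hEc.neg.continuousOn le_rfl continuousOn_const
    (fun x _ => hasDerivWithinAt_const _ _ _) ?_ (right_mem_Icc.2 hpq)
  · simpa using this
  intro x _ e he
  refine Eventually.frequently ?_
  -- The error is `e / 2` undiscounted to time `x`: after multiplication by `exp (−r x)` it costs `e
  -- / 2`, which leaves room below `e`.
  have hD : ∀ᶠ w in 𝓝[>] x, lam * |φ (ζ w) - φ (ζ x)| ≤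
      (S (ζ x) - r * φ (ζ x) + e / 2 * Real.exp (r * x)) * |ζ w - ζ x| :=
    ((hζc.tendsto x).mono_left inf_le_left).eventually
      ((hφ (ζ x)).eventually_abs_sub_le hlam (by positivity))
  have hexp : HasDerivAt (fun t => Real.exp (-(r * t))) (-r * Real.exp (-(r * x))) x := by
    have h0 : HasDerivAt (fun t => -(r * t)) (-r) x := by
      simpa using ((hasDerivAt_id x).const_mul r).fun_neg
    convert h0.exp using 1
    ring
  have hs1 : Tendsto (slope (fun t => ∫ s in (0 : ℝ)..t, Real.exp (-(r * s)) * S (ζ s)) x)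
      (𝓝[>] x) (𝓝 (Real.exp (-(r * x)) * S (ζ x))) :=
    (hasDerivAt_iff_tendsto_slope.1 (hIc x)).mono_left
      (nhdsWithin_mono _ fun y hy => ne_of_gt hy)
  have hs2 : Tendsto (slope (fun t => Real.exp (-(r * t))) x)
      (𝓝[>] x) (𝓝 (-r * Real.exp (-(r * x)))) :=
    (hasDerivAt_iff_tendsto_slope.1 hexp).mono_left
      (nhdsWithin_mono _ fun y hy => ne_of_gt hy)
  have hs3 : Tendsto (fun w => φ (ζ w)) (𝓝[>] x) (𝓝 (φ (ζ x))) :=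
    ((hφc.comp hζc).tendsto x).mono_left inf_le_left
  have hlim := (hs1.add (hs2.mul hs3)).sub_const (Real.exp (-(r * x)) *
    (S (ζ x) - r * φ (ζ x) + e / 2 * Real.exp (r * x)))
  have hval : Real.exp (-(r * x)) * S (ζ x) + -r * Real.exp (-(r * x)) * φ (ζ x) -
      Real.exp (-(r * x)) * (S (ζ x) - r * φ (ζ x) + e / 2 * Real.exp (r * x)) = -(e / 2) := by
    have : Real.exp (-(r * x)) * Real.exp (r * x) = 1 := by rw [← Real.exp_add]; simp
    linear_combination (-(e / 2)) * this
  rw [hval] at hlim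
  filter_upwards [hD, hlim.eventually (lt_mem_nhds (show -e < -(e / 2) by linarith)),
    self_mem_nhdsWithin] with w hw1 hw2 hw3
  have hwx : 0 < w - x := sub_pos.2 hw3
  have hζw : |ζ w - ζ x| ≤ lam * (w - x) := by simpa [abs_of_pos hwx] using hζ x w
  have hc : 0 ≤ S (ζ x) - r * φ (ζ x) + e / 2 * Real.exp (r * x) := by
    have := (hφ (ζ x)).mul_le hlam
    have h2 : 0 < e / 2 * Real.exp (r * x) := by positivity
    linarith
  have hφw : -((S (ζ x) - r * φ (ζ x) + e / 2 * Real.exp (r * x)) * (w - x)) ≤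
      φ (ζ w) - φ (ζ x) := by
    have h1 : lam * |φ (ζ w) - φ (ζ x)| ≤
        lam * ((S (ζ x) - r * φ (ζ x) + e / 2 * Real.exp (r * x)) * (w - x)) :=
      hw1.trans (by nlinarith)
    exact (abs_le.1 (le_of_mul_le_mul_left h1 hlam)).1
  have hE := mul_le_mul_of_nonneg_left hφw (Real.exp_pos (-(r * x))).le
  simp only [slope_def_field] at hw2 ⊢
  rw [div_lt_iff₀ hwx]
  have hm := mul_lt_mul_of_pos_right hw2 hwx
  have hne : w - x ≠ 0 := hwx.ne'
  have hexpand : ((((∫ s in (0 : ℝ)..w, Real.exp (-(r * s)) * S (ζ s)) -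
      ∫ s in (0 : ℝ)..x, Real.exp (-(r * s)) * S (ζ s)) / (w - x)) +
      (Real.exp (-(r * w)) - Real.exp (-(r * x))) / (w - x) * φ (ζ w) -
      Real.exp (-(r * x)) * (S (ζ x) - r * φ (ζ x) + e / 2 * Real.exp (r * x))) * (w - x) =
      ((∫ s in (0 : ℝ)..w, Real.exp (-(r * s)) * S (ζ s)) -
      ∫ s in (0 : ℝ)..x, Real.exp (-(r * s)) * S (ζ s)) +
      (Real.exp (-(r * w)) - Real.exp (-(r * x))) * φ (ζ w) -
      Real.exp (-(r * x)) * ((S (ζ x) - r * φ (ζ x) + e / 2 * Real.exp (r * x)) * (w - x)) := by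
    field_simp
  rw [hexpand] at hm
  simp only [total]
  linarith

theorem lintegral_Ico_ofReal {g : ℝ → ℝ} (hg : Continuous g) (hg0 : ∀ t, 0 ≤ g t) {τ : ℝ}
    (hτ : 0 ≤ τ) :
    ∫⁻ t in Ico 0 τ, ENNReal.ofReal (g t) = ENNReal.ofReal (∫ t in (0 : ℝ)..τ, g t) := by
  rw [intervalIntegral.integral_of_le hτ, integral_Ioc_eq_integral_Ioo, ← integral_Ico_eq_integral_Ioo,
    ofReal_integral_eq_lintegral_ofReal _ (Eventually.of_forall hg0)]
  exact (hg.integrableOn_Icc (a := 0) (b := τ)).mono_set Ico_subset_Icc_self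

theorem ofReal_integral_le_lintegral_Ici {g : ℝ → ℝ} (hg : Continuous g) (hg0 : ∀ t, 0 ≤ g t)
    {τ : ℝ} (hτ : 0 ≤ τ) :
    ENNReal.ofReal (∫ t in (0 : ℝ)..τ, g t) ≤ ∫⁻ t in Ici 0, ENNReal.ofReal (g t) := by
  rw [← lintegral_Ico_ofReal hg hg0 hτ]
  exact lintegral_mono_set Ico_subset_Ici_self

theorem lintegral_Ici_le {g : ℝ → ℝ} (hg : Continuous g) (hg0 : ∀ t, 0 ≤ g t) {C : ℝ≥0∞}
    (hC : ∀ τ, 0 ≤ τ → ENNReal.ofReal (∫ t in (0 : ℝ)..τ, g t) ≤ C) :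
    ∫⁻ t in Ici 0, ENNReal.ofReal (g t) ≤ C := by
  have hU : (Ici (0 : ℝ)) = ⋃ n : ℕ, Ico 0 (n : ℝ) := by
    ext t
    simp only [mem_Ici, mem_iUnion, mem_Ico]
    exact ⟨fun h => (exists_nat_gt t).imp fun n hn => ⟨h, hn⟩, fun ⟨_, h, _⟩ => h⟩
  rw [hU, setLIntegral_iUnion_of_directed _ (Monotone.directed_le fun m n hmn =>
    Ico_subset_Ico_right (by exact_mod_cast hmn))]
  refine iSup_le fun n => ?_
  rw [lintegral_Ico_ofReal hg hg0 n.cast_nonneg]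
  exact hC n n.cast_nonneg

section Bounds

variable {ζ : ℝ → ℝ} {M : ℝ} {T : ℝ≥0∞}

theorem regret_top : regret r S ψ ζ ∞ =
    ∫⁻ t in Ici 0, ENNReal.ofReal (Real.exp (-(r * t)) * S (ζ t)) := by
  simp [regret, before_top]

theorem regret_of_ne_top (hS : Continuous S) (hS0 : ∀ z, 0 ≤ S z) (hψ0 : ∀ z, 0 ≤ ψ z)
    (hζ : Continuous ζ) (hT : T ≠ ∞) :
    regret r S ψ ζ T = ENNReal.ofReal (total r S ψ ζ T.toReal) := by
  have hg0 : ∀ t, 0 ≤ Real.exp (-(r * t)) * S (ζ t) := fun t =>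
    mul_nonneg (Real.exp_pos _).le (hS0 _)
  rw [regret, before_of_ne_top hT, lintegral_Ico_ofReal (by fun_prop) hg0 ENNReal.toReal_nonneg,
    if_neg hT, ← ENNReal.ofReal_add, total]
  · exact intervalIntegral.integral_nonneg ENNReal.toReal_nonneg fun t _ => hg0 t
  · exact mul_nonneg (Real.exp_pos _).le (hψ0 _)

theorem total_zero (r : ℝ) (S φ ζ : ℝ → ℝ) : total r S φ ζ 0 = φ (ζ 0) := by simp [total]

theorem tendsto_exp_neg_mul_atTop (hr : 0 < r) (M : ℝ) :
    Tendsto (fun t => Real.exp (-(r * t)) * M) atTop (𝓝 0) := by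
  have : Tendsto (fun t : ℝ => Real.exp (-(r * t))) atTop (𝓝 0) :=
    Real.tendsto_exp_neg_atTop_nhds_zero.comp (tendsto_id.const_mul_atTop hr)
  simpa using this.mul_const M

/-- With an infinite deadline there is no terminal cost to compare with. By monotonicity the
comparison can be made at ever later times, when the discounted continuation value, at most `exp (−r
s) * M`, vanishes. -/
theorem total_le_regret_top (hr : 0 < r) (hS : Continuous S) (hS0 : ∀ z, 0 ≤ S z)
    (hφM : ∀ z, φ z ≤ M) (hζ : Continuous ζ)
    (hmono : Monotone (total r S φ ζ)) {t : ℝ} (ht : 0 ≤ t) :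
    ENNReal.ofReal (total r S φ ζ t) ≤ regret r S ψ ζ ∞ := by
  have hg0 : ∀ t, 0 ≤ Real.exp (-(r * t)) * S (ζ t) := fun t =>
    mul_nonneg (Real.exp_pos _).le (hS0 _)
  rw [regret_top]
  by_cases htop : (∫⁻ t in Ici 0, ENNReal.ofReal (Real.exp (-(r * t)) * S (ζ t))) = ∞
  · rw [htop]; exact le_top
  rw [← ENNReal.ofReal_toReal htop]
  apply ENNReal.ofReal_le_ofReal
  have hlim := (tendsto_exp_neg_mul_atTop hr M).const_add
    (∫⁻ t in Ici 0, ENNReal.ofReal (Real.exp (-(r * t)) * S (ζ t))).toReal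
  rw [add_zero] at hlim
  refine ge_of_tendsto hlim ?_
  filter_upwards [eventually_ge_atTop t] with s hs
  refine (hmono hs).trans ?_
  unfold total
  have h1 := ofReal_integral_le_lintegral_Ici (g := fun t => Real.exp (-(r * t)) * S (ζ t))
    (by fun_prop) hg0 (ht.trans hs)
  have h2 := (ENNReal.ofReal_le_iff_le_toReal htop).1 h1
  gcongr
  exact hφM _

/-- Verification: a subsolution below the stopping cost bounds the cost from below. -/
theorem ofReal_le_regret (hlam : 0 < lam) (hr : 0 < r) (hS : Continuous S) (hS0 : ∀ z, 0 ≤ S z)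
    (hφ : ∀ z, SubAt lam r S φ z) (hφ0 : ∀ z, 0 ≤ φ z) (hφψ : ∀ z, φ z ≤ ψ z)
    (hφM : ∀ z, φ z ≤ M) (hζc : Continuous ζ) (hζ : ∀ s t, |ζ t - ζ s| ≤ lam * |t - s|) :
    ENNReal.ofReal (φ (ζ 0)) ≤ regret r S ψ ζ T := by
  have hmono := monotone_total hlam hS hφ hζc hζ
  rw [← total_zero r S φ ζ]
  by_cases hT : T = ∞
  · subst hT
    exact total_le_regret_top hr hS hS0 hφM hζc hmono le_rfl
  · rw [regret_of_ne_top hS hS0 (fun z => (hφ0 z).trans (hφψ z)) hζc hT]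
    apply ENNReal.ofReal_le_ofReal
    refine (hmono (ENNReal.toReal_nonneg (a := T))).trans ?_
    unfold total
    gcongr
    exact hφψ _

/-- The monotone total starts at `φ (ζ 0)` and is bounded by the cost of the trajectory. If that
cost is no larger than the start, nothing can be lost: neither before the deadline nor in replacing
`φ` by `ψ` there. -/
theorem total_eq_of_regret_le (hlam : 0 < lam) (hr : 0 < r) (hS : Continuous S)
    (hS0 : ∀ z, 0 ≤ S z) (hφ : ∀ z, SubAt lam r S φ z) (hφ0 : ∀ z, 0 ≤ φ z)
    (hφψ : ∀ z, φ z ≤ ψ z) (hφM : ∀ z, φ z ≤ M) (hζc : Continuous ζ)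
    (hζ : ∀ s t, |ζ t - ζ s| ≤ lam * |t - s|)
    (hle : regret r S ψ ζ T ≤ ENNReal.ofReal (φ (ζ 0))) :
    (∀ t ∈ before T, total r S φ ζ t = φ (ζ 0)) ∧
      (T ≠ ∞ → φ (ζ T.toReal) = ψ (ζ T.toReal)) := by
  have hmono := monotone_total hlam hS hφ hζc hζ
  by_cases hT : T = ∞
  · subst hT
    refine ⟨fun t ht => le_antisymm ?_ ?_, fun h => absurd rfl h⟩
    · exact (ENNReal.ofReal_le_ofReal_iff (hφ0 _)).1
        ((total_le_regret_top hr hS hS0 hφM hζc hmono ht.1).trans hle)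
    · rw [← total_zero r S φ ζ]; exact hmono ht.1
  · rw [regret_of_ne_top hS hS0 (fun z => (hφ0 z).trans (hφψ z)) hζc hT,
      ENNReal.ofReal_le_ofReal_iff (hφ0 _)] at hle
    have h0 := total_zero r S φ ζ
    have hψ : total r S φ ζ T.toReal ≤ total r S ψ ζ T.toReal := by
      unfold total
      gcongr
      exact hφψ _
    have h1 := hmono (ENNReal.toReal_nonneg (a := T))
    refine ⟨fun t ht => le_antisymm ?_ ?_, fun _ => ?_⟩
    · rw [before_of_ne_top hT] at ht
      exact (hmono ht.2.le).trans (hψ.trans hle)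
    · rw [← h0]; exact hmono ht.1
    · have h2 : total r S φ ζ T.toReal = total r S ψ ζ T.toReal :=
        le_antisymm hψ (hle.trans (h0 ▸ h1))
      simp only [total, add_right_inj] at h2
      exact mul_left_cancel₀ (Real.exp_pos _).ne' h2

/-- The converse. For an infinite deadline the partial cost falls short of the constant total by a
nonnegative term, so no decay estimate is needed. -/
theorem regret_le_of_total_eq (hS : Continuous S)
    (hS0 : ∀ z, 0 ≤ S z) (hφc : Continuous φ) (hφ0 : ∀ z, 0 ≤ φ z)
    (hφψ : ∀ z, φ z ≤ ψ z) (hζc : Continuous ζ)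
    (hE : ∀ t ∈ before T, total r S φ ζ t = φ (ζ 0))
    (hend : T ≠ ∞ → φ (ζ T.toReal) = ψ (ζ T.toReal)) :
    regret r S ψ ζ T ≤ ENNReal.ofReal (φ (ζ 0)) := by
  have hg0 : ∀ t, 0 ≤ Real.exp (-(r * t)) * S (ζ t) := fun t =>
    mul_nonneg (Real.exp_pos _).le (hS0 _)
  have hgc : Continuous fun t => Real.exp (-(r * t)) * S (ζ t) := by fun_prop
  by_cases hT : T = ∞
  · subst hT
    rw [regret_top]
    refine lintegral_Ici_le hgc hg0 fun τ hτ => ENNReal.ofReal_le_ofReal ?_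
    have := hE τ (by rw [before_top]; exact hτ)
    unfold total at this
    have h2 : 0 ≤ Real.exp (-(r * τ)) * φ (ζ τ) := mul_nonneg (Real.exp_pos _).le (hφ0 _)
    linarith
  · rw [regret_of_ne_top hS hS0 (fun z => (hφ0 z).trans (hφψ z)) hζc hT]
    apply ENNReal.ofReal_le_ofReal
    have hEc : Continuous (total r S φ ζ) := by
      have : Continuous fun t => ∫ s in (0 : ℝ)..t, Real.exp (-(r * s)) * S (ζ s) :=
        intervalIntegral.continuous_primitive (fun _ _ => hgc.intervalIntegrable _ _) 0
      unfold total; fun_prop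
    have h1 : total r S ψ ζ T.toReal = total r S φ ζ T.toReal := by
      simp only [total, hend hT]
    rw [h1]
    rcases (ENNReal.toReal_nonneg (a := T)).eq_or_lt with h0 | h0
    · rw [← h0, total_zero]
    -- Constancy is known only strictly before the deadline and passes to it by continuity.
    · refine le_of_tendsto ((hEc.tendsto T.toReal).mono_left (nhdsWithin_le_nhds (s := Iio T.toReal))) ?_
      filter_upwards [Ioo_mem_nhdsLT h0] with t ht
      exact (hE t (by rw [before_of_ne_top hT]; exact ⟨ht.1.le, ht.2⟩)).le

/-- Solving the constant total for `φ (ζ t)` leaves an expression that is visibly differentiable in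
`t`, although `φ` may have kinks and `ζ` may fail to be differentiable. -/
theorem comp_eq_of_total_eq {t : ℝ} {C : ℝ} (h : total r S φ ζ t = C) :
    φ (ζ t) = Real.exp (r * t) * (C - ∫ s in (0 : ℝ)..t, Real.exp (-(r * s)) * S (ζ s)) := by
  have : Real.exp (r * t) * Real.exp (-(r * t)) = 1 := by rw [← Real.exp_add]; simp
  rw [← h, total]
  linear_combination (-φ (ζ t)) * this

/-- Along a trajectory with constant total cost, the continuation value moves at a known rate. -/
theorem hasDerivAt_of_total_eq (hS : Continuous S) (hζc : Continuous ζ) {C t : ℝ}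
    (ht : total r S φ ζ t = C) :
    HasDerivAt (fun t => Real.exp (r * t) *
      (C - ∫ s in (0 : ℝ)..t, Real.exp (-(r * s)) * S (ζ s))) (r * φ (ζ t) - S (ζ t)) t := by
  have hgc : Continuous fun t => Real.exp (-(r * t)) * S (ζ t) := by fun_prop
  have h1 := (hgc.integral_hasStrictDerivAt 0 t).hasDerivAt.const_sub C
  have h2 : HasDerivAt (fun t => Real.exp (r * t)) (Real.exp (r * t) * r) t := by
    simpa using ((hasDerivAt_id t).const_mul r).exp
  refine (h2.fun_mul h1).congr_deriv ?_
  have h4 : Real.exp (r * t) * Real.exp (-(r * t)) = 1 := by rw [← Real.exp_add]; simp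
  have h5 := comp_eq_of_total_eq ht
  rw [h5]
  linear_combination (-S (ζ t)) * h4

theorem hasDerivWithinAt_comp_of_total_eq (hS : Continuous S) (hζc : Continuous ζ) {C t : ℝ}
    (hE : ∀ t ∈ before T, total r S φ ζ t = C) (ht : t ∈ before T) :
    HasDerivWithinAt (fun t => φ (ζ t)) (r * φ (ζ t) - S (ζ t)) (Ici t) t := by
  obtain ⟨t', htt', ht'⟩ := exists_gt_mem_before ht
  refine (hasDerivAt_of_total_eq hS hζc (hE t ht)).hasDerivWithinAt.congr_of_eventuallyEq ?_
    (comp_eq_of_total_eq (hE t ht))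
  filter_upwards [Icc_mem_nhdsGE htt'] with s hs
  exact comp_eq_of_total_eq (hE s (before_mono ht' (ht.1.trans hs.1) hs.2))

theorem hasDerivAt_comp_of_total_eq (hS : Continuous S) (hζc : Continuous ζ) {C t : ℝ}
    (hE : ∀ t ∈ before T, total r S φ ζ t = C) (ht : t ∈ before T) (h0 : 0 < t) :
    HasDerivAt (fun t => φ (ζ t)) (r * φ (ζ t) - S (ζ t)) t := by
  obtain ⟨t', htt', ht'⟩ := exists_gt_mem_before ht
  refine (hasDerivAt_of_total_eq hS hζc (hE t ht)).congr_of_eventuallyEq ?_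
  filter_upwards [Icc_mem_nhds h0 htt'] with s hs
  exact comp_eq_of_total_eq (hE s (before_mono ht' hs.1 hs.2))

end Bounds

end Verification

theorem ae_ne_real (a : ℝ) : ∀ᵐ t : ℝ, t ≠ a := by simp [ae_iff, measure_singleton]

/-! ### What a constant total forces on the trajectory. -/

section OptimalTrajectories

variable {lam r z₀ C : ℝ} {S φ θ : ℝ → ℝ} {T : ℝ≥0∞}

/-- The derivative of `φ` along the path is computed twice: by the chain rule, and from the
constancy of the total. Quantifying over `d` inside means that one null set of times serves for all
later uses. -/
theorem ae_deriv_mul_eq (hS : Continuous S) (hlam : 0 < lam) (hθ : IsControl θ)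
    (hE : ∀ t ∈ before T, total r S φ (path lam z₀ θ) t = C) :
    ∀ᵐ t, t ∈ before T → ∀ d, HasDerivAt φ d (path lam z₀ θ t) →
      d * (lam * θ t) = r * φ (path lam z₀ θ t) - S (path lam z₀ θ t) := by
  filter_upwards [hθ.ae_hasDerivAt_path (lam := lam) (z₀ := z₀), ae_ne_real 0] with t ht h0 htT d hd
  have h1 := hasDerivAt_comp_of_total_eq hS (hθ.continuous_path hlam) hE htT
    (lt_of_le_of_ne htT.1 h0.symm)
  exact (hd.comp t ht).unique h1

/-- Where the dynamic programming equation holds with positive slope, the required rate of decrease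
is the largest possible one, so only full speed down attains it. -/
theorem ae_eq_neg_one (hS : Continuous S) (hlam : 0 < lam) (hθ : IsControl θ)
    (hE : ∀ t ∈ before T, total r S φ (path lam z₀ θ) t = C) :
    ∀ᵐ t, t ∈ before T → ∀ d, HasDerivAt φ d (path lam z₀ θ t) → 0 < d →
      r * φ (path lam z₀ θ t) + lam * d = S (path lam z₀ θ t) → θ t = -1 := by
  filter_upwards [ae_deriv_mul_eq hS hlam hθ hE] with t ht htT d hd h0 h1
  have := ht htT d hd
  have h2 : (lam * d) * (θ t + 1) = 0 := by linear_combination this + h1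
  rcases mul_eq_zero.1 h2 with h3 | h3
  · exact absurd h3 (by positivity)
  · linarith

theorem ae_eq_one (hS : Continuous S) (hlam : 0 < lam) (hθ : IsControl θ)
    (hE : ∀ t ∈ before T, total r S φ (path lam z₀ θ) t = C) :
    ∀ᵐ t, t ∈ before T → ∀ d, HasDerivAt φ d (path lam z₀ θ t) → d < 0 →
      r * φ (path lam z₀ θ t) - lam * d = S (path lam z₀ θ t) → θ t = 1 := by
  filter_upwards [ae_deriv_mul_eq hS hlam hθ hE] with t ht htT d hd h0 h1
  have := ht htT d hd
  have h2 : (lam * d) * (θ t - 1) = 0 := by linear_combination this + h1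
  rcases mul_eq_zero.1 h2 with h3 | h3
  · exact absurd h3 (mul_neg_of_pos_of_neg hlam h0).ne
  · linarith

theorem exists_mem_before_of_ae {t e : ℝ} (ht : t ∈ before T) (he : t < e) {p : ℝ → Prop}
    (hp : ∀ᵐ s, s ∈ before T → p s) : ∃ s, t < s ∧ s < e ∧ s ∈ before T ∧ p s := by
  obtain ⟨t', htt', ht'⟩ := exists_gt_mem_before ht
  have hne : (volume.restrict (Ioo t (min t' e))) ≠ 0 := by
    rw [Ne, Measure.restrict_eq_zero, Real.volume_Ioo]
    simp [htt', he]
  have : ∀ᵐ s ∂volume.restrict (Ioo t (min t' e)), s ∈ Ioo t (min t' e) ∧ (s ∈ before T → p s) :=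
    (ae_restrict_mem measurableSet_Ioo).and (ae_restrict_of_ae hp)
  have hne' : (ae (volume.restrict (Ioo t (min t' e)))).NeBot := ae_neBot.2 hne
  obtain ⟨s, hs, hps⟩ := this.exists
  have hsT := before_mono ht' (ht.1.trans hs.1.le) (hs.2.le.trans (min_le_left _ _))
  exact ⟨s, hs.1, hs.2.trans_le (min_le_right _ _), hsT, hps hsT⟩

/-- Under the strict inequality the required rate `rφ − S` lies below `−lam * |d|`, the fastest
decrease that speed `lam` permits. So optimal learning never visits the interior of the region where
stopping is strictly better. -/
theorem not_eventually_strict (hS : Continuous S) (hlam : 0 < lam) (hθ : IsControl θ)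
    (hE : ∀ t ∈ before T, total r S φ (path lam z₀ θ) t = C) {t : ℝ} (ht : t ∈ before T)
    (hstrict : ∀ᶠ z in 𝓝 (path lam z₀ θ t), ∃ d, HasDerivAt φ d z ∧ r * φ z + lam * |d| < S z) :
    False := by
  have h1 := (hθ.continuous_path (z₀ := z₀) hlam).continuousAt.eventually hstrict
  obtain ⟨e, he, h2⟩ := mem_nhdsGE_iff_exists_Ico_subset.1 (mem_nhdsWithin_of_mem_nhds h1 :
    _ ∈ 𝓝[≥] t)
  obtain ⟨s, hts, hse, hs, hp⟩ := exists_mem_before_of_ae ht he (ae_deriv_mul_eq hS hlam hθ hE)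
  obtain ⟨d, hd, hlt⟩ := h2 ⟨hts.le, hse⟩
  have := hp d hd
  have h3 : |d * (lam * θ s)| ≤ lam * |d| := by
    rw [abs_mul, abs_mul, abs_of_pos hlam]
    have := mul_le_mul_of_nonneg_left (hθ.abs_le_one s) (mul_nonneg hlam.le (abs_nonneg d))
    linarith
  have := neg_abs_le (d * (lam * θ s))
  linarith

/-- The strict inequality excludes positions below `lo`. A visit to `lo` is excluded as well: just
above it the path must move down at full speed, so it would be below `lo` immediately afterwards. -/
theorem lt_path_of_total_eq (hS : Continuous S) (hlam : 0 < lam) (hθ : IsControl θ)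
    (hE : ∀ t ∈ before T, total r S φ (path lam z₀ θ) t = C) {lo k : ℝ} (hk : lo < k)
    (hout : ∀ z < lo, ∃ d, HasDerivAt φ d z ∧ r * φ z + lam * |d| < S z)
    (hdown : ∀ z ∈ Ico lo k, ∃ d, HasDerivAt φ d z ∧ 0 < d ∧ r * φ z + lam * d = S z)
    {t : ℝ} (ht : t ∈ before T) : lo < path lam z₀ θ t := by
  have hζ := hθ.continuous_path (z₀ := z₀) hlam
  have hge : ∀ t ∈ before T, lo ≤ path lam z₀ θ t := fun t ht => by
    by_contra hlt
    exact not_eventually_strict hS hlam hθ hE ht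
      ((gt_mem_nhds (not_le.1 hlt)).mono fun z hz => hout z hz)
  refine lt_of_le_of_ne (hge t ht) fun heq => ?_
  obtain ⟨t', htt', ht'⟩ := exists_gt_mem_before ht
  have hnear : ∀ᶠ s in 𝓝[≥] t, path lam z₀ θ s < k :=
    ((hζ.tendsto t).mono_left inf_le_left).eventually (gt_mem_nhds (heq ▸ hk))
  obtain ⟨e, he, hev⟩ := mem_nhdsGE_iff_exists_Ico_subset.1 hnear
  set s := min t' ((t + e) / 2) with hs
  have hts : t < s := lt_min htt' (by linarith [mem_Ioi.1 he])
  have hse : s < e := (min_le_right _ _).trans_lt (by linarith [mem_Ioi.1 he])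
  have hsT : s ∈ before T := before_mono ht' (ht.1.trans hts.le) (min_le_left _ _)
  have hae : ∀ᵐ v, v ∈ Ioo t s → θ v = -1 := by
    filter_upwards [ae_eq_neg_one hS hlam hθ hE] with v hv hvm
    have hvT := before_mono hsT (ht.1.trans hvm.1.le) hvm.2.le
    obtain ⟨d, hd, h0, h1⟩ := hdown _ ⟨hge v hvT, hev ⟨hvm.1.le, hvm.2.trans hse⟩⟩
    exact hv hvT d hd h0 h1
  have := path_eq_of_ae (lam := lam) (z₀ := z₀) hθ hts.le hae
  have h2 := hge s hsT
  nlinarith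

/-- A trajectory with constant total cost leaves a concave kink at once, to one side. -/
theorem leaves_of_total_eq (hS : Continuous S) (hlam : 0 < lam) (hθ : IsControl θ)
    (hE : ∀ t ∈ before T, total r S φ (path lam z₀ θ) t = C) (hk : r * φ z₀ < S z₀)
    (h0 : (0 : ℝ) ∈ before T) :
    ∃ e > 0, (∀ t ∈ Ioo 0 e, t ∈ before T) ∧
      ((∀ t ∈ Ioo 0 e, path lam z₀ θ t < z₀) ∨ ∀ t ∈ Ioo 0 e, z₀ < path lam z₀ θ t) := by
  have hζ := hθ.continuous_path (z₀ := z₀) hlam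
  have hd := hasDerivWithinAt_comp_of_total_eq hS hζ hE h0
  rw [path_zero] at hd
  -- The right derivative of `φ` along the path at time 0 is `rφ − S < 0`, so the path does not
  -- return to `z₀` for a while; by the intermediate value theorem it stays on one side.
  have hne : ∀ᶠ t in 𝓝[>] (0 : ℝ), path lam z₀ θ t ≠ z₀ := by
    have h1 := ((hasDerivWithinAt_iff_tendsto_slope' self_notMem_Ioi).1
      (hd.mono Ioi_subset_Ici_self)).eventually
      (gt_mem_nhds (sub_neg.2 hk))
    filter_upwards [h1, self_mem_nhdsWithin] with t ht ht0 heq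
    simp [slope_def_field, heq, path_zero] at ht
  obtain ⟨t', ht', hT'⟩ := exists_gt_mem_before h0
  obtain ⟨e, he, hev⟩ := mem_nhdsGT_iff_exists_Ioo_subset.1 hne
  refine ⟨min e t', lt_min he ht', fun t ht => before_mono hT' ht.1.le
    (ht.2.le.trans (min_le_right _ _)), ?_⟩
  by_contra! hcon
  obtain ⟨⟨t₁, h1, h1'⟩, ⟨t₂, h2, h2'⟩⟩ := hcon
  obtain ⟨t, ht, hteq⟩ := isPreconnected_Ioo.intermediate_value h2 h1 hζ.continuousOn ⟨h2', h1'⟩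
  exact hev ⟨ht.1, ht.2.trans_le (min_le_left _ _)⟩ hteq

/-- A trajectory with constant total cost is never at a local maximum after time `0`. -/
theorem path_ne_of_isLocalMax (hS : Continuous S) (hlam : 0 < lam) (hθ : IsControl θ)
    (hE : ∀ t ∈ before T, total r S φ (path lam z₀ θ) t = C) {k : ℝ} (hk : r * φ k < S k)
    (hmax : IsLocalMax φ k) {t : ℝ} (ht : t ∈ before T) (h0 : 0 < t) : path lam z₀ θ t ≠ k := by
  rintro rfl
  have hd := hasDerivAt_comp_of_total_eq hS (hθ.continuous_path (z₀ := z₀) hlam) hE ht h0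
  -- At a positive time a maximum of `φ` in space would be a maximum in time, with derivative zero;
  -- but the derivative is `rφ − S < 0`.
  have : IsLocalMax (fun t => φ (path lam z₀ θ t)) t :=
    (hθ.continuous_path (z₀ := z₀) hlam).continuousAt.eventually hmax
  have := this.hasDerivAt_eq_zero hd
  linarith

/-- The rate `rφ − S` of the continuation value exactly offsets running cost and discounting, so the
total has derivative zero. This is how explicit trajectories are shown to be optimal. -/
theorem total_eq_of_hasDerivAt {ζ : ℝ → ℝ} (hS : Continuous S) (hφ : Continuous φ)
    (hζ : Continuous ζ) {s t : ℝ} (hst : s ≤ t)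
    (hd : ∀ v ∈ Ioo s t, HasDerivAt (fun v => φ (ζ v)) (r * φ (ζ v) - S (ζ v)) v) :
    total r S φ ζ t = total r S φ ζ s := by
  rcases hst.eq_or_lt with rfl | hlt
  · rfl
  have hgc : Continuous fun t => Real.exp (-(r * t)) * S (ζ t) := by fun_prop
  have hEc : Continuous (total r S φ ζ) := by
    have : Continuous fun t => ∫ s in (0 : ℝ)..t, Real.exp (-(r * s)) * S (ζ s) :=
      intervalIntegral.continuous_primitive (fun _ _ => hgc.intervalIntegrable _ _) 0
    unfold total; fun_prop
  obtain ⟨c, -, hc⟩ := exists_hasDerivAt_eq_slope (total r S φ ζ) (fun _ => 0) hlt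
    hEc.continuousOn fun v hv => by
      have h1 := (hgc.integral_hasStrictDerivAt 0 v).hasDerivAt
      have h2 : HasDerivAt (fun t => Real.exp (-(r * t))) (Real.exp (-(r * v)) * (-r)) v := by
        simpa using ((hasDerivAt_id v).const_mul r).fun_neg.exp
      refine (h1.add (h2.fun_mul (hd v hv))).congr_deriv ?_
      ring
  have h2 : t - s ≠ 0 := (sub_pos.2 hlt).ne'
  field_simp at hc
  linarith

end OptimalTrajectories

/-! ### From almost everywhere information about the control to the explicit trajectory. -/

section ExplicitTrajectories

variable {lam z₀ lo k hi : ℝ} {θ : ℝ → ℝ} {T : ℝ≥0∞}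

/-- A trajectory that is pushed down throughout `(lo, k)` and stopped outside `(lo, hi)`. -/
theorem descent (hlam : 0 < lam) (hθ : IsControl θ)
    (hin : ∀ t ∈ before T, lo < path lam z₀ θ t)
    (hend : T ≠ ∞ → path lam z₀ θ T.toReal ∉ Ioo lo hi) (hkhi : k < hi)
    (hae : ∀ᵐ t, t ∈ before T → path lam z₀ θ t < k → θ t = -1) (h0 : lo < z₀)
    (hstart : z₀ < k ∨ z₀ = k ∧ ∃ e > 0, ∀ t ∈ Ioo 0 e, path lam z₀ θ t < k) :
    T = ENNReal.ofReal ((z₀ - lo) / lam) ∧ ∀ᵐ t, t ∈ before T → θ t = -1 := by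
  have hz : z₀ ≤ k := by
    rcases hstart with h | h
    · exact h.le
    · exact h.1.le
  -- Any level already reached below `k` is a barrier, because the control pushes down everywhere
  -- between it and `k`.
  have hbar : ∀ s t, 0 ≤ s → path lam z₀ θ s < k → t ∈ before T → s ≤ t → path lam z₀ θ t < k := by
    intro s t h0s hs ht hst
    refine (hθ.path_le_of_barrier hlam hs le_rfl (t := t) ?_ t ⟨hst, le_rfl⟩).trans_lt hs
    filter_upwards [hae] with v hv hvm _ h3
    rw [hv (before_mono ht (h0s.trans hvm.1.le) hvm.2.le) h3]
    norm_num
  have hlt : ∀ t ∈ before T, 0 < t → path lam z₀ θ t < k := by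
    intro t ht ht0
    rcases hstart with h | ⟨-, e, he, h⟩
    · exact hbar 0 t le_rfl (by rwa [path_zero]) ht ht.1
    · have hm : 0 < min t (e / 2) := by positivity
      exact hbar (min t (e / 2)) t hm.le
        (h _ ⟨hm, (min_le_right _ _).trans_lt (by linarith)⟩) ht (min_le_left _ _)
  have hae' : ∀ᵐ t, t ∈ before T → θ t = -1 := by
    filter_upwards [hae, ae_ne_real 0] with t ht h0 htT
    exact ht htT (hlt t htT (lt_of_le_of_ne htT.1 h0.symm))
  refine ⟨?_, hae'⟩
  have heq : ∀ t, 0 ≤ t → (∀ v ∈ Ioo 0 t, v ∈ before T) → path lam z₀ θ t = z₀ - lam * t := by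
    intro t ht hv
    have := path_eq_of_ae (lam := lam) (z₀ := z₀) hθ ht (k := -1)
      (hae'.mono fun v h hm => h (hv v hm))
    rw [this, path_zero]; ring
  have hτ : 0 ≤ (z₀ - lo) / lam := div_nonneg (by linarith) hlam.le
  -- At this time the path would be at `lo`, which it may not be before the deadline.
  have hnot : (z₀ - lo) / lam ∉ before T := fun hmem => by
    have h1 := hin _ hmem
    rw [heq _ hτ fun v hv => before_mono hmem hv.1.le hv.2.le] at h1
    field_simp at h1
    linarith
  have hTle : T ≤ ENNReal.ofReal ((z₀ - lo) / lam) := not_lt.1 fun h => hnot ⟨hτ, h⟩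
  have hT : T ≠ ∞ := ne_top_of_le_ne_top ENNReal.ofReal_ne_top hTle
  refine le_antisymm hTle ((ENNReal.ofReal_le_iff_le_toReal hT).2 ?_)
  by_contra hcon
  push Not at hcon
  -- An earlier deadline would find the path strictly inside `(lo, hi)`.
  refine hend hT ?_
  rw [heq _ ENNReal.toReal_nonneg fun v hv => by rw [before_of_ne_top hT]; exact ⟨hv.1.le, hv.2⟩]
  rw [lt_div_iff₀ hlam] at hcon
  have h2 : 0 ≤ lam * T.toReal := mul_nonneg hlam.le ENNReal.toReal_nonneg
  constructor <;> linarith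

theorem ascent (hlam : 0 < lam) (hθ : IsControl θ)
    (hin : ∀ t ∈ before T, path lam z₀ θ t < hi)
    (hend : T ≠ ∞ → path lam z₀ θ T.toReal ∉ Ioo lo hi) (hlok : lo < k)
    (hae : ∀ᵐ t, t ∈ before T → k < path lam z₀ θ t → θ t = 1) (h0 : z₀ < hi)
    (hstart : k < z₀ ∨ z₀ = k ∧ ∃ e > 0, ∀ t ∈ Ioo 0 e, k < path lam z₀ θ t) :
    T = ENNReal.ofReal ((hi - z₀) / lam) ∧ ∀ᵐ t, t ∈ before T → θ t = 1 := by
  have := descent (z₀ := -z₀) (lo := -hi) (hi := -lo) (k := -k) (T := T) hlam hθ.neg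
    (fun t ht => by rw [path_neg]; exact neg_lt_neg (hin t ht))
    (fun hT h => hend hT (by rw [path_neg] at h; exact ⟨by linarith [h.2], by linarith [h.1]⟩))
    (neg_lt_neg hlok)
    (hae.mono fun t h ht h2 => by rw [path_neg] at h2; rw [h ht (by linarith)])
    (neg_lt_neg h0)
    (by
      rcases hstart with h | ⟨h, e, he, h2⟩
      · exact Or.inl (neg_lt_neg h)
      · refine Or.inr ⟨by rw [h], e, he, fun t ht => ?_⟩
        rw [path_neg]; exact neg_lt_neg (h2 t ht))
  refine ⟨by rw [this.1]; congr 2; ring, this.2.mono fun t h ht => ?_⟩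
  have := h ht
  linarith

/-- A trajectory that is pushed towards `q` from both sides and may only be stopped outside
`(lo, hi)`. -/
theorem approach_left {kl q kr : ℝ} (hlam : 0 < lam) (hθ : IsControl θ)
    (hend : T ≠ ∞ → path lam z₀ θ T.toReal ∉ Ioo lo hi)
    (hlo : lo < kl) (hq : q < kr) (hhi : q < hi)
    (hae : ∀ᵐ t, t ∈ before T → kl < path lam z₀ θ t → path lam z₀ θ t < q → θ t = 1)
    (hae' : ∀ᵐ t, t ∈ before T → q < path lam z₀ θ t → path lam z₀ θ t < kr → θ t = -1)
    (hz : z₀ ≤ q)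
    (hstart : kl < z₀ ∨ z₀ = kl ∧ ∃ e > 0, ∀ t ∈ Ioo 0 e, kl < path lam z₀ θ t) :
    T = ∞ ∧ ∀ᵐ t, t ∈ before T → θ t = if t < (q - z₀) / lam then 1 else 0 := by
  have hkz : kl ≤ z₀ := by
    rcases hstart with h | h
    · exact h.le
    · exact h.1.ge
  -- `q` is a barrier from below, because the control pushes down just above it; `hmono` uses the
  -- upward push to show that no level reached above `kl` is ever lost.
  have hup : ∀ t, 0 ≤ t → (∀ v ∈ Ioo 0 t, v ∈ before T) → path lam z₀ θ t ≤ q := by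
    intro t ht hv
    refine hθ.path_le_of_barrier hlam hq (by rwa [path_zero]) (t := t) ?_ t ⟨ht, le_rfl⟩
    filter_upwards [hae'] with v h hvm h2 h3
    rw [h (hv v hvm) h2 h3]
    norm_num
  have hmono : ∀ s t, 0 ≤ s → s ≤ t → (∀ v ∈ Ioo 0 t, v ∈ before T) → kl < path lam z₀ θ s →
      path lam z₀ θ s ≤ path lam z₀ θ t := by
    intro s t h0s hst hv hs
    refine hθ.le_path_of_barrier hlam hs le_rfl (t := t) ?_ t ⟨hst, le_rfl⟩
    filter_upwards [hae] with v h hvm h2 h3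
    have hsq : path lam z₀ θ s ≤ q := hup s h0s fun w hw => hv w ⟨hw.1, hw.2.trans_le hst⟩
    rw [h (hv v ⟨h0s.trans_lt hvm.1, hvm.2⟩) h3 (h2.trans_le hsq)]
    norm_num
  have hlt : ∀ t, 0 < t → (∀ v ∈ Ioo 0 t, v ∈ before T) → kl < path lam z₀ θ t := by
    intro t ht hv
    rcases hstart with h | ⟨-, e, he, h⟩
    · have := hmono 0 t le_rfl ht.le hv (by rwa [path_zero])
      rw [path_zero] at this
      exact h.trans_le this
    · have hm : 0 < min t (e / 2) := by positivity
      have hk := h (min t (e / 2)) ⟨hm, (min_le_right _ _).trans_lt (by linarith)⟩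
      exact hk.trans_le (hmono _ t hm.le (min_le_left _ _) hv hk)
  have hT : T = ∞ := by
    by_contra hT
    have hv : ∀ v ∈ Ioo 0 T.toReal, v ∈ before T := fun v hv => by
      rw [before_of_ne_top hT]; exact ⟨hv.1.le, hv.2⟩
    refine hend hT ⟨?_, (hup _ ENNReal.toReal_nonneg hv).trans_lt hhi⟩
    rcases (ENNReal.toReal_nonneg (a := T)).eq_or_lt with h0 | h0
    · rw [← h0, path_zero]; linarith
    · exact hlo.trans (hlt _ h0 hv)
  subst hT
  rw [before_top] at *
  have hmem : ∀ t : ℝ, ∀ v ∈ Ioo 0 t, v ∈ Ici (0 : ℝ) := fun t v hv => hv.1.le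
  refine ⟨rfl, ?_⟩
  -- Until this time the speed limit alone keeps the path below `q`, so the control is known to be
  -- 1; the path therefore reaches `q` exactly then.
  have hone : ∀ᵐ v, v ∈ Ioo 0 ((q - z₀) / lam) → θ v = 1 := by
    filter_upwards [hae] with v h hvm
    refine h hvm.1.le (hlt v hvm.1 (hmem v)) ?_
    have h1 := (abs_le.1 (hθ.abs_path_sub_le (z₀ := z₀) hlam 0 v)).2
    rw [path_zero, sub_zero, abs_of_pos hvm.1] at h1
    have h2 := hvm.2
    rw [lt_div_iff₀ hlam] at h2
    linarith
  have hτ : 0 ≤ (q - z₀) / lam := div_nonneg (by linarith) hlam.le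
  have hpτ : path lam z₀ θ ((q - z₀) / lam) = q := by
    rw [path_eq_of_ae hθ hτ hone, path_zero]
    field_simp
    ring
  have hstay : ∀ t, (q - z₀) / lam ≤ t → path lam z₀ θ t = q := by
    intro t ht
    refine le_antisymm (hup t (hτ.trans ht) (hmem t)) ?_
    -- `kl = q` is not excluded by the hypotheses; in that degenerate case the path starts at `q`
    -- and the lower bound comes from `hlt` instead of `hmono`.
    rcases (hkz.trans hz).eq_or_lt with h | h
    · have h0 : z₀ = q := le_antisymm hz (h ▸ hkz)
      rcases (hτ.trans ht).eq_or_lt with h' | h'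
      · rw [← h', path_zero, h0]
      · exact h ▸ (hlt t h' (hmem t)).le
    · have := hmono _ t hτ ht (hmem t) (by rwa [hpτ])
      rwa [hpτ] at this
  filter_upwards [hone, hθ.ae_hasDerivAt_path (lam := lam) (z₀ := z₀), ae_ne_real 0,
    ae_ne_real ((q - z₀) / lam)] with t h1 h2 h3 h4 ht
  split_ifs with h
  · exact h1 ⟨lt_of_le_of_ne ht h3.symm, h⟩
  · have hlt' : (q - z₀) / lam < t := lt_of_le_of_ne (not_lt.1 h) h4.symm
    -- The path is constant from here on, so its almost everywhere derivative `lam * θ` vanishes.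
    have hc : HasDerivAt (path lam z₀ θ) 0 t :=
      (hasDerivAt_const t q).congr_of_eventuallyEq
        ((lt_mem_nhds hlt').mono fun v hv => hstay v (le_of_lt hv))
    have := h2.unique hc
    exact (mul_eq_zero.1 this).resolve_left hlam.ne'

theorem approach_right {kl q kr : ℝ} (hlam : 0 < lam) (hθ : IsControl θ)
    (hend : T ≠ ∞ → path lam z₀ θ T.toReal ∉ Ioo lo hi)
    (hhi : kr < hi) (hq : kl < q) (hlo : lo < q)
    (hae : ∀ᵐ t, t ∈ before T → kl < path lam z₀ θ t → path lam z₀ θ t < q → θ t = 1)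
    (hae' : ∀ᵐ t, t ∈ before T → q < path lam z₀ θ t → path lam z₀ θ t < kr → θ t = -1)
    (hz : q ≤ z₀)
    (hstart : z₀ < kr ∨ z₀ = kr ∧ ∃ e > 0, ∀ t ∈ Ioo 0 e, path lam z₀ θ t < kr) :
    T = ∞ ∧ ∀ᵐ t, t ∈ before T → θ t = if t < (z₀ - q) / lam then -1 else 0 := by
  have := approach_left (z₀ := -z₀) (lo := -hi) (hi := -lo) (kl := -kr) (q := -q) (kr := -kl)
    (T := T) hlam hθ.neg
    (fun hT h => hend hT (by rw [path_neg] at h; exact ⟨by linarith [h.2], by linarith [h.1]⟩))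
    (neg_lt_neg hhi) (neg_lt_neg hq) (neg_lt_neg hlo)
    (hae'.mono fun t h ht h2 h3 => by
      rw [path_neg] at h2 h3; rw [h ht (by linarith) (by linarith), neg_neg])
    (hae.mono fun t h ht h2 h3 => by
      rw [path_neg] at h2 h3; rw [h ht (by linarith) (by linarith)])
    (neg_le_neg hz)
    (by
      rcases hstart with h | ⟨h, e, he, h2⟩
      · exact Or.inl (neg_lt_neg h)
      · refine Or.inr ⟨by rw [h], e, he, fun t ht => ?_⟩
        rw [path_neg]; exact neg_lt_neg (h2 t ht))
  refine ⟨this.1, this.2.mono fun t h ht => ?_⟩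
  have h2 := h ht
  rw [show (-q - -z₀) / lam = (z₀ - q) / lam by ring] at h2
  split_ifs at h2 ⊢ <;> linarith

end ExplicitTrajectories

/-! ### The flow loss and comparison for linear first-order equations. -/

/-- The expected flow loss, normalized, at log-likelihood ratio `z`. -/
def flow (a b z : ℝ) : ℝ := a * Real.exp (z / 2) + b * Real.exp (-z / 2)

theorem continuous_flow (a b : ℝ) : Continuous (flow a b) := by unfold flow; fun_prop

theorem flow_neg (a b z : ℝ) : flow b a (-z) = flow a b z := by
  simp only [flow, neg_neg]; ring

theorem flow_pos {a b : ℝ} (ha : 0 < a) (hb : 0 < b) (z : ℝ) : 0 < flow a b z := by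
  unfold flow; positivity

theorem hasDerivAt_exp_half (z : ℝ) :
    HasDerivAt (fun z => Real.exp (z / 2)) (Real.exp (z / 2) / 2) z := by
  have := ((hasDerivAt_id z).div_const 2).exp
  simpa [div_eq_mul_inv] using this

theorem hasDerivAt_exp_neg_half (z : ℝ) :
    HasDerivAt (fun z => Real.exp (-z / 2)) (-(Real.exp (-z / 2) / 2)) z := by
  have := ((hasDerivAt_id z).fun_neg.div_const 2).exp
  simpa [div_eq_mul_inv] using this

theorem hasDerivAt_flow (a b z : ℝ) :
    HasDerivAt (flow a b) ((a * Real.exp (z / 2) - b * Real.exp (-z / 2)) / 2) z := by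
  refine (((hasDerivAt_exp_half z).const_mul a).fun_add
    ((hasDerivAt_exp_neg_half z).const_mul b)).congr_deriv ?_
  ring

theorem flow_eq_mul (a b z : ℝ) :
    flow a b z = Real.exp (-z / 2) * (a * Real.exp z + b) := by
  have : Real.exp (z / 2) = Real.exp (-z / 2) * Real.exp z := by
    rw [← Real.exp_add]; congr 1; ring
  rw [flow, this]; ring

theorem exp_half_eq_mul (z : ℝ) : Real.exp (z / 2) = Real.exp (-z / 2) * Real.exp z := by
  rw [← Real.exp_add]; congr 1; ring

/-- Integrating factor: the derivative of `exp (μ z) * f z` has the sign of `f' + μ f`. Every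
comparison of values below reduces to the sign of such a source term, with `μ = ±(rho + lam / 2) /
lam`. -/
theorem exp_mul_le_exp_mul {μ s t : ℝ} {f f' : ℝ → ℝ} (hst : s ≤ t)
    (hf : ∀ z ∈ Icc s t, HasDerivAt f (f' z) z) (hpos : ∀ z ∈ Ioo s t, 0 ≤ f' z + μ * f z) :
    Real.exp (μ * s) * f s ≤ Real.exp (μ * t) * f t := by
  have hd : ∀ z ∈ Icc s t, HasDerivAt (fun z => Real.exp (μ * z) * f z)
      (Real.exp (μ * z) * (f' z + μ * f z)) z := fun z hz => by
    have h1 : HasDerivAt (fun z => Real.exp (μ * z)) (Real.exp (μ * z) * μ) z := by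
      simpa using ((hasDerivAt_id z).const_mul μ).exp
    exact (h1.fun_mul (hf z hz)).congr_deriv (by ring)
  refine monotoneOn_of_deriv_nonneg (convex_Icc s t)
    (fun z hz => (hd z hz).continuousAt.continuousWithinAt) ?_ ?_
    (left_mem_Icc.2 hst) (right_mem_Icc.2 hst) hst
  · intro z hz
    rw [interior_Icc] at hz
    exact (hd z (Ioo_subset_Icc_self hz)).differentiableAt.differentiableWithinAt
  · intro z hz
    rw [interior_Icc] at hz
    rw [(hd z (Ioo_subset_Icc_self hz)).deriv]
    exact mul_nonneg (Real.exp_pos _).le (hpos z hz)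

theorem exp_mul_lt_exp_mul {μ s t : ℝ} {f f' : ℝ → ℝ} (hst : s < t)
    (hf : ∀ z ∈ Icc s t, HasDerivAt f (f' z) z) (hpos : ∀ z ∈ Ioo s t, 0 < f' z + μ * f z) :
    Real.exp (μ * s) * f s < Real.exp (μ * t) * f t := by
  have hd : ∀ z ∈ Icc s t, HasDerivAt (fun z => Real.exp (μ * z) * f z)
      (Real.exp (μ * z) * (f' z + μ * f z)) z := fun z hz => by
    have h1 : HasDerivAt (fun z => Real.exp (μ * z)) (Real.exp (μ * z) * μ) z := by
      simpa using ((hasDerivAt_id z).const_mul μ).exp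
    exact (h1.fun_mul (hf z hz)).congr_deriv (by ring)
  refine strictMonoOn_of_deriv_pos (convex_Icc s t)
    (fun z hz => (hd z hz).continuousAt.continuousWithinAt) ?_
    (left_mem_Icc.2 hst.le) (right_mem_Icc.2 hst.le) hst
  intro z hz
  rw [interior_Icc] at hz
  rw [(hd z (Ioo_subset_Icc_self hz)).deriv]
  exact mul_pos (Real.exp_pos _) (hpos z hz)

theorem pos_of_exp_mul_lt {μ s t x y : ℝ} (h : Real.exp (μ * s) * x < Real.exp (μ * t) * y)
    (hx : 0 ≤ x) : 0 < y :=
  (mul_pos_iff_of_pos_left (Real.exp_pos _)).1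
    ((mul_nonneg (Real.exp_pos (μ * s)).le hx).trans_lt h)

theorem neg_of_exp_mul_lt {μ s t x y : ℝ} (h : Real.exp (μ * s) * x < Real.exp (μ * t) * y)
    (hy : y ≤ 0) : x < 0 := by
  have h1 := h.trans_le (mul_nonpos_of_nonneg_of_nonpos (Real.exp_pos (μ * t)).le hy)
  by_contra hx
  exact absurd h1 (not_lt.2 (mul_nonneg (Real.exp_pos _).le (not_lt.1 hx)))

/-- On `[z₁, ∞)`, `φ` is the cost of moving down at full speed. -/
def IsRise (lam rho a b z₁ : ℝ) (φ : ℝ → ℝ) : Prop :=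
  ∀ z, z₁ ≤ z → HasDerivAt φ ((flow a b z - (rho + lam / 2) * φ z) / lam) z

/-- On `(-∞, z₁]`, `φ` is the cost of moving up at full speed. -/
def IsFall (lam rho a b z₁ : ℝ) (φ : ℝ → ℝ) : Prop :=
  ∀ z, z ≤ z₁ → HasDerivAt φ (-((flow a b z - (rho + lam / 2) * φ z) / lam)) z

theorem IsRise.reflect {lam rho a b z₁ : ℝ} {φ : ℝ → ℝ} (h : IsRise lam rho b a (-z₁) φ) :
    IsFall lam rho a b z₁ (fun z => φ (-z)) := fun z hz => by
  have := (h (-z) (neg_le_neg hz)).comp z (hasDerivAt_neg z)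
  refine this.congr_deriv ?_
  rw [flow_neg]; ring

namespace IsRise

variable {lam rho a b z₁ q : ℝ} {φ χ : ℝ → ℝ}

theorem mono (h : IsRise lam rho a b z₁ φ) {z₂ : ℝ} (hz : z₁ ≤ z₂) : IsRise lam rho a b z₂ φ :=
  fun z hz' => h z (hz.trans hz')

/-- Left of the minimum of the flow, the cost stays below the cost of waiting. -/
theorem lt_of_le_left (h : IsRise lam rho a b z₁ φ) (hlam : 0 < lam)
    (hq : a * Real.exp q = b) (ha : 0 < a) {z w : ℝ} (h1 : z₁ ≤ z) (hzw : z < w) (hw : w ≤ q)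
    (hle : (rho + lam / 2) * φ w ≤ flow a b w) : (rho + lam / 2) * φ z < flow a b z := by
  -- The source term for `rφ − flow` is minus the derivative of the flow, which is positive to the
  -- left of its minimizer `q`.
  have := exp_mul_lt_exp_mul (μ := (rho + lam / 2) / lam)
    (f := fun z => (rho + lam / 2) * φ z - flow a b z) hzw
    (fun v hv => ((h v (h1.trans hv.1)).const_mul _).fun_sub (hasDerivAt_flow a b v)) ?_
  · linarith [neg_of_exp_mul_lt this (by linarith)]
  intro v hv
  have h2 : Real.exp v < Real.exp q := Real.exp_lt_exp.2 (hv.2.trans_le hw)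
  have h3 : 0 < Real.exp (-v / 2) * (b - a * Real.exp v) :=
    mul_pos (Real.exp_pos _) (by nlinarith)
  have h4 := exp_half_eq_mul v
  have : (rho + lam / 2) * ((flow a b v - (rho + lam / 2) * φ v) / lam) -
      (a * Real.exp (v / 2) - b * Real.exp (-v / 2)) / 2 +
      (rho + lam / 2) / lam * ((rho + lam / 2) * φ v - flow a b v) =
      Real.exp (-v / 2) * (b - a * Real.exp v) / 2 := by
    rw [h4]; field_simp; ring
  rw [this]; positivity

/-- Right of the minimum of the flow, the cost stays below the cost of waiting. -/
theorem lt_of_le_right (h : IsRise lam rho a b z₁ φ) (hlam : 0 < lam)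
    (hq : a * Real.exp q = b) (ha : 0 < a) {z w : ℝ} (h1 : z₁ ≤ z) (hzw : z < w) (hw : q ≤ z)
    (hle : (rho + lam / 2) * φ z ≤ flow a b z) : (rho + lam / 2) * φ w < flow a b w := by
  have := exp_mul_lt_exp_mul (μ := (rho + lam / 2) / lam)
    (f := fun z => flow a b z - (rho + lam / 2) * φ z) hzw
    (fun v hv => (hasDerivAt_flow a b v).fun_sub ((h v (h1.trans hv.1)).const_mul _)) ?_
  · linarith [pos_of_exp_mul_lt this (by linarith)]
  intro v hv
  have h2 : Real.exp q < Real.exp v := Real.exp_lt_exp.2 (hw.trans_lt hv.1)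
  have h3 : 0 < Real.exp (-v / 2) * (a * Real.exp v - b) :=
    mul_pos (Real.exp_pos _) (by nlinarith)
  have h4 := exp_half_eq_mul v
  have : (a * Real.exp (v / 2) - b * Real.exp (-v / 2)) / 2 -
      (rho + lam / 2) * ((flow a b v - (rho + lam / 2) * φ v) / lam) +
      (rho + lam / 2) / lam * (flow a b v - (rho + lam / 2) * φ v) =
      Real.exp (-v / 2) * (a * Real.exp v - b) / 2 := by
    rw [h4]; field_simp; ring
  rw [this]; positivity

/-- The source term for `(rho + lam) * φ − flow` is `b * exp (−z / 2) > 0`. By the equation for `φ`,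
the conclusion says that its slope is below `φ / 2`, the slope of the stopping loss `A * exp (z /
2)` at the same value. -/
theorem flow_lt (h : IsRise lam rho a b z₁ φ) (hlam : 0 < lam) (hb : 0 < b) {z w : ℝ}
    (h1 : z₁ ≤ z) (hzw : z < w) (hle : flow a b z ≤ (rho + lam) * φ z) :
    flow a b w < (rho + lam) * φ w := by
  have := exp_mul_lt_exp_mul (μ := (rho + lam / 2) / lam)
    (f := fun z => (rho + lam) * φ z - flow a b z) hzw
    (fun v hv => ((h v (h1.trans hv.1)).const_mul _).fun_sub (hasDerivAt_flow a b v)) ?_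
  · linarith [pos_of_exp_mul_lt this (by linarith)]
  intro v hv
  have : (rho + lam) * ((flow a b v - (rho + lam / 2) * φ v) / lam) -
      (a * Real.exp (v / 2) - b * Real.exp (-v / 2)) / 2 +
      (rho + lam / 2) / lam * ((rho + lam) * φ v - flow a b v) = b * Real.exp (-v / 2) := by
    unfold flow; field_simp; ring
  rw [this]; positivity

/-- By the equation defining `lo`, the source term for `A * exp (z / 2) − φ` is positive exactly to
the right of `lo`: once below the stopping loss there, the cost stays below it. -/
theorem lt_terminal (h : IsRise lam rho a b z₁ φ) (hlam : 0 < lam) {A : ℝ} {lo : ℝ}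
    (hA : 0 < (rho + lam) * A - a) (hlo : ((rho + lam) * A - a) * Real.exp lo = b)
    {z w : ℝ} (h1 : z₁ ≤ z) (h2 : lo ≤ z) (hzw : z < w)
    (hle : φ z ≤ A * Real.exp (z / 2)) : φ w < A * Real.exp (w / 2) := by
  have := exp_mul_lt_exp_mul (μ := (rho + lam / 2) / lam)
    (f := fun z => A * Real.exp (z / 2) - φ z) hzw
    (fun v hv => ((hasDerivAt_exp_half v).const_mul A).fun_sub (h v (h1.trans hv.1))) ?_
  · linarith [pos_of_exp_mul_lt this (by linarith)]
  intro v hv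
  have h2 : Real.exp lo < Real.exp v := Real.exp_lt_exp.2 (h2.trans_lt hv.1)
  have h3 : 0 < Real.exp (-v / 2) * (((rho + lam) * A - a) * Real.exp v - b) :=
    mul_pos (Real.exp_pos _) (by nlinarith)
  have h4 := exp_half_eq_mul v
  have : A * (Real.exp (v / 2) / 2) - (flow a b v - (rho + lam / 2) * φ v) / lam +
      (rho + lam / 2) / lam * (A * Real.exp (v / 2) - φ v) =
      Real.exp (-v / 2) * (((rho + lam) * A - a) * Real.exp v - b) / lam := by
    rw [flow_eq_mul, h4]; field_simp; ring
  rw [this]; positivity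

/-- The difference of two solutions solves the homogeneous equation, so it keeps its sign. -/
theorem lt_of_lt (h : IsRise lam rho a b z₁ φ) (h' : IsRise lam rho a b z₁ χ)
    {z w : ℝ} (h1 : z₁ ≤ z) (hzw : z ≤ w) (hlt : φ z < χ z) : φ w < χ w := by
  have := exp_mul_le_exp_mul (μ := (rho + lam / 2) / lam)
    (f := fun z => χ z - φ z) hzw
    (fun v hv => (h' v (h1.trans hv.1)).fun_sub (h v (h1.trans hv.1))) 
    (fun v hv => le_of_eq (by ring))
  have h2 : 0 < Real.exp ((rho + lam / 2) / lam * z) * (χ z - φ z) :=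
    mul_pos (Real.exp_pos _) (by linarith)
  have h3 := (mul_pos_iff_of_pos_left (Real.exp_pos _)).1 (h2.trans_le this)
  linarith

/-- A rising and a falling cost cross once where the rising one is below the cost of waiting. -/
theorem sub_fall_lt (h : IsRise lam rho a b z₁ φ) {z₂ : ℝ} (h' : IsFall lam rho a b z₂ χ)
    (hlam : 0 < lam) {z w : ℝ} (h1 : z₁ ≤ z) (hzw : z < w) (h2 : w ≤ z₂)
    (hlt : ∀ v ∈ Ioo z w, (rho + lam / 2) * φ v < flow a b v) :
    Real.exp (-((rho + lam / 2) / lam) * z) * (φ z - χ z) <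
      Real.exp (-((rho + lam / 2) / lam) * w) * (φ w - χ w) := by
  -- With this sign of the exponent `χ` cancels from the source term, leaving a condition on `φ`
  -- alone. With the opposite sign, in `sub_fall_lt'`, it is `φ` that cancels.
  refine exp_mul_lt_exp_mul (f := fun z => φ z - χ z) hzw
    (fun v hv => (h v (h1.trans hv.1)).fun_sub (h' v (hv.2.trans h2))) fun v hv => ?_
  have h3 := hlt v hv
  have : (flow a b v - (rho + lam / 2) * φ v) / lam -
      -((flow a b v - (rho + lam / 2) * χ v) / lam) +
      -((rho + lam / 2) / lam) * (φ v - χ v) =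
      2 * (flow a b v - (rho + lam / 2) * φ v) / lam := by
    field_simp; ring
  rw [this]
  exact div_pos (by linarith) hlam

/-- A rising and a falling cost cross once where the falling one is below the cost of waiting. -/
theorem sub_fall_lt' (h : IsRise lam rho a b z₁ φ) {z₂ : ℝ} (h' : IsFall lam rho a b z₂ χ)
    (hlam : 0 < lam) {z w : ℝ} (h1 : z₁ ≤ z) (hzw : z < w) (h2 : w ≤ z₂)
    (hlt : ∀ v ∈ Ioo z w, (rho + lam / 2) * χ v < flow a b v) :
    Real.exp ((rho + lam / 2) / lam * z) * (φ z - χ z) <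
      Real.exp ((rho + lam / 2) / lam * w) * (φ w - χ w) := by
  refine exp_mul_lt_exp_mul (f := fun z => φ z - χ z) hzw
    (fun v hv => (h v (h1.trans hv.1)).fun_sub (h' v (hv.2.trans h2))) fun v hv => ?_
  have h3 := hlt v hv
  have : (flow a b v - (rho + lam / 2) * φ v) / lam -
      -((flow a b v - (rho + lam / 2) * χ v) / lam) +
      (rho + lam / 2) / lam * (φ v - χ v) =
      2 * (flow a b v - (rho + lam / 2) * χ v) / lam := by
    field_simp; ring
  rw [this]
  exact div_pos (by linarith) hlam

end IsRise

/-- The solution through `(z₁, v₁)` of the differential equation in `IsRise`. -/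
def rise (lam rho a b z₁ v₁ z : ℝ) : ℝ :=
  Real.exp (-((rho + lam / 2) / lam * (z - z₁))) *
    (v₁ + ∫ s in z₁..z, Real.exp ((rho + lam / 2) / lam * (s - z₁)) * (flow a b s / lam))

theorem rise_self (lam rho a b z₁ v₁ : ℝ) : rise lam rho a b z₁ v₁ z₁ = v₁ := by simp [rise]

theorem hasDerivAt_rise (lam rho a b z₁ v₁ z : ℝ) :
    HasDerivAt (rise lam rho a b z₁ v₁)
      ((flow a b z - (rho + lam / 2) * rise lam rho a b z₁ v₁ z) / lam) z := by
  have hc : Continuous fun s => Real.exp ((rho + lam / 2) / lam * (s - z₁)) * (flow a b s / lam) := by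
    have := continuous_flow a b
    fun_prop
  have h1 := (hc.integral_hasStrictDerivAt z₁ z).hasDerivAt.const_add v₁
  have h2 : HasDerivAt (fun z => Real.exp (-((rho + lam / 2) / lam * (z - z₁))))
      (Real.exp (-((rho + lam / 2) / lam * (z - z₁))) * (-((rho + lam / 2) / lam))) z := by
    simpa using (((hasDerivAt_id z).sub_const z₁).const_mul ((rho + lam / 2) / lam)).fun_neg.exp
  refine (h2.fun_mul h1).congr_deriv ?_
  have h3 : Real.exp (-((rho + lam / 2) / lam * (z - z₁))) *
      Real.exp ((rho + lam / 2) / lam * (z - z₁)) = 1 := by rw [← Real.exp_add]; simp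
  unfold rise
  linear_combination (flow a b z / lam) * h3

theorem isRise_rise (lam rho a b z₁ v₁ : ℝ) : IsRise lam rho a b z₁ (rise lam rho a b z₁ v₁) :=
  fun z _ => hasDerivAt_rise lam rho a b z₁ v₁ z

/-! ### The one-sided values and their crossing. -/

/-- The normalized loss from the better immediate action. -/
def stopLoss (A B z : ℝ) : ℝ := min (A * Real.exp (z / 2)) (B * Real.exp (-z / 2))

theorem stopLoss_neg (A B z : ℝ) : stopLoss B A (-z) = stopLoss A B z := by
  simp only [stopLoss, neg_neg, min_comm]

/-- The parameters of the normalized problem: learning pays exactly on `(lo, hi)`, and the flow is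
smallest at `q`. -/
structure Model (lam rho a b A B lo hi q : ℝ) : Prop where
  lam_pos : 0 < lam
  rho_nonneg : 0 ≤ rho
  a_pos : 0 < a
  b_pos : 0 < b
  A_pos : 0 < A
  B_pos : 0 < B
  lt : a * B + b * A < (rho + lam) * A * B
  lo_eq : ((rho + lam) * A - a) * Real.exp lo = b
  hi_eq : ((rho + lam) * B - b) * Real.exp (-hi) = a
  q_eq : a * Real.exp q = b

/-- The value of moving down to `lo` and stopping there, extended by stopping below `lo`. -/
def leftValue (lam rho a b A lo z : ℝ) : ℝ :=
  if z ≤ lo then A * Real.exp (z / 2) else rise lam rho a b lo (A * Real.exp (lo / 2)) z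

/-- The value of moving up to `hi` and stopping there, extended by stopping above `hi`. -/
def rightValue (lam rho a b B hi z : ℝ) : ℝ := leftValue lam rho b a B (-hi) (-z)

theorem hasDerivAt_ite {f g : ℝ → ℝ} {k d : ℝ} (hf : HasDerivAt f d k) (hg : HasDerivAt g d k)
    (h : f k = g k) : HasDerivAt (fun z => if z ≤ k then f z else g z) d k := by
  have h1 : HasDerivWithinAt (fun z => if z ≤ k then f z else g z) d (Iic k) k :=
    hf.hasDerivWithinAt.congr (fun z hz => if_pos hz) (if_pos le_rfl)
  have h2 : HasDerivWithinAt (fun z => if z ≤ k then f z else g z) d (Ici k) k := by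
    refine hg.hasDerivWithinAt.congr (fun z hz => ?_) (by simp [h])
    rcases (mem_Ici.1 hz).eq_or_lt with rfl | hlt
    · simp [h]
    · simp [not_le.2 hlt]
  simpa using h1.union h2

theorem hasDerivAt_ite_of_lt {f g : ℝ → ℝ} {k d z : ℝ} (hz : z < k) (hf : HasDerivAt f d z) :
    HasDerivAt (fun z => if z ≤ k then f z else g z) d z :=
  hf.congr_of_eventuallyEq ((gt_mem_nhds hz).mono fun _ hw => if_pos (le_of_lt hw))

theorem hasDerivAt_ite_of_gt {f g : ℝ → ℝ} {k d z : ℝ} (hz : k < z) (hg : HasDerivAt g d z) :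
    HasDerivAt (fun z => if z ≤ k then f z else g z) d z :=
  hg.congr_of_eventuallyEq ((lt_mem_nhds hz).mono fun _ hw => if_neg (not_le.2 hw))

theorem leftValue_of_le {lam rho a b A lo z : ℝ} (h : z ≤ lo) :
    leftValue lam rho a b A lo z = A * Real.exp (z / 2) := if_pos h

theorem rightValue_of_ge {lam rho a b B hi z : ℝ} (h : hi ≤ z) :
    rightValue lam rho a b B hi z = B * Real.exp (-z / 2) :=
  leftValue_of_le (neg_le_neg h)

theorem rightValue_neg (lam rho a b B hi z : ℝ) :
    rightValue lam rho b a B (-hi) (-z) = leftValue lam rho a b B hi z := by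
  simp [rightValue]

namespace Model

variable {lam rho a b A B lo hi q : ℝ}

theorem reflect (m : Model lam rho a b A B lo hi q) :
    Model lam rho b a B A (-hi) (-lo) (-q) where
  lam_pos := m.lam_pos
  rho_nonneg := m.rho_nonneg
  a_pos := m.b_pos
  b_pos := m.a_pos
  A_pos := m.B_pos
  B_pos := m.A_pos
  lt := by linarith [m.lt]
  lo_eq := m.hi_eq
  hi_eq := by rw [neg_neg]; exact m.lo_eq
  q_eq := by rw [← m.q_eq, mul_assoc, ← Real.exp_add]; simp

theorem r_pos (m : Model lam rho a b A B lo hi q) : 0 < rho + lam / 2 := by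
  linarith [m.lam_pos, m.rho_nonneg]

theorem A_gt (m : Model lam rho a b A B lo hi q) : 0 < (rho + lam) * A - a := by
  have := m.lt
  have h1 := mul_pos m.b_pos m.A_pos
  have h2 : a * B < ((rho + lam) * A) * B := by linarith
  linarith [lt_of_mul_lt_mul_right h2 m.B_pos.le]

/-- This places `lo` to the left of the point log (B / A) at which both actions are equally good;
the reflected statement places `hi` to its right. -/
theorem A_mul_exp_lo_lt (m : Model lam rho a b A B lo hi q) : A * Real.exp lo < B := by
  have h : ((rho + lam) * A - a) * (A * Real.exp lo) < ((rho + lam) * A - a) * B := by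
    have := m.lo_eq
    have := m.lt
    calc ((rho + lam) * A - a) * (A * Real.exp lo)
        = A * (((rho + lam) * A - a) * Real.exp lo) := by ring
      _ = A * b := by rw [m.lo_eq]
      _ < _ := by linarith
  exact lt_of_mul_lt_mul_left h m.A_gt.le

theorem lo_lt_hi (m : Model lam rho a b A B lo hi q) : lo < hi := by
  have h1 := m.A_mul_exp_lo_lt
  have h2 := m.reflect.A_mul_exp_lo_lt
  have h3 : B < A * Real.exp hi := by
    have := mul_lt_mul_of_pos_right h2 (Real.exp_pos hi)
    rwa [mul_assoc, ← Real.exp_add, neg_add_cancel, Real.exp_zero, mul_one] at this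
  exact Real.exp_lt_exp.1 (lt_of_mul_lt_mul_left (h1.trans h3) m.A_pos.le)

/-- Since `A * exp (z / 2)` has half its value as slope, the left side is `rψ + lam * ψ'`: below
`lo` the stopping loss is a strict subsolution. -/
theorem stop_lt_flow (m : Model lam rho a b A B lo hi q) {z : ℝ} (hz : z < lo) :
    (rho + lam) * (A * Real.exp (z / 2)) < flow a b z := by
  rw [flow_eq_mul, exp_half_eq_mul]
  have h1 : Real.exp z < Real.exp lo := Real.exp_lt_exp.2 hz
  have h2 := mul_lt_mul_of_pos_left h1 m.A_gt
  have := mul_lt_mul_of_pos_left (show (rho + lam) * A * Real.exp z < a * Real.exp z + b by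
    linarith [m.lo_eq]) (Real.exp_pos (-z / 2))
  linarith

/-- Smooth pasting: this equality makes the slopes of stopping and of moving down agree at `lo`. -/
theorem stop_eq_flow (m : Model lam rho a b A B lo hi q) :
    (rho + lam) * (A * Real.exp (lo / 2)) = flow a b lo := by
  rw [flow_eq_mul, exp_half_eq_mul]
  linear_combination Real.exp (-lo / 2) * m.lo_eq

theorem hasDerivAt_leftValue_of_lt {z : ℝ} (hz : z < lo) :
    HasDerivAt (leftValue lam rho a b A lo) (A * (Real.exp (z / 2) / 2)) z :=
  hasDerivAt_ite_of_lt hz ((hasDerivAt_exp_half z).const_mul A)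

theorem isRise_leftValue (m : Model lam rho a b A B lo hi q) :
    IsRise lam rho a b lo (leftValue lam rho a b A lo) := by
  intro z hz
  rcases hz.eq_or_lt with rfl | hlt
  · have h2 := hasDerivAt_rise lam rho a b lo (A * Real.exp (lo / 2)) lo
    rw [rise_self] at h2
    rw [leftValue_of_le le_rfl]
    refine hasDerivAt_ite (((hasDerivAt_exp_half lo).const_mul A).congr_deriv ?_) h2
      (rise_self ..).symm
    have := m.lam_pos
    rw [← m.stop_eq_flow]
    field_simp
    ring
  · rw [show leftValue lam rho a b A lo z = rise lam rho a b lo (A * Real.exp (lo / 2)) z from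
      if_neg (not_le.2 hlt)]
    exact hasDerivAt_ite_of_gt hlt (hasDerivAt_rise ..)

theorem isFall_rightValue (m : Model lam rho a b A B lo hi q) :
    IsFall lam rho a b hi (rightValue lam rho a b B hi) :=
  IsRise.reflect m.reflect.isRise_leftValue

theorem leftValue_lt_terminal (m : Model lam rho a b A B lo hi q) {z : ℝ} (hz : lo < z) :
    leftValue lam rho a b A lo z < A * Real.exp (z / 2) :=
  m.isRise_leftValue.lt_terminal m.lam_pos m.A_gt m.lo_eq le_rfl le_rfl hz (leftValue_of_le le_rfl).le

theorem rightValue_lt_terminal (m : Model lam rho a b A B lo hi q) {z : ℝ} (hz : z < hi) :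
    rightValue lam rho a b B hi z < B * Real.exp (-z / 2) :=
  m.reflect.leftValue_lt_terminal (neg_lt_neg hz)

theorem flow_lt_leftValue (m : Model lam rho a b A B lo hi q) {z : ℝ} (hz : lo < z) :
    flow a b z < (rho + lam) * leftValue lam rho a b A lo z :=
  m.isRise_leftValue.flow_lt m.lam_pos m.b_pos le_rfl hz
    (by rw [leftValue_of_le le_rfl, m.stop_eq_flow])

theorem flow_lt_rightValue (m : Model lam rho a b A B lo hi q) {z : ℝ} (hz : z < hi) :
    flow a b z < (rho + lam) * rightValue lam rho a b B hi z := by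
  rw [← flow_neg]; exact m.reflect.flow_lt_leftValue (neg_lt_neg hz)

theorem leftValue_pos (m : Model lam rho a b A B lo hi q) (z : ℝ) :
    0 < leftValue lam rho a b A lo z := by
  rcases le_or_gt z lo with h | h
  · rw [leftValue_of_le h]; exact mul_pos m.A_pos (Real.exp_pos _)
  · have h1 := (flow_pos m.a_pos m.b_pos z).trans (m.flow_lt_leftValue h)
    exact (mul_pos_iff_of_pos_left (by linarith [m.r_pos, m.lam_pos])).1 h1

theorem rightValue_pos (m : Model lam rho a b A B lo hi q) (z : ℝ) :
    0 < rightValue lam rho a b B hi z := m.reflect.leftValue_pos _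

theorem mul_leftValue_lt_of_le (m : Model lam rho a b A B lo hi q) {z : ℝ} (hz : z ≤ lo) :
    (rho + lam / 2) * leftValue lam rho a b A lo z < flow a b z := by
  have h1 : (rho + lam) * (A * Real.exp (z / 2)) ≤ flow a b z := by
    rcases hz.eq_or_lt with rfl | h
    · exact m.stop_eq_flow.le
    · exact (m.stop_lt_flow h).le
  rw [leftValue_of_le hz]
  have := mul_pos m.lam_pos (mul_pos m.A_pos (Real.exp_pos (z / 2)))
  linarith

/-- One comparison with the cost of waiting, made at the minimizer `q` of the flow, spreads to both
sides by `lt_of_le_left` and `lt_of_le_right`. If `q` lies below `lo`, the spreading to the right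
starts at `lo`, where the inequality always holds. -/
theorem mul_leftValue_lt (m : Model lam rho a b A B lo hi q)
    (h : (rho + lam / 2) * leftValue lam rho a b A lo q ≤ flow a b q) {z : ℝ} (hz : z ≠ q) :
    (rho + lam / 2) * leftValue lam rho a b A lo z < flow a b z := by
  rcases le_or_gt z lo with h1 | h1
  · exact m.mul_leftValue_lt_of_le h1
  rcases lt_or_gt_of_ne hz with h2 | h2
  · exact m.isRise_leftValue.lt_of_le_left m.lam_pos m.q_eq m.a_pos h1.le h2 le_rfl h
  rcases le_or_gt lo q with h3 | h3
  · exact m.isRise_leftValue.lt_of_le_right m.lam_pos m.q_eq m.a_pos h3 h2 le_rfl h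
  · exact m.isRise_leftValue.lt_of_le_right m.lam_pos m.q_eq m.a_pos le_rfl h1 h3.le
      (m.mul_leftValue_lt_of_le le_rfl).le

theorem mul_rightValue_lt (m : Model lam rho a b A B lo hi q)
    (h : (rho + lam / 2) * rightValue lam rho a b B hi q ≤ flow a b q) {z : ℝ} (hz : z ≠ q) :
    (rho + lam / 2) * rightValue lam rho a b B hi z < flow a b z := by
  rw [← flow_neg] at h ⊢
  exact m.reflect.mul_leftValue_lt h (by simpa using hz)

/-- At `lo` the left value equals `flow / (rho + lam)`, and the right value exceeds this everywhere
below `hi`. With its mirror image at `hi` it gives the sign change for the crossing. -/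
theorem leftValue_lo_lt (m : Model lam rho a b A B lo hi q) :
    leftValue lam rho a b A lo lo < rightValue lam rho a b B hi lo := by
  rw [leftValue_of_le le_rfl]
  have := m.flow_lt_rightValue m.lo_lt_hi
  rw [← m.stop_eq_flow] at this
  exact lt_of_mul_lt_mul_left this (by linarith [m.r_pos, m.lam_pos])

theorem rightValue_hi_lt (m : Model lam rho a b A B lo hi q) :
    rightValue lam rho a b B hi hi < leftValue lam rho a b A lo hi := by
  have := m.reflect.leftValue_lo_lt
  rwa [rightValue_neg] at this

end Model

/-- A positive weight does not move zeros, and a strictly increasing function has at most one. -/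
theorem exists_crossing {f g : ℝ → ℝ} {x y μ : ℝ} (hxy : x < y) (hf : ContinuousOn f (Icc x y))
    (hg : ContinuousOn g (Icc x y)) (hx : f x < g x) (hy : g y < f y)
    (hmono : ∀ z ∈ Icc x y, ∀ w ∈ Icc x y, z < w →
      Real.exp (μ * z) * (f z - g z) < Real.exp (μ * w) * (f w - g w)) :
    ∃ k ∈ Ioo x y, f k = g k ∧ (∀ z ∈ Ico x k, f z < g z) ∧ ∀ z ∈ Ioc k y, g z < f z := by
  obtain ⟨k, hk, hk0⟩ := intermediate_value_Ioo hxy.le (hf.sub hg)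
    (show (0 : ℝ) ∈ Ioo (f x - g x) (f y - g y) from ⟨by linarith, by linarith⟩)
  have hk0' : f k - g k = 0 := hk0
  have hkI := Ioo_subset_Icc_self hk
  refine ⟨k, hk, by linarith, fun z hz => ?_, fun z hz => ?_⟩
  · have := hmono z ⟨hz.1, hz.2.le.trans hk.2.le⟩ k hkI hz.2
    linarith [neg_of_exp_mul_lt this hk0'.le]
  · have := hmono k hkI z ⟨hk.1.le.trans hz.1.le, hz.2⟩ hz.1
    linarith [pos_of_exp_mul_lt this hk0'.ge]

namespace Model

variable {lam rho a b A B lo hi q : ℝ}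

/-- The switch point of own-biased learning. -/
def IsSwitch (lam rho a b A B lo hi q k : ℝ) : Prop :=
  k ∈ Ioo lo hi ∧ leftValue lam rho a b A lo k = rightValue lam rho a b B hi k ∧
    (∀ z ∈ Ico lo k, leftValue lam rho a b A lo z < rightValue lam rho a b B hi z) ∧
    (∀ z ∈ Ioc k hi, rightValue lam rho a b B hi z < leftValue lam rho a b A lo z) ∧
    (∀ z ∈ Icc lo k, z ≠ q → (rho + lam / 2) * leftValue lam rho a b A lo z < flow a b z) ∧
    ∀ z ∈ Icc k hi, z ≠ q → (rho + lam / 2) * rightValue lam rho a b B hi z < flow a b z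

theorem IsSwitch.reflect {k : ℝ} (h : IsSwitch lam rho b a B A (-hi) (-lo) (-q) (-k)) :
    IsSwitch lam rho a b A B lo hi q k := by
  obtain ⟨h1, h2, h3, h4, h5, h6⟩ := h
  rw [rightValue_neg] at h2
  refine ⟨⟨neg_lt_neg_iff.1 h1.2, neg_lt_neg_iff.1 h1.1⟩, h2.symm, fun z hz => ?_, fun z hz => ?_,
    fun z hz hq => ?_, fun z hz hq => ?_⟩
  · have := h4 (-z) ⟨neg_lt_neg hz.2, neg_le_neg hz.1⟩
    rwa [rightValue_neg] at this
  · have := h3 (-z) ⟨neg_le_neg hz.2, neg_lt_neg hz.1⟩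
    rwa [rightValue_neg] at this
  · have := h6 (-z) ⟨neg_le_neg hz.2, neg_le_neg hz.1⟩ (by simpa using hq)
    rwa [rightValue_neg, flow_neg] at this
  · have := h5 (-z) ⟨neg_le_neg hz.2, neg_le_neg hz.1⟩ (by simpa using hq)
    rwa [flow_neg] at this

/-- If waiting at `q` does not beat the left value, the left value is below the cost of waiting
everywhere off `q`. By `sub_fall_lt` the weighted difference of the two values is then strictly
increasing, which gives the unique crossing. -/
theorem exists_isSwitch_of_left (m : Model lam rho a b A B lo hi q)
    (h : (rho + lam / 2) * leftValue lam rho a b A lo q ≤ flow a b q) :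
    ∃ k, IsSwitch lam rho a b A B lo hi q k := by
  have hL := m.isRise_leftValue
  have hR := m.isFall_rightValue
  -- Intervals around `q` are split at `q`, since the strict comparison may fail at that single
  -- point.
  have hmono : ∀ z ∈ Icc lo hi, ∀ w ∈ Icc lo hi, z < w → q ∉ Ioo z w →
      Real.exp (-((rho + lam / 2) / lam) * z) *
        (leftValue lam rho a b A lo z - rightValue lam rho a b B hi z) <
      Real.exp (-((rho + lam / 2) / lam) * w) *
        (leftValue lam rho a b A lo w - rightValue lam rho a b B hi w) := by
    intro z hz w hw hzw hq
    refine hL.sub_fall_lt hR m.lam_pos hz.1 hzw hw.2 fun v hv => m.mul_leftValue_lt h ?_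
    rintro rfl
    exact hq hv
  obtain ⟨k, hk, hkeq, hlt, hgt⟩ := exists_crossing m.lo_lt_hi
    (fun z hz => (hL z hz.1).continuousAt.continuousWithinAt)
    (fun z hz => (hR z hz.2).continuousAt.continuousWithinAt) m.leftValue_lo_lt
    m.rightValue_hi_lt (μ := -((rho + lam / 2) / lam)) (by
      intro z hz w hw hzw
      by_cases hq : q ∈ Ioo z w
      · have hqI : q ∈ Icc lo hi := ⟨hz.1.trans hq.1.le, hq.2.le.trans hw.2⟩
        exact (hmono z hz q hqI hq.1 (by simp)).trans (hmono q hqI w hw hq.2 (by simp))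
      · exact hmono z hz w hw hzw hq)
  refine ⟨k, hk, hkeq, hlt, hgt, fun z _ hz => m.mul_leftValue_lt h hz, fun z hz hzq => ?_⟩
  -- The comparison with waiting has to be transferred to the right value. If `k ≤ q ≤ hi`, the
  -- right value at `q` is at most the left one; if `q > hi`, it is just the stopping loss. If `q <
  -- k`, the comparison is taken over at `k`, where both values agree, and spread to the right.
  rcases le_or_gt k q with hkq | hkq
  · refine m.mul_rightValue_lt ?_ hzq
    rcases le_or_gt q hi with h1 | h1
    · refine le_trans ?_ h
      have hle : rightValue lam rho a b B hi q ≤ leftValue lam rho a b A lo q := by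
        rcases hkq.eq_or_lt with h2 | h2
        · rw [← h2, hkeq]
        · exact (hgt q ⟨h2, h1⟩).le
      exact mul_le_mul_of_nonneg_left hle m.r_pos.le
    · rw [← flow_neg]
      exact (m.reflect.mul_leftValue_lt_of_le (neg_le_neg h1.le)).le
  · have hk2 : (rho + lam / 2) * rightValue lam rho a b B hi k < flow a b k := by
      rw [← hkeq]; exact m.mul_leftValue_lt h hkq.ne'
    rcases hz.1.eq_or_lt with rfl | hkz
    · exact hk2
    · rw [← flow_neg]
      rw [← flow_neg] at hk2
      exact m.reflect.isRise_leftValue.lt_of_le_left m.lam_pos m.reflect.q_eq m.b_pos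
        (neg_le_neg hz.2) (neg_lt_neg hkz) (neg_le_neg hkq.le) hk2.le

theorem exists_isSwitch (m : Model lam rho a b A B lo hi q)
    (h : (rho + lam / 2) * leftValue lam rho a b A lo q ≤ flow a b q ∨
      (rho + lam / 2) * rightValue lam rho a b B hi q ≤ flow a b q) :
    ∃ k, IsSwitch lam rho a b A B lo hi q k := by
  rcases h with h | h
  · exact m.exists_isSwitch_of_left h
  · obtain ⟨k, hk⟩ := m.reflect.exists_isSwitch_of_left (by rwa [flow_neg])
    exact ⟨-k, IsSwitch.reflect (by rwa [neg_neg])⟩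

end Model

/-! ### Moving to the minimum of the flow and waiting there. -/

/-- The value of moving down to `q` and waiting there. -/
def waitRight (lam rho a b q z : ℝ) : ℝ :=
  rise lam rho a b q (flow a b q / (rho + lam / 2)) z

/-- The value of moving up to `q` and waiting there. -/
def waitLeft (lam rho a b q z : ℝ) : ℝ := waitRight lam rho b a (-q) (-z)

namespace Model

variable {lam rho a b A B lo hi q : ℝ}

theorem mul_waitRight_self (m : Model lam rho a b A B lo hi q) :
    (rho + lam / 2) * waitRight lam rho a b q q = flow a b q := by
  rw [waitRight, rise_self, mul_div_assoc']
  exact mul_div_cancel_left₀ _ m.r_pos.ne'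

theorem mul_waitLeft_self (m : Model lam rho a b A B lo hi q) :
    (rho + lam / 2) * waitLeft lam rho a b q q = flow a b q := by
  rw [← flow_neg]; exact m.reflect.mul_waitRight_self

theorem isFall_waitLeft : IsFall lam rho a b q (waitLeft lam rho a b q) :=
  IsRise.reflect (isRise_rise _ _ _ _ _ _)

theorem mul_waitRight_lt (m : Model lam rho a b A B lo hi q) {z : ℝ} (hz : q < z) :
    (rho + lam / 2) * waitRight lam rho a b q z < flow a b z :=
  (isRise_rise _ _ _ _ _ _).lt_of_le_right m.lam_pos m.q_eq m.a_pos le_rfl hz le_rfl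
    m.mul_waitRight_self.le

theorem mul_waitLeft_lt (m : Model lam rho a b A B lo hi q) {z : ℝ} (hz : z < q) :
    (rho + lam / 2) * waitLeft lam rho a b q z < flow a b z := by
  rw [← flow_neg]; exact m.reflect.mul_waitRight_lt (neg_lt_neg hz)

theorem flow_lt_waitRight (m : Model lam rho a b A B lo hi q) {z : ℝ} (hz : q ≤ z) :
    flow a b z < (rho + lam) * waitRight lam rho a b q z := by
  have h0 : flow a b q < (rho + lam) * waitRight lam rho a b q q := by
    have h1 := m.mul_waitRight_self
    have h2 := flow_pos m.a_pos m.b_pos q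
    have h3 : 0 < waitRight lam rho a b q q := by
      rw [← h1] at h2; exact (mul_pos_iff_of_pos_left m.r_pos).1 h2
    nlinarith [m.lam_pos]
  rcases hz.eq_or_lt with rfl | hlt
  · exact h0
  · exact IsRise.flow_lt (isRise_rise _ _ _ _ _ _) m.lam_pos m.b_pos le_rfl hlt h0.le

theorem flow_lt_waitLeft (m : Model lam rho a b A B lo hi q) {z : ℝ} (hz : z ≤ q) :
    flow a b z < (rho + lam) * waitLeft lam rho a b q z := by
  rw [← flow_neg]; exact m.reflect.flow_lt_waitRight (neg_le_neg hz)

/-- The boundary between own-biased and opposite-biased learning on the left of `q`. -/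
def IsLeftSwitch (lam rho a b A lo q k : ℝ) : Prop :=
  k ∈ Ioo lo q ∧ leftValue lam rho a b A lo k = waitLeft lam rho a b q k ∧
    (∀ z ∈ Ico lo k, leftValue lam rho a b A lo z < waitLeft lam rho a b q z) ∧
    (∀ z ∈ Ioc k q, waitLeft lam rho a b q z < leftValue lam rho a b A lo z) ∧
    ∀ z ∈ Icc lo k, (rho + lam / 2) * leftValue lam rho a b A lo z < flow a b z

theorem lo_lt_q (m : Model lam rho a b A B lo hi q)
    (h : flow a b q < (rho + lam / 2) * leftValue lam rho a b A lo q) : lo < q := by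
  by_contra hcon
  exact absurd (m.mul_leftValue_lt_of_le (not_lt.1 hcon)) (not_lt.2 h.le)

/-- Here the left value is above the cost of waiting at `q`, so `sub_fall_lt` does not apply up to
`q`. Its companion `sub_fall_lt'` does, because the falling function `waitLeft` is below the cost of
waiting to the left of `q`. -/
theorem exists_isLeftSwitch (m : Model lam rho a b A B lo hi q)
    (h : flow a b q < (rho + lam / 2) * leftValue lam rho a b A lo q) :
    ∃ k, IsLeftSwitch lam rho a b A lo q k := by
  have hL := m.isRise_leftValue
  have hW : IsFall lam rho a b q (waitLeft lam rho a b q) := isFall_waitLeft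
  have hq := m.lo_lt_q h
  obtain ⟨k, hk, hkeq, hlt, hgt⟩ := exists_crossing hq
    (fun z hz => (hL z hz.1).continuousAt.continuousWithinAt)
    (fun z hz => (hW z hz.2).continuousAt.continuousWithinAt)
    (by
      have := m.flow_lt_waitLeft hq.le
      rw [← m.stop_eq_flow] at this
      rw [leftValue_of_le le_rfl]
      exact lt_of_mul_lt_mul_left this (by linarith [m.r_pos, m.lam_pos]))
    (by
      rw [← m.mul_waitLeft_self] at h
      exact lt_of_mul_lt_mul_left h m.r_pos.le)
    (μ := (rho + lam / 2) / lam)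
    (fun z hz w hw hzw => hL.sub_fall_lt' hW m.lam_pos hz.1 hzw hw.2 fun v hv =>
      m.mul_waitLeft_lt (hv.2.trans_le hw.2))
  have hk2 : (rho + lam / 2) * leftValue lam rho a b A lo k < flow a b k := by
    rw [hkeq]; exact m.mul_waitLeft_lt hk.2
  refine ⟨k, hk, hkeq, hlt, hgt, fun z hz => ?_⟩
  rcases hz.2.eq_or_lt with rfl | hzk
  · exact hk2
  · exact hL.lt_of_le_left m.lam_pos m.q_eq m.a_pos hz.1 hzk hk.2.le hk2.le

/-- Both functions are costs of moving up at full speed, so they obey the same equation to the left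
of `q` and inherit their order at `q`. -/
theorem waitLeft_lt_rightValue (m : Model lam rho a b A B lo hi q)
    (h : flow a b q < (rho + lam / 2) * rightValue lam rho a b B hi q) {z : ℝ} (hz : z ≤ q) :
    waitLeft lam rho a b q z < rightValue lam rho a b B hi z := by
  have hq : -hi < -q := m.reflect.lo_lt_q (by rwa [flow_neg])
  refine IsRise.lt_of_lt (isRise_rise _ _ _ _ _ _) (m.reflect.isRise_leftValue.mono hq.le) le_rfl
    (neg_le_neg hz) ?_
  have h1 := m.mul_waitLeft_self
  rw [← h1] at h
  exact lt_of_mul_lt_mul_left h m.r_pos.le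

end Model

/-! ### Explicit left value and the cutoff for waiting. -/

/-- The logarithm of the constant `K` in the lower cost cutoff. -/
def logCutoff (lam rho : ℝ) : ℝ :=
  if 0 < rho then lam / rho * Real.log ((2 * rho + lam) / lam) else 2

theorem logCutoff_pos {lam rho : ℝ} (hlam : 0 < lam) : 0 < logCutoff lam rho := by
  unfold logCutoff
  split_ifs with h
  · refine mul_pos (by positivity) (Real.log_pos ?_)
    rw [lt_div_iff₀ hlam]; linarith
  · norm_num

theorem logCutoff_le {lam rho : ℝ} (hlam : 0 < lam) : logCutoff lam rho ≤ 2 := by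
  unfold logCutoff
  split_ifs with h
  · have h1 := Real.log_le_sub_one_of_pos (show 0 < (2 * rho + lam) / lam by positivity)
    calc lam / rho * Real.log ((2 * rho + lam) / lam)
        ≤ lam / rho * ((2 * rho + lam) / lam - 1) := by gcongr
      _ = 2 := by field_simp; ring
  · exact le_rfl

theorem IsRise.eq_of_eq {lam rho a b z₁ : ℝ} {φ χ : ℝ → ℝ} (h : IsRise lam rho a b z₁ φ)
    (h' : IsRise lam rho a b z₁ χ) {z : ℝ} (hz : z₁ ≤ z) (h0 : φ z₁ = χ z₁) : φ z = χ z := by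
  have h1 := exp_mul_le_exp_mul (μ := (rho + lam / 2) / lam) (f := fun z => χ z - φ z) hz
    (fun v hv => (h' v hv.1).fun_sub (h v hv.1)) (fun v hv => le_of_eq (by ring))
  have h2 := exp_mul_le_exp_mul (μ := (rho + lam / 2) / lam) (f := fun z => φ z - χ z) hz
    (fun v hv => (h v hv.1).fun_sub (h' v hv.1)) (fun v hv => le_of_eq (by ring))
  simp only [h0, sub_self, mul_zero] at h1 h2
  have h3 := nonneg_of_mul_nonneg_right h1 (Real.exp_pos _)
  have h4 := nonneg_of_mul_nonneg_right h2 (Real.exp_pos _)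
  linarith

namespace Model

variable {lam rho a b A B lo hi q : ℝ}

/-- The first two terms are a particular solution for the two exponentials in the flow; the
coefficient of the homogeneous solution is fixed by smooth pasting at `lo`. -/
theorem leftValue_eq_of_rho_pos (m : Model lam rho a b A B lo hi q) (hrho : 0 < rho) {z : ℝ}
    (hz : lo ≤ z) :
    leftValue lam rho a b A lo z = a / (rho + lam) * Real.exp (z / 2) +
      b / rho * Real.exp (-z / 2) - b * lam / (rho * (rho + lam)) * Real.exp (-lo / 2) *
        Real.exp (-((rho + lam / 2) / lam) * (z - lo)) := by
  have hlam := m.lam_pos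
  refine m.isRise_leftValue.eq_of_eq
    (χ := fun z => a / (rho + lam) * Real.exp (z / 2) +
      b / rho * Real.exp (-z / 2) - b * lam / (rho * (rho + lam)) * Real.exp (-lo / 2) *
        Real.exp (-((rho + lam / 2) / lam) * (z - lo))) (fun z _ => ?_) hz ?_
  · have h1 : HasDerivAt (fun z => Real.exp (-((rho + lam / 2) / lam) * (z - lo)))
        (Real.exp (-((rho + lam / 2) / lam) * (z - lo)) * (-((rho + lam / 2) / lam))) z := by
      simpa using (((hasDerivAt_id z).sub_const lo).const_mul (-((rho + lam / 2) / lam))).exp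
    refine ((((hasDerivAt_exp_half z).const_mul (a / (rho + lam))).fun_add
      ((hasDerivAt_exp_neg_half z).const_mul (b / rho))).fun_sub
      (h1.const_mul (b * lam / (rho * (rho + lam)) * Real.exp (-lo / 2)))).congr_deriv ?_
    unfold flow
    field_simp
    ring
  · have h1 := m.stop_eq_flow
    have h2 : A * Real.exp (lo / 2) = flow a b lo / (rho + lam) := by
      rw [← h1]; field_simp
    rw [leftValue_of_le le_rfl, h2, flow]
    simp only [sub_self, mul_zero, Real.exp_zero, mul_one]
    field_simp
    ring

/-- At `rho = 0` the homogeneous solution is itself `exp (−z / 2)`, so the second flow term is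
resonant and a factor linear in `z` appears. This is why the cutoff takes a different form there. -/
theorem leftValue_eq_of_rho_zero (m : Model lam 0 a b A B lo hi q) {z : ℝ} (hz : lo ≤ z) :
    leftValue lam 0 a b A lo z = a / lam * Real.exp (z / 2) +
      b / lam * ((z - lo + 1) * Real.exp (-z / 2)) := by
  have hlam := m.lam_pos
  refine m.isRise_leftValue.eq_of_eq
    (χ := fun z => a / lam * Real.exp (z / 2) +
      b / lam * ((z - lo + 1) * Real.exp (-z / 2))) (fun z _ => ?_) hz ?_
  · have h1 : HasDerivAt (fun z : ℝ => z - lo + 1) 1 z := by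
      simpa using ((hasDerivAt_id z).sub_const lo).add_const 1
    refine (((hasDerivAt_exp_half z).const_mul (a / lam)).fun_add
      ((h1.fun_mul (hasDerivAt_exp_neg_half z)).const_mul (b / lam))).congr_deriv ?_
    unfold flow
    field_simp
    ring
  · have h1 := m.stop_eq_flow
    rw [zero_add] at h1
    have h2 : A * Real.exp (lo / 2) = flow a b lo / lam := by
      rw [← h1]; field_simp
    rw [leftValue_of_le le_rfl, h2, flow]
    field_simp
    ring

theorem flow_q (m : Model lam rho a b A B lo hi q) :
    flow a b q = 2 * b * Real.exp (-q / 2) := by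
  rw [flow_eq_mul, m.q_eq]; ring

theorem exp_half_q (m : Model lam rho a b A B lo hi q) :
    a * Real.exp (q / 2) = b * Real.exp (-q / 2) := by
  rw [exp_half_eq_mul, ← m.q_eq]; ring

/-- Own-biased learning is worse than waiting at `q` iff `q - lo` exceeds the cutoff. -/
theorem leftValue_flow_iff (m : Model lam rho a b A B lo hi q) :
    (flow a b q < (rho + lam / 2) * leftValue lam rho a b A lo q ↔ logCutoff lam rho < q - lo) ∧
      ((rho + lam / 2) * leftValue lam rho a b A lo q < flow a b q ↔
        q - lo < logCutoff lam rho) := by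
  have hlam := m.lam_pos
  have hb := m.b_pos
  -- For `q ≤ lo` the explicit formulas do not apply, but the left value is the stopping loss, which
  -- is below the cost of waiting, and the cutoff is positive.
  rcases le_or_gt q lo with hq | hq
  · have h1 := m.mul_leftValue_lt_of_le hq
    have h2 := logCutoff_pos (rho := rho) hlam
    exact ⟨iff_of_false (not_lt.2 h1.le) (by linarith), iff_of_true h1 (by linarith)⟩
  have he := Real.exp_pos (-q / 2)
  have hQ := m.exp_half_q
  rcases m.rho_nonneg.eq_or_lt with h0 | h0
  · subst h0
    rw [m.leftValue_eq_of_rho_zero hq.le, m.flow_q, logCutoff, if_neg (lt_irrefl _)]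
    -- By the choice of `q` both terms of the flow are equal there, and the excess of the left value
    -- over waiting factors through `q − lo − 2`.
    have : (0 + lam / 2) * (a / lam * Real.exp (q / 2) +
        b / lam * ((q - lo + 1) * Real.exp (-q / 2))) - 2 * b * Real.exp (-q / 2) =
        (b * Real.exp (-q / 2) / 2) * (q - lo - 2) := by
      generalize Real.exp (-q / 2) = x at *
      field_simp
      linear_combination lam * hQ
    have hκ : 0 < b * Real.exp (-q / 2) / 2 := by positivity
    constructor
    · rw [← sub_pos, this, mul_pos_iff_of_pos_left hκ, sub_pos]
    · rw [← sub_neg, this, ← neg_pos, ← mul_neg, mul_pos_iff_of_pos_left hκ, neg_pos, sub_neg]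
  · rw [m.leftValue_eq_of_rho_pos h0 hq.le, m.flow_q, logCutoff, if_pos h0]
    have h1 : Real.exp (-lo / 2) * Real.exp (-((rho + lam / 2) / lam) * (q - lo)) =
        Real.exp (-q / 2) * Real.exp (-(rho / lam * (q - lo))) := by
      rw [← Real.exp_add, ← Real.exp_add]; congr 1; field_simp; ring
    -- Again a positive factor times a bracket that depends only on `q − lo`; the bracket changes
    -- sign at the cutoff.
    have h2 : (rho + lam / 2) * (a / (rho + lam) * Real.exp (q / 2) +
        b / rho * Real.exp (-q / 2) - b * lam / (rho * (rho + lam)) * Real.exp (-lo / 2) *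
        Real.exp (-((rho + lam / 2) / lam) * (q - lo))) - 2 * b * Real.exp (-q / 2) =
        (b * Real.exp (-q / 2) * lam * (2 * rho + lam) / (2 * rho * (rho + lam))) *
          (lam / (2 * rho + lam) - Real.exp (-(rho / lam * (q - lo)))) := by
      rw [mul_assoc (b * lam / _), h1]
      generalize Real.exp (-q / 2) = x at *
      field_simp
      linear_combination (rho * (2 * rho + lam)) * hQ
    have hκ : 0 < b * Real.exp (-q / 2) * lam * (2 * rho + lam) / (2 * rho * (rho + lam)) := by
      positivity
    have hlog : Real.log (lam / (2 * rho + lam)) = -Real.log ((2 * rho + lam) / lam) := by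
      rw [← Real.log_inv, inv_div]
    constructor
    · rw [← sub_pos, h2, mul_pos_iff_of_pos_left hκ, sub_pos,
        ← Real.lt_log_iff_exp_lt (by positivity), hlog, neg_lt_neg_iff, ← inv_div rho lam,
        inv_mul_lt_iff₀ (by positivity)]
    · rw [← sub_neg, h2, ← neg_pos, ← mul_neg, mul_pos_iff_of_pos_left hκ, neg_pos, sub_neg,
        ← Real.log_lt_iff_lt_exp (by positivity), hlog, neg_lt_neg_iff, ← inv_div rho lam,
        lt_inv_mul_iff₀ (by positivity)]

theorem rightValue_flow_iff (m : Model lam rho a b A B lo hi q) :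
    (flow a b q < (rho + lam / 2) * rightValue lam rho a b B hi q ↔ logCutoff lam rho < hi - q) ∧
      ((rho + lam / 2) * rightValue lam rho a b B hi q < flow a b q ↔
        hi - q < logCutoff lam rho) := by
  rw [← flow_neg, show hi - q = -q - -hi by ring]
  exact m.reflect.leftValue_flow_iff

end Model

/-! ### Assembling value functions from pieces. -/

theorem subAt_ite {lam r k z : ℝ} {S f g : ℝ → ℝ} (hf : z ≤ k → SubAt lam r S f z)
    (hg : k ≤ z → SubAt lam r S g z) (h : f k = g k) :
    SubAt lam r S (fun z => if z ≤ k then f z else g z) z := by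
  have hright : ∀ w, k ≤ w → (fun z => if z ≤ k then f z else g z) w = g w := by
    intro w hw
    rcases hw.eq_or_lt with rfl | hlt
    · simp [h]
    · exact if_neg (not_le.2 hlt)
  have hleft : ∀ w ≤ k, (fun z => if z ≤ k then f z else g z) w = f w := fun w hw => if_pos hw
  rcases lt_trichotomy z k with hz | rfl | hz
  · have heq : (fun z => if z ≤ k then f z else g z) =ᶠ[𝓝 z] f :=
      (gt_mem_nhds hz).mono fun w hw => hleft w (le_of_lt hw)
    obtain ⟨⟨d, hd, hd'⟩, ⟨e, he, he'⟩⟩ := hf hz.le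
    rw [← hleft z hz.le] at hd' he'
    exact ⟨⟨d, hd.congr_of_eventuallyEq (mem_nhdsWithin_of_mem_nhds heq) (hleft z hz.le), hd'⟩,
      ⟨e, he.congr_of_eventuallyEq (mem_nhdsWithin_of_mem_nhds heq) (hleft z hz.le), he'⟩⟩
  -- At the seam the left derivative comes from `f` and the right one from `g`. They need not agree,
  -- which is why `SubAt` asks only for one-sided derivatives.
  · obtain ⟨d, hd, hd'⟩ := (hf le_rfl).1
    obtain ⟨e, he, he'⟩ := (hg le_rfl).2
    rw [← hleft z le_rfl] at hd'
    rw [← hright z le_rfl] at he'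
    exact ⟨⟨d, hd.congr (fun w hw => hleft w hw) (hleft z le_rfl), hd'⟩,
      ⟨e, he.congr (fun w hw => hright w hw) (hright z le_rfl), he'⟩⟩
  · have heq : (fun z => if z ≤ k then f z else g z) =ᶠ[𝓝 z] g :=
      (lt_mem_nhds hz).mono fun w hw => hright w (le_of_lt hw)
    obtain ⟨⟨d, hd, hd'⟩, ⟨e, he, he'⟩⟩ := hg hz.le
    rw [← hright z hz.le] at hd' he'
    exact ⟨⟨d, hd.congr_of_eventuallyEq (mem_nhdsWithin_of_mem_nhds heq) (hright z hz.le), hd'⟩,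
      ⟨e, he.congr_of_eventuallyEq (mem_nhdsWithin_of_mem_nhds heq) (hright z hz.le), he'⟩⟩

/-- `φ` is the value function of a stopping problem whose learning region is `(lo, hi)`. -/
structure IsValue (lam r : ℝ) (S ψ : ℝ → ℝ) (lo hi : ℝ) (φ : ℝ → ℝ) : Prop where
  lam_pos : 0 < lam
  r_pos : 0 < r
  continuous_flow : Continuous S
  flow_nonneg : ∀ z, 0 ≤ S z
  sub : ∀ z, SubAt lam r S φ z
  nonneg : ∀ z, 0 ≤ φ z
  lt_terminal : ∀ z ∈ Ioo lo hi, φ z < ψ z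
  eq_terminal : ∀ z, z ∉ Ioo lo hi → φ z = ψ z
  bounded : ∃ M, ∀ z, φ z ≤ M
  stop_low : ∀ z < lo, ∃ d, HasDerivAt φ d z ∧ r * φ z + lam * |d| < S z
  stop_high : ∀ z > hi, ∃ d, HasDerivAt φ d z ∧ r * φ z + lam * |d| < S z
  near_low : ∃ k > lo, ∀ z ∈ Ico lo k, ∃ d, HasDerivAt φ d z ∧ 0 < d ∧ r * φ z + lam * d = S z
  near_high : ∃ k < hi, ∀ z ∈ Ioc k hi, ∃ d, HasDerivAt φ d z ∧ d < 0 ∧ r * φ z - lam * d = S z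

theorem stopLoss_le {A B : ℝ} (hA : 0 < A) (hB : 0 < B) (z : ℝ) : stopLoss A B z ≤ max A B := by
  rcases le_total z 0 with h | h
  · refine (min_le_left _ _).trans (le_trans ?_ (le_max_left _ _))
    have : Real.exp (z / 2) ≤ 1 := Real.exp_le_one_iff.2 (by linarith)
    nlinarith
  · refine (min_le_right _ _).trans (le_trans ?_ (le_max_right _ _))
    have : Real.exp (-z / 2) ≤ 1 := Real.exp_le_one_iff.2 (by linarith)
    nlinarith

/-- As long as waiting is no cheaper, the slope is nonnegative and the equation for `φ` is the
dynamic programming equation with equality. -/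
theorem IsRise.subAt {lam rho a b z₁ z : ℝ} {φ : ℝ → ℝ} (h : IsRise lam rho a b z₁ φ)
    (hlam : 0 < lam) (hz : z₁ ≤ z) (hle : (rho + lam / 2) * φ z ≤ flow a b z) :
    SubAt lam (rho + lam / 2) (flow a b) φ z := by
  refine SubAt.of_hasDerivAt (h z hz) ?_
  rw [abs_div, abs_of_pos hlam, abs_of_nonneg (sub_nonneg.2 hle)]
  field_simp
  linarith

theorem IsFall.subAt {lam rho a b z₁ z : ℝ} {φ : ℝ → ℝ} (h : IsFall lam rho a b z₁ φ)
    (hlam : 0 < lam) (hz : z ≤ z₁) (hle : (rho + lam / 2) * φ z ≤ flow a b z) :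
    SubAt lam (rho + lam / 2) (flow a b) φ z := by
  refine SubAt.of_hasDerivAt (h z hz) ?_
  rw [abs_neg, abs_div, abs_of_pos hlam, abs_of_nonneg (sub_nonneg.2 hle)]
  field_simp
  linarith

namespace Model

variable {lam rho a b A B lo hi q : ℝ}

theorem stopLoss_eq_left (m : Model lam rho a b A B lo hi q) {z : ℝ} (hz : z ≤ lo) :
    stopLoss A B z = A * Real.exp (z / 2) := by
  refine min_eq_left ?_
  rw [exp_half_eq_mul]
  have h1 : A * Real.exp z < B :=
    (mul_le_mul_of_nonneg_left (Real.exp_le_exp.2 hz) m.A_pos.le).trans_lt m.A_mul_exp_lo_lt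
  have := mul_lt_mul_of_pos_right h1 (Real.exp_pos (-z / 2))
  linarith

theorem stopLoss_eq_right (m : Model lam rho a b A B lo hi q) {z : ℝ} (hz : hi ≤ z) :
    stopLoss A B z = B * Real.exp (-z / 2) := by
  rw [← stopLoss_neg]; exact m.reflect.stopLoss_eq_left (neg_le_neg hz)

theorem left_strict (m : Model lam rho a b A B lo hi q) {z : ℝ} (hz : z < lo) :
    ∃ d, HasDerivAt (leftValue lam rho a b A lo) d z ∧
      (rho + lam / 2) * leftValue lam rho a b A lo z + lam * |d| < flow a b z := by
  refine ⟨_, hasDerivAt_leftValue_of_lt hz, ?_⟩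
  have := m.stop_lt_flow hz
  have h2 := mul_pos m.A_pos (Real.exp_pos (z / 2))
  rw [leftValue_of_le hz.le, abs_of_pos (mul_pos m.A_pos (by positivity))]
  linarith

theorem right_strict (m : Model lam rho a b A B lo hi q) {z : ℝ} (hz : hi < z) :
    ∃ d, HasDerivAt (rightValue lam rho a b B hi) d z ∧
      (rho + lam / 2) * rightValue lam rho a b B hi z + lam * |d| < flow a b z := by
  obtain ⟨d, hd, h⟩ := m.reflect.left_strict (neg_lt_neg hz)
  refine ⟨-d, (hd.comp z (hasDerivAt_neg z)).congr_deriv (by ring), ?_⟩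
  rw [abs_neg, ← flow_neg]
  exact h

theorem subAt_leftValue (m : Model lam rho a b A B lo hi q) {z : ℝ}
    (h : lo ≤ z → (rho + lam / 2) * leftValue lam rho a b A lo z ≤ flow a b z) :
    SubAt lam (rho + lam / 2) (flow a b) (leftValue lam rho a b A lo) z := by
  rcases lt_or_ge z lo with hz | hz
  · obtain ⟨d, hd, h⟩ := m.left_strict hz
    exact SubAt.of_hasDerivAt hd h.le
  · exact m.isRise_leftValue.subAt m.lam_pos hz (h hz)

theorem subAt_rightValue (m : Model lam rho a b A B lo hi q) {z : ℝ}
    (h : z ≤ hi → (rho + lam / 2) * rightValue lam rho a b B hi z ≤ flow a b z) :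
    SubAt lam (rho + lam / 2) (flow a b) (rightValue lam rho a b B hi) z := by
  rcases lt_or_ge hi z with hz | hz
  · obtain ⟨d, hd, h⟩ := m.right_strict hz
    exact SubAt.of_hasDerivAt hd h.le
  · exact m.isFall_rightValue.subAt m.lam_pos hz (h hz)

/-- At `lo` the left value is strictly below the cost of waiting; by continuity it still is slightly
above `lo`, so the slope there is positive. -/
theorem near_low (m : Model lam rho a b A B lo hi q) {k : ℝ} (hk : lo < k) {φ : ℝ → ℝ}
    (hφ : ∀ z ≤ k, φ z = leftValue lam rho a b A lo z) :
    ∃ k > lo, ∀ z ∈ Ico lo k, ∃ d, HasDerivAt φ d z ∧ 0 < d ∧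
      (rho + lam / 2) * φ z + lam * d = flow a b z := by
  have hc := (m.isRise_leftValue lo le_rfl).continuousAt
  have h1 : ∀ᶠ z in 𝓝 lo, (rho + lam / 2) * leftValue lam rho a b A lo z < flow a b z :=
    (hc.const_mul _).eventually_lt (continuous_flow a b).continuousAt
      (m.mul_leftValue_lt_of_le le_rfl)
  obtain ⟨e, he, h2⟩ := mem_nhdsGE_iff_exists_Ico_subset.1 (mem_nhdsWithin_of_mem_nhds h1 :
    _ ∈ 𝓝[≥] lo)
  refine ⟨min e k, lt_min he hk, fun z hz => ?_⟩
  have hzk : z < k := hz.2.trans_le (min_le_right _ _)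
  have h3 : (rho + lam / 2) * leftValue lam rho a b A lo z < flow a b z :=
    h2 ⟨hz.1, hz.2.trans_le (min_le_left _ _)⟩
  refine ⟨_, (m.isRise_leftValue z hz.1).congr_of_eventuallyEq
    ((gt_mem_nhds hzk).mono fun w hw => hφ w (le_of_lt hw)), div_pos (by linarith) m.lam_pos, ?_⟩
  have := m.lam_pos
  rw [hφ z hzk.le]
  field_simp
  ring

theorem near_high (m : Model lam rho a b A B lo hi q) {k : ℝ} (hk : k < hi) {φ : ℝ → ℝ}
    (hφ : ∀ z, k ≤ z → φ z = rightValue lam rho a b B hi z) :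
    ∃ k < hi, ∀ z ∈ Ioc k hi, ∃ d, HasDerivAt φ d z ∧ d < 0 ∧
      (rho + lam / 2) * φ z - lam * d = flow a b z := by
  obtain ⟨k', hk', h⟩ := m.reflect.near_low (neg_lt_neg hk) (φ := fun z => φ (-z))
    (fun z hz => by rw [hφ (-z) (by linarith), rightValue, neg_neg])
  refine ⟨-k', by linarith [show -hi < k' from hk'], fun z hz => ?_⟩
  obtain ⟨d, hd, h0, h1⟩ := h (-z) ⟨neg_le_neg hz.2, by linarith [hz.1]⟩
  have hd' := hd.comp z (hasDerivAt_neg z)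
  simp only [Function.comp_def, neg_neg] at hd'
  refine ⟨_, hd', by linarith, ?_⟩
  rw [neg_neg, flow_neg] at h1
  linarith

/-- A function that agrees with the one-sided values near the boundaries is the value function if
it is a subsolution below the stopping loss. -/
theorem isValue (m : Model lam rho a b A B lo hi q) {kl kr : ℝ} (hkl : lo < kl) (hkr : kr < hi)
    {φ : ℝ → ℝ} (hl : ∀ z ≤ kl, φ z = leftValue lam rho a b A lo z)
    (hr : ∀ z, kr ≤ z → φ z = rightValue lam rho a b B hi z)
    (hsub : ∀ z, SubAt lam (rho + lam / 2) (flow a b) φ z) (hpos : ∀ z ∈ Ioo lo hi, 0 ≤ φ z)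
    (hlt : ∀ z ∈ Ioo lo hi, φ z < stopLoss A B z) :
    IsValue lam (rho + lam / 2) (flow a b) (stopLoss A B) lo hi φ where
  lam_pos := m.lam_pos
  r_pos := m.r_pos
  continuous_flow := continuous_flow a b
  flow_nonneg z := (flow_pos m.a_pos m.b_pos z).le
  sub := hsub
  nonneg z := by
    rcases le_or_gt z lo with h | h
    · rw [hl z (h.trans hkl.le)]; exact (m.leftValue_pos z).le
    rcases le_or_gt hi z with h' | h'
    · rw [hr z (hkr.le.trans h')]; exact (m.rightValue_pos z).le
    · exact hpos z ⟨h, h'⟩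
  lt_terminal := hlt
  eq_terminal z hz := by
    rcases le_or_gt z lo with h | h
    · rw [hl z (h.trans hkl.le), leftValue_of_le h, m.stopLoss_eq_left h]
    rcases le_or_gt hi z with h' | h'
    · rw [hr z (hkr.le.trans h'), rightValue_of_ge h', m.stopLoss_eq_right h']
    · exact absurd ⟨h, h'⟩ hz
  bounded := by
    refine ⟨max A B, fun z => le_trans ?_ (stopLoss_le m.A_pos m.B_pos z)⟩
    rcases le_or_gt z lo with h | h
    · rw [hl z (h.trans hkl.le), leftValue_of_le h, m.stopLoss_eq_left h]
    rcases le_or_gt hi z with h' | h'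
    · rw [hr z (hkr.le.trans h'), rightValue_of_ge h', m.stopLoss_eq_right h']
    · exact (hlt z ⟨h, h'⟩).le
  stop_low z hz := by
    obtain ⟨d, hd, h⟩ := m.left_strict hz
    refine ⟨d, hd.congr_of_eventuallyEq ((gt_mem_nhds hz).mono fun w hw =>
      hl w ((le_of_lt hw).trans hkl.le)), ?_⟩
    rwa [hl z (hz.le.trans hkl.le)]
  stop_high z hz := by
    obtain ⟨d, hd, h⟩ := m.right_strict hz
    refine ⟨d, hd.congr_of_eventuallyEq ((lt_mem_nhds hz).mono fun w hw =>
      hr w (hkr.le.trans (le_of_lt hw))), ?_⟩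
    rwa [hr z (hkr.le.trans (le_of_lt hz))]
  near_low := m.near_low hkl hl
  near_high := m.near_high hkr hr

end Model

/-- The value function of own-biased learning with switch point `k`. -/
structure IsOwnValue (lam r : ℝ) (S ψ : ℝ → ℝ) (lo k hi q : ℝ) (φ : ℝ → ℝ) : Prop extends
    IsValue lam r S ψ lo hi φ where
  lo_lt : lo < k
  lt_hi : k < hi
  rising : ∀ z ∈ Ico lo k, HasDerivAt φ ((S z - r * φ z) / lam) z
  falling : ∀ z ∈ Ioc k hi, HasDerivAt φ (-((S z - r * φ z) / lam)) z
  lt_flow : ∀ z ∈ Icc lo hi, z ≠ q → r * φ z < S z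

/-- The value function of own-biased learning on `(lo, kl)` and `(kr, hi)` and opposite-biased
learning on `(kl, kr)`. -/
structure IsMixedValue (lam r : ℝ) (S ψ : ℝ → ℝ) (lo kl q kr hi : ℝ) (φ : ℝ → ℝ) : Prop extends
    IsValue lam r S ψ lo hi φ where
  lo_lt : lo < kl
  kl_lt : kl < q
  lt_kr : q < kr
  lt_hi : kr < hi
  rising : ∀ z ∈ Ico lo kl, HasDerivAt φ ((S z - r * φ z) / lam) z
  falling : ∀ z ∈ Ioc kr hi, HasDerivAt φ (-((S z - r * φ z) / lam)) z
  falling_left : ∀ z ∈ Ioo kl q, HasDerivAt φ (-((S z - r * φ z) / lam)) z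
  rising_right : ∀ z ∈ Ioo q kr, HasDerivAt φ ((S z - r * φ z) / lam) z
  lt_flow : ∀ z ∈ Icc lo hi, z ≠ q → r * φ z < S z
  eq_flow : r * φ q = S q

namespace Model

variable {lam rho a b A B lo hi q : ℝ}

/-- The value is the lower envelope of the two one-sided values on `[lo, hi]`. The second conclusion
is for uniqueness: if one of the comparisons at `q` is strict, resting is suboptimal at every point,
including `q`. -/
theorem exists_isOwnValue (m : Model lam rho a b A B lo hi q)
    (h : (rho + lam / 2) * leftValue lam rho a b A lo q ≤ flow a b q ∨
      (rho + lam / 2) * rightValue lam rho a b B hi q ≤ flow a b q) :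
    ∃ k φ, IsOwnValue lam (rho + lam / 2) (flow a b) (stopLoss A B) lo k hi q φ ∧
      (((rho + lam / 2) * leftValue lam rho a b A lo q < flow a b q ∨
        (rho + lam / 2) * rightValue lam rho a b B hi q < flow a b q) →
        ∀ z ∈ Icc lo hi, (rho + lam / 2) * φ z < flow a b z) := by
  obtain ⟨k, hk, hkeq, hlt, hgt, hL, hR⟩ := m.exists_isSwitch h
  have hr := m.r_pos
  set φ : ℝ → ℝ := fun z => if z ≤ k then leftValue lam rho a b A lo z
    else rightValue lam rho a b B hi z with hφ
  have hφl : ∀ z ≤ k, φ z = leftValue lam rho a b A lo z := fun z hz => if_pos hz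
  have hφr : ∀ z, k ≤ z → φ z = rightValue lam rho a b B hi z := fun z hz => by
    rcases hz.eq_or_lt with rfl | h'
    · rw [hφl _ le_rfl, hkeq]
    · exact if_neg (not_le.2 h')
  -- Being below both one-sided values, `φ` is below the cost of waiting at `q` whichever of the two
  -- hypotheses holds there.
  have hle : ∀ z ∈ Icc lo hi, φ z ≤ leftValue lam rho a b A lo z ∧
      φ z ≤ rightValue lam rho a b B hi z := by
    intro z hz
    rcases lt_trichotomy z k with h' | rfl | h'
    · rw [hφl z h'.le]; exact ⟨le_rfl, (hlt z ⟨hz.1, h'⟩).le⟩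
    · rw [hφl z le_rfl]; exact ⟨le_rfl, hkeq.le⟩
    · rw [hφr z h'.le]; exact ⟨(hgt z ⟨h', hz.2⟩).le, le_rfl⟩
  have hoff : ∀ z ∈ Icc lo hi, z ≠ q → (rho + lam / 2) * φ z < flow a b z := by
    intro z hz hzq
    rcases le_total z k with h' | h'
    · rw [hφl z h']; exact hL z ⟨hz.1, h'⟩ hzq
    · rw [hφr z h']; exact hR z ⟨h', hz.2⟩ hzq
  have hall : ∀ z ∈ Icc lo hi, (rho + lam / 2) * φ z ≤ flow a b z := by
    intro z hz
    by_cases hzq : z = q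
    · subst hzq
      rcases h with h | h
      · exact (mul_le_mul_of_nonneg_left (hle z hz).1 hr.le).trans h
      · exact (mul_le_mul_of_nonneg_left (hle z hz).2 hr.le).trans h
    · exact (hoff z hz hzq).le
  refine ⟨k, φ, ⟨m.isValue hk.1 hk.2 hφl hφr (fun z => subAt_ite (fun hz => ?_) (fun hz => ?_) hkeq)
    (fun z _ => ?_) (fun z hz => ?_), hk.1, hk.2, fun z hz => ?_, fun z hz => ?_, hoff⟩,
    fun hs z hz => ?_⟩
  · refine m.subAt_leftValue fun hz' => ?_
    rw [← hφl z hz]; exact hall z ⟨hz', hz.trans hk.2.le⟩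
  · refine m.subAt_rightValue fun hz' => ?_
    rw [← hφr z hz]; exact hall z ⟨hk.1.le.trans hz, hz'⟩
  · rcases le_total z k with h' | h'
    · rw [hφl z h']; exact (m.leftValue_pos z).le
    · rw [hφr z h']; exact (m.rightValue_pos z).le
  · have h1 := hle z (Ioo_subset_Icc_self hz)
    exact lt_min (h1.1.trans_lt (m.leftValue_lt_terminal hz.1))
      (h1.2.trans_lt (m.rightValue_lt_terminal hz.2))
  · rw [hφl z hz.2.le]
    exact hasDerivAt_ite_of_lt hz.2 (m.isRise_leftValue z hz.1)
  · rw [hφr z hz.1.le]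
    exact hasDerivAt_ite_of_gt hz.1 (m.isFall_rightValue z hz.2)
  · by_cases hzq : z = q
    · subst hzq
      rcases hs with h | h
      · exact (mul_le_mul_of_nonneg_left (hle z hz).1 hr.le).trans_lt h
      · exact (mul_le_mul_of_nonneg_left (hle z hz).2 hr.le).trans_lt h
    · exact hoff z hz hzq

/-- Four solutions are glued at `kl`, `q` and `kr`. At `q` the two waiting values meet with `rφ =
S`, hence with slope zero, so only the two switches can be kinks. -/
theorem exists_isMixedValue (m : Model lam rho a b A B lo hi q)
    (hl : flow a b q < (rho + lam / 2) * leftValue lam rho a b A lo q)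
    (hr : flow a b q < (rho + lam / 2) * rightValue lam rho a b B hi q) :
    ∃ kl kr φ, IsMixedValue lam (rho + lam / 2) (flow a b) (stopLoss A B) lo kl q kr hi φ := by
  have hrp := m.r_pos
  have hlq := m.lo_lt_q hl
  have hr' : flow b a (-q) < (rho + lam / 2) * leftValue lam rho b a B (-hi) (-q) := by
    rwa [flow_neg]
  have hqh : q < hi := neg_lt_neg_iff.1 (m.reflect.lo_lt_q hr')
  obtain ⟨kl, hkl, hkleq, hklt, hkgt, hkL⟩ := m.exists_isLeftSwitch hl
  obtain ⟨kr', hkr', hkreq', hkrlt', hkrgt', hkR'⟩ := m.reflect.exists_isLeftSwitch hr'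
  obtain ⟨kr, rfl⟩ : ∃ kr, kr' = -kr := ⟨-kr', (neg_neg _).symm⟩
  have hkr : kr ∈ Ioo q hi := ⟨neg_lt_neg_iff.1 hkr'.2, neg_lt_neg_iff.1 hkr'.1⟩
  have hwn : ∀ z, waitLeft lam rho b a (-q) (-z) = waitRight lam rho a b q z := fun z => by
    simp [waitLeft]
  have hkreq : waitRight lam rho a b q kr = rightValue lam rho a b B hi kr := by
    rw [hwn] at hkreq'; exact hkreq'.symm
  have hkrlt : ∀ z ∈ Ico q kr, waitRight lam rho a b q z < rightValue lam rho a b B hi z := by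
    intro z hz
    have := hkrgt' (-z) ⟨neg_lt_neg hz.2, neg_le_neg hz.1⟩
    rwa [hwn] at this
  have hkrgt : ∀ z ∈ Ioc kr hi, rightValue lam rho a b B hi z < waitRight lam rho a b q z := by
    intro z hz
    have := hkrlt' (-z) ⟨neg_le_neg hz.2, neg_lt_neg hz.1⟩
    rwa [hwn] at this
  have hkR : ∀ z ∈ Icc kr hi, (rho + lam / 2) * rightValue lam rho a b B hi z < flow a b z := by
    intro z hz
    have := hkR' (-z) ⟨neg_le_neg hz.2, neg_le_neg hz.1⟩
    rwa [flow_neg] at this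
  -- The waiting values are compared with the one-sided value of the same direction of motion; the
  -- opposite one is handled by the crossings at `kl` and `kr`. Together this puts `φ` below both
  -- one-sided values, hence strictly below the stopping loss in `(lo, hi)`.
  have hWl : ∀ z ≤ q, waitLeft lam rho a b q z < rightValue lam rho a b B hi z := fun z hz =>
    m.waitLeft_lt_rightValue hr hz
  have hWr : ∀ z, q ≤ z → waitRight lam rho a b q z < leftValue lam rho a b A lo z := by
    intro z hz
    have := m.reflect.waitLeft_lt_rightValue (z := -z) (by rwa [rightValue_neg, flow_neg])
      (neg_le_neg hz)
    rwa [hwn, rightValue_neg] at this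
  have hqq : waitLeft lam rho a b q q = waitRight lam rho a b q q :=
    mul_left_cancel₀ hrp.ne' (m.mul_waitLeft_self.trans m.mul_waitRight_self.symm)
  set φr : ℝ → ℝ := fun z => if z ≤ kr then waitRight lam rho a b q z
    else rightValue lam rho a b B hi z with hφr
  set φm : ℝ → ℝ := fun z => if z ≤ q then waitLeft lam rho a b q z else φr z with hφm
  set φ : ℝ → ℝ := fun z => if z ≤ kl then leftValue lam rho a b A lo z else φm z with hφ
  have hφrq : φr q = waitRight lam rho a b q q := if_pos hkr.1.le
  have hφmkl : φm kl = waitLeft lam rho a b q kl := if_pos hkl.2.le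
  have e1 : ∀ z ≤ kl, φ z = leftValue lam rho a b A lo z := fun z hz => if_pos hz
  have e2 : ∀ z, kl ≤ z → z ≤ q → φ z = waitLeft lam rho a b q z := fun z h1 h2 => by
    rcases h1.eq_or_lt with rfl | h
    · rw [e1 _ le_rfl, hkleq]
    · simp only [hφ, hφm, if_neg (not_le.2 h), if_pos h2]
  have e3 : ∀ z, q ≤ z → z ≤ kr → φ z = waitRight lam rho a b q z := fun z h1 h2 => by
    rcases h1.eq_or_lt with rfl | h
    · rw [e2 _ hkl.2.le le_rfl, hqq]
    · simp only [hφ, hφm, hφr, if_neg (not_le.2 (hkl.2.trans h)), if_neg (not_le.2 h), if_pos h2]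
  have e4 : ∀ z, kr ≤ z → φ z = rightValue lam rho a b B hi z := fun z h1 => by
    rcases h1.eq_or_lt with rfl | h
    · rw [e3 _ hkr.1.le le_rfl, hkreq]
    · have h2 := hkr.1.trans h
      simp only [hφ, hφm, hφr, if_neg (not_le.2 (hkl.2.trans h2)), if_neg (not_le.2 h2),
        if_neg (not_le.2 h)]
  have hWLfall : IsFall lam rho a b q (waitLeft lam rho a b q) := isFall_waitLeft
  have hWRrise : IsRise lam rho a b q (waitRight lam rho a b q) := isRise_rise _ _ _ _ _ _
  have hsub : ∀ z, SubAt lam (rho + lam / 2) (flow a b) φ z := by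
    refine fun z => subAt_ite (fun hz => m.subAt_leftValue fun hz' => (hkL z ⟨hz', hz⟩).le)
      (fun _ => subAt_ite (fun hw => hWLfall.subAt m.lam_pos hw ?_) (fun hw =>
        subAt_ite (fun _ => hWRrise.subAt m.lam_pos hw ?_)
          (fun hv => m.subAt_rightValue fun hv' => (hkR z ⟨hv, hv'⟩).le)
        hkreq) (hqq.trans hφrq.symm)) (hkleq.trans hφmkl.symm)
    · rcases hw.eq_or_lt with rfl | h
      · exact m.mul_waitLeft_self.le
      · exact (m.mul_waitLeft_lt h).le
    · rcases hw.eq_or_lt with rfl | h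
      · exact m.mul_waitRight_self.le
      · exact (m.mul_waitRight_lt h).le
  have hpos : ∀ z, 0 < φ z := by
    intro z
    have hflow := flow_pos m.a_pos m.b_pos z
    have hrl : 0 < rho + lam := by linarith [m.r_pos, m.lam_pos]
    rcases le_total z kl with h1 | h1
    · rw [e1 z h1]; exact m.leftValue_pos z
    rcases le_total z q with h2 | h2
    · rw [e2 z h1 h2]
      exact (mul_pos_iff_of_pos_left hrl).1 (hflow.trans (m.flow_lt_waitLeft h2))
    rcases le_total z kr with h3 | h3
    · rw [e3 z h2 h3]
      exact (mul_pos_iff_of_pos_left hrl).1 (hflow.trans (m.flow_lt_waitRight h2))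
    · rw [e4 z h3]; exact m.rightValue_pos z
  have hlt : ∀ z ∈ Ioo lo hi, φ z < leftValue lam rho a b A lo z ∨
      φ z = leftValue lam rho a b A lo z := by
    intro z hz
    rcases le_or_gt z kl with h1 | h1
    · exact Or.inr (e1 z h1)
    rcases le_total z q with h2 | h2
    · rw [e2 z h1.le h2]; exact Or.inl (hkgt z ⟨h1, h2⟩)
    rcases le_or_gt z kr with h3 | h3
    · rw [e3 z h2 h3]; exact Or.inl (hWr z h2)
    · rw [e4 z h3.le]; exact Or.inl ((hkrgt z ⟨h3, hz.2.le⟩).trans (hWr z h2))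
  have hlt' : ∀ z ∈ Ioo lo hi, φ z < rightValue lam rho a b B hi z ∨
      φ z = rightValue lam rho a b B hi z := by
    intro z hz
    rcases lt_or_ge z kl with h1 | h1
    · rw [e1 z h1.le]
      exact Or.inl ((hklt z ⟨hz.1.le, h1⟩).trans (hWl z (h1.le.trans hkl.2.le)))
    rcases le_total z q with h2 | h2
    · rw [e2 z h1 h2]; exact Or.inl (hWl z h2)
    rcases lt_or_ge z kr with h3 | h3
    · rw [e3 z h2 h3.le]; exact Or.inl (hkrlt z ⟨h2, h3⟩)
    · exact Or.inr (e4 z h3)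
  refine ⟨kl, kr, φ, m.isValue hkl.1 hkr.2 e1 e4 hsub (fun z _ => (hpos z).le) (fun z hz => ?_),
    hkl.1, hkl.2, hkr.1, hkr.2, fun z hz => ?_, fun z hz => ?_, fun z hz => ?_, fun z hz => ?_,
    fun z hz hzq => ?_, ?_⟩
  · refine lt_min ?_ ?_
    · exact ((hlt z hz).elim le_of_lt le_of_eq).trans_lt (m.leftValue_lt_terminal hz.1)
    · exact ((hlt' z hz).elim le_of_lt le_of_eq).trans_lt (m.rightValue_lt_terminal hz.2)
  · rw [e1 z hz.2.le]
    exact (m.isRise_leftValue z hz.1).congr_of_eventuallyEq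
      ((gt_mem_nhds hz.2).mono fun w hw => e1 w (le_of_lt hw))
  · rw [e4 z hz.1.le]
    exact (m.isFall_rightValue z hz.2).congr_of_eventuallyEq
      ((lt_mem_nhds hz.1).mono fun w hw => e4 w (le_of_lt hw))
  · rw [e2 z hz.1.le hz.2.le]
    exact (hWLfall z hz.2.le).congr_of_eventuallyEq
      (Filter.mem_of_superset (Ioo_mem_nhds hz.1 hz.2) fun w hw => e2 w hw.1.le hw.2.le)
  · rw [e3 z hz.1.le hz.2.le]
    exact (hWRrise z hz.1.le).congr_of_eventuallyEq
      (Filter.mem_of_superset (Ioo_mem_nhds hz.1 hz.2) fun w hw => e3 w hw.1.le hw.2.le)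
  · rcases le_total z kl with h1 | h1
    · rw [e1 z h1]; exact hkL z ⟨hz.1, h1⟩
    rcases lt_or_gt_of_ne hzq with h2 | h2
    · rw [e2 z h1 h2.le]; exact m.mul_waitLeft_lt h2
    rcases le_total z kr with h3 | h3
    · rw [e3 z h2.le h3]; exact m.mul_waitRight_lt h2
    · rw [e4 z h3]; exact hkR z ⟨h3, hz.2⟩
  · rw [e2 q hkl.2.le le_rfl]; exact m.mul_waitLeft_self

end Model

/-! ### Optimal trajectories for a given value function. -/

theorem path_lt_of_total_eq {lam r z₀ C : ℝ} {S φ θ : ℝ → ℝ} {T : ℝ≥0∞} (hS : Continuous S)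
    (hlam : 0 < lam) (hθ : IsControl θ)
    (hE : ∀ t ∈ before T, total r S φ (path lam z₀ θ) t = C) {k hi : ℝ} (hk : k < hi)
    (hout : ∀ z > hi, ∃ d, HasDerivAt φ d z ∧ r * φ z + lam * |d| < S z)
    (hup : ∀ z ∈ Ioc k hi, ∃ d, HasDerivAt φ d z ∧ d < 0 ∧ r * φ z - lam * d = S z)
    {t : ℝ} (ht : t ∈ before T) : path lam z₀ θ t < hi := by
  have hE' : ∀ t ∈ before T, total r (fun z => S (-z)) (fun z => φ (-z))
      (path lam (-z₀) fun t => -θ t) t = C := fun t ht => by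
    rw [← hE t ht]; simp only [total, path_neg, neg_neg]
  have := lt_path_of_total_eq (hS.comp continuous_neg) hlam hθ.neg hE' (neg_lt_neg hk)
    (fun z hz => by
      obtain ⟨d, hd, h⟩ := hout (-z) (by linarith)
      exact ⟨_, hd.comp z (hasDerivAt_neg z), by simpa using h⟩)
    (fun z hz => by
      obtain ⟨d, hd, h0, h⟩ := hup (-z) ⟨by linarith [hz.2], by linarith [hz.1]⟩
      exact ⟨_, hd.comp z (hasDerivAt_neg z), by linarith,
        by simp only [Function.comp_apply]; linarith⟩) ht
  rw [path_neg] at this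
  linarith

theorem before_ae_eq_path {lam z₀ κ : ℝ} {θ : ℝ → ℝ} {T : ℝ≥0∞} (hθ : IsControl θ)
    (hae : ∀ᵐ t, t ∈ before T → θ t = κ) {t : ℝ} (h0 : 0 ≤ t)
    (ht : ENNReal.ofReal t ≤ T) : path lam z₀ θ t = z₀ + lam * κ * t := by
  rw [path_eq_of_ae (k := κ) hθ h0, path_zero, sub_zero]
  filter_upwards [hae] with v hv hvm
  refine hv ⟨hvm.1.le, lt_of_lt_of_le ?_ ht⟩
  exact (ENNReal.ofReal_lt_ofReal_iff (hvm.1.trans hvm.2)).2 hvm.2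

namespace IsValue

variable {lam r lo hi z₀ : ℝ} {S ψ φ θ : ℝ → ℝ} {T : ℝ≥0∞}

theorem continuous (h : IsValue lam r S ψ lo hi φ) : Continuous φ :=
  continuous_iff_continuousAt.2 fun z => (h.sub z).continuousAt

theorem le_terminal (h : IsValue lam r S ψ lo hi φ) (z : ℝ) : φ z ≤ ψ z := by
  by_cases hz : z ∈ Ioo lo hi
  · exact (h.lt_terminal z hz).le
  · exact (h.eq_terminal z hz).le

theorem le_regret (h : IsValue lam r S ψ lo hi φ) (hθ : IsControl θ) :
    ENNReal.ofReal (φ z₀) ≤ regret r S ψ (path lam z₀ θ) T := by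
  obtain ⟨M, hM⟩ := h.bounded
  have := ofReal_le_regret (T := T) h.lam_pos h.r_pos h.continuous_flow h.flow_nonneg h.sub h.nonneg
    h.le_terminal hM (hθ.continuous_path (z₀ := z₀) h.lam_pos) (hθ.abs_path_sub_le h.lam_pos)
  rwa [path_zero] at this

theorem total_eq (h : IsValue lam r S ψ lo hi φ) (hθ : IsControl θ)
    (hle : regret r S ψ (path lam z₀ θ) T ≤ ENNReal.ofReal (φ z₀)) :
    ∀ t ∈ before T, total r S φ (path lam z₀ θ) t = φ z₀ := by
  obtain ⟨M, hM⟩ := h.bounded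
  have := (total_eq_of_regret_le (T := T) h.lam_pos h.r_pos h.continuous_flow h.flow_nonneg h.sub
    h.nonneg h.le_terminal hM (hθ.continuous_path (z₀ := z₀) h.lam_pos)
    (hθ.abs_path_sub_le h.lam_pos) (by rwa [path_zero])).1
  rwa [path_zero] at this

theorem end_notMem (h : IsValue lam r S ψ lo hi φ) (hθ : IsControl θ)
    (hle : regret r S ψ (path lam z₀ θ) T ≤ ENNReal.ofReal (φ z₀)) (hT : T ≠ ∞) :
    path lam z₀ θ T.toReal ∉ Ioo lo hi := by
  obtain ⟨M, hM⟩ := h.bounded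
  have := (total_eq_of_regret_le (T := T) h.lam_pos h.r_pos h.continuous_flow h.flow_nonneg h.sub
    h.nonneg h.le_terminal hM (hθ.continuous_path (z₀ := z₀) h.lam_pos)
    (hθ.abs_path_sub_le h.lam_pos) (by rwa [path_zero])).2 hT
  exact fun hmem => absurd this (h.lt_terminal _ hmem).ne

theorem path_mem (h : IsValue lam r S ψ lo hi φ) (hθ : IsControl θ)
    (hle : regret r S ψ (path lam z₀ θ) T ≤ ENNReal.ofReal (φ z₀)) {t : ℝ} (ht : t ∈ before T) :
    path lam z₀ θ t ∈ Ioo lo hi := by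
  have hE := h.total_eq hθ hle
  obtain ⟨k, hk, hk'⟩ := h.near_low
  obtain ⟨l, hl, hl'⟩ := h.near_high
  exact ⟨lt_path_of_total_eq h.continuous_flow h.lam_pos hθ hE hk h.stop_low hk' ht,
    path_lt_of_total_eq h.continuous_flow h.lam_pos hθ hE hl h.stop_high hl' ht⟩

theorem deadline_eq_zero (hin : ∀ t ∈ before T, path lam z₀ θ t ∈ Ioo lo hi)
    (hz : z₀ ∉ Ioo lo hi) : T = 0 := by
  by_contra hT
  refine hz ?_
  have := hin 0 ⟨le_rfl, by simpa using pos_iff_ne_zero.2 hT⟩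
  rwa [path_zero] at this

theorem regret_zero_le (h : IsValue lam r S ψ lo hi φ) (hθ : IsControl θ) (hz : z₀ ∉ Ioo lo hi) :
    regret r S ψ (path lam z₀ θ) 0 ≤ ENNReal.ofReal (φ z₀) := by
  have h1 := regret_le_of_total_eq (T := 0) (ψ := ψ) (r := r) h.continuous_flow h.flow_nonneg
    h.continuous h.nonneg h.le_terminal (hθ.continuous_path (z₀ := z₀) h.lam_pos)
    (fun t ht => absurd ht.2 (by simp)) (fun _ => by simpa [path_zero] using h.eq_terminal _ hz)
  rwa [path_zero] at h1

/-- The condition on `d` is the dynamic programming equation in the direction `κ`: moving that way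
changes `φ` at exactly the rate `rφ − S`. -/
theorem total_eq_of_straight (h : IsValue lam r S ψ lo hi φ) (hθ : IsControl θ) {κ τ : ℝ}
    (hpath : ∀ t ∈ Icc 0 τ, path lam z₀ θ t = z₀ + lam * κ * t)
    (hd : ∀ t ∈ Ioo 0 τ, ∃ d, HasDerivAt φ d (z₀ + lam * κ * t) ∧
      d * (lam * κ) = r * φ (z₀ + lam * κ * t) - S (z₀ + lam * κ * t)) :
    ∀ t ∈ Icc 0 τ, total r S φ (path lam z₀ θ) t = φ z₀ := by
  intro t ht
  rw [total_eq_of_hasDerivAt h.continuous_flow h.continuous (hθ.continuous_path h.lam_pos) ht.1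
    fun v hv => ?_, total_zero, path_zero]
  obtain ⟨d, hd1, hd2⟩ := hd v ⟨hv.1, hv.2.trans_le ht.2⟩
  have h1 : HasDerivAt (fun t => z₀ + lam * κ * t) (lam * κ) v := by
    simpa using ((hasDerivAt_id v).const_mul (lam * κ)).const_add z₀
  have h2 : path lam z₀ θ =ᶠ[𝓝 v] fun t => z₀ + lam * κ * t :=
    Filter.mem_of_superset (Icc_mem_nhds hv.1 (hv.2.trans_le ht.2)) fun w hw => hpath w hw
  rw [h2.eq_of_nhds, ← hd2]
  exact (hd1.comp v h1).congr_of_eventuallyEq (h2.mono fun w hw => by simp [hw])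

theorem regret_le_of_straight (h : IsValue lam r S ψ lo hi φ) (hθ : IsControl θ) {κ τ : ℝ}
    (hτ : 0 ≤ τ) (hae : ∀ᵐ t, t ∈ before (ENNReal.ofReal τ) → θ t = κ)
    (hd : ∀ t ∈ Ioo 0 τ, ∃ d, HasDerivAt φ d (z₀ + lam * κ * t) ∧
      d * (lam * κ) = r * φ (z₀ + lam * κ * t) - S (z₀ + lam * κ * t))
    (hend : z₀ + lam * κ * τ ∉ Ioo lo hi) :
    regret r S ψ (path lam z₀ θ) (ENNReal.ofReal τ) ≤ ENNReal.ofReal (φ z₀) := by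
  have hpath : ∀ t ∈ Icc 0 τ, path lam z₀ θ t = z₀ + lam * κ * t := fun t ht =>
    before_ae_eq_path hθ hae ht.1 (ENNReal.ofReal_le_ofReal ht.2)
  have h1 := regret_le_of_total_eq (T := ENNReal.ofReal τ) (ψ := ψ) (r := r) h.continuous_flow
    h.flow_nonneg h.continuous h.nonneg h.le_terminal (hθ.continuous_path (z₀ := z₀) h.lam_pos)
    (fun t ht => by
      rw [path_zero]
      refine h.total_eq_of_straight hθ hpath hd t ⟨ht.1, ?_⟩
      exact (ENNReal.ofReal_le_ofReal_iff hτ).1 ht.2.le)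
    (fun _ => by
      rw [ENNReal.toReal_ofReal hτ, hpath τ ⟨hτ, le_rfl⟩]
      exact h.eq_terminal _ hend)
  rwa [path_zero] at h1

end IsValue

/-- The control `θ` follows own-biased learning with switch point `k` until the deadline `T`, which
is at an exit from `(lo, hi)`. -/
structure FollowsOwn (lam lo k hi z₀ : ℝ) (θ : ℝ → ℝ) (T : ℝ≥0∞) : Prop where
  isControl : IsControl θ
  mem : ∀ t ∈ before T, path lam z₀ θ t ∈ Ioo lo hi
  notMem : T ≠ ∞ → path lam z₀ θ T.toReal ∉ Ioo lo hi
  down : ∀ᵐ t, t ∈ before T → path lam z₀ θ t < k → θ t = -1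
  up : ∀ᵐ t, t ∈ before T → k < path lam z₀ θ t → θ t = 1
  leaves : z₀ = k → ∃ e > 0, (∀ t ∈ Ioo 0 e, path lam z₀ θ t < k) ∨
    ∀ t ∈ Ioo 0 e, k < path lam z₀ θ t

/-- The control moves at constant speed `κ` to the point `e` and stops there. -/
def MovesTo (lam z₀ κ e : ℝ) (θ : ℝ → ℝ) (T : ℝ≥0∞) : Prop :=
  T = ENNReal.ofReal ((e - z₀) / (lam * κ)) ∧ ∀ᵐ t, t ∈ before T → θ t = κ

/-- The almost everywhere conditions say nothing about a start at `k`; `leaves` tells on which side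
the path goes, and then it can never come back. -/
theorem FollowsOwn.movesTo {lam lo k hi z₀ : ℝ} {θ : ℝ → ℝ} {T : ℝ≥0∞} (hlam : 0 < lam)
    (hlo : lo < k) (hhi : k < hi) (hz : z₀ ∈ Ioo lo hi)
    (h : FollowsOwn lam lo k hi z₀ θ T) :
    ((z₀ < k ∨ z₀ = k ∧ ∃ e > 0, ∀ t ∈ Ioo 0 e, path lam z₀ θ t < k) ∧
      MovesTo lam z₀ (-1) lo θ T) ∨
    ((k < z₀ ∨ z₀ = k ∧ ∃ e > 0, ∀ t ∈ Ioo 0 e, k < path lam z₀ θ t) ∧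
      MovesTo lam z₀ 1 hi θ T) := by
  have hdown : (z₀ < k ∨ z₀ = k ∧ ∃ e > 0, ∀ t ∈ Ioo 0 e, path lam z₀ θ t < k) →
      MovesTo lam z₀ (-1) lo θ T := fun hs => by
    have := descent hlam h.isControl (fun t ht => (h.mem t ht).1) h.notMem hhi h.down hz.1 hs
    exact ⟨by rw [this.1]; congr 1; field_simp; ring, this.2⟩
  have hup : (k < z₀ ∨ z₀ = k ∧ ∃ e > 0, ∀ t ∈ Ioo 0 e, k < path lam z₀ θ t) →
      MovesTo lam z₀ 1 hi θ T := fun hs => by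
    have := ascent hlam h.isControl (fun t ht => (h.mem t ht).2) h.notMem hlo h.up hz.2 hs
    exact ⟨by rw [this.1]; congr 1; field_simp, this.2⟩
  rcases lt_trichotomy z₀ k with h1 | h1 | h1
  · exact Or.inl ⟨Or.inl h1, hdown (Or.inl h1)⟩
  · obtain ⟨e, he, h2 | h2⟩ := h.leaves h1
    · exact Or.inl ⟨Or.inr ⟨h1, e, he, h2⟩, hdown (Or.inr ⟨h1, e, he, h2⟩)⟩
    · exact Or.inr ⟨Or.inr ⟨h1, e, he, h2⟩, hup (Or.inr ⟨h1, e, he, h2⟩)⟩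
  · exact Or.inr ⟨Or.inl h1, hup (Or.inl h1)⟩

theorem MovesTo.unique {lam z₀ κ e : ℝ} {θ θ' : ℝ → ℝ} {T T' : ℝ≥0∞}
    (h : MovesTo lam z₀ κ e θ T) (h' : MovesTo lam z₀ κ e θ' T') :
    T = T' ∧ ∀ᵐ t, t ∈ before T → θ t = θ' t := by
  have hT : T = T' := h.1.trans h'.1.symm
  subst hT
  refine ⟨rfl, ?_⟩
  filter_upwards [h.2, h'.2] with t h1 h2 ht
  rw [h1 ht, h2 ht]

namespace IsOwnValue

variable {lam r lo k hi q z₀ : ℝ} {S ψ φ θ : ℝ → ℝ} {T : ℝ≥0∞}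

theorem regret_le (h : IsOwnValue lam r S ψ lo k hi q φ)
    (hf : FollowsOwn lam lo k hi z₀ θ T) :
    regret r S ψ (path lam z₀ θ) T ≤ ENNReal.ofReal (φ z₀) := by
  have hlam := h.lam_pos
  by_cases hz : z₀ ∈ Ioo lo hi
  · rcases hf.movesTo hlam h.lo_lt h.lt_hi hz with ⟨hs, hT, hae⟩ | ⟨hs, hT, hae⟩
    · have hzk : z₀ ≤ k := by
        rcases hs with h | h
        · exact h.le
        · exact h.1.le
      subst hT
      refine h.regret_le_of_straight hf.isControl
        (div_nonneg_of_nonpos (by linarith [hz.1]) (by linarith)) hae (fun t ht => ?_) ?_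
      · have h1 := ht.2
        have h0 := mul_pos hlam ht.1
        rw [lt_div_iff_of_neg (by linarith)] at h1
        refine ⟨_, h.rising _ ⟨by linarith, by linarith⟩, ?_⟩
        field_simp
        ring
      · intro hmem
        have := hmem.1
        field_simp at this
        linarith
    · have hzk : k ≤ z₀ := by
        rcases hs with h | h
        · exact h.le
        · exact h.1.ge
      subst hT
      refine h.regret_le_of_straight hf.isControl
        (div_nonneg (by linarith [hz.2]) (by linarith)) hae (fun t ht => ?_) ?_
      · have h1 := ht.2
        have h0 := mul_pos hlam ht.1
        rw [lt_div_iff₀ (by linarith)] at h1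
        refine ⟨_, h.falling _ ⟨by linarith, by linarith⟩, ?_⟩
        field_simp
        ring
      · intro hmem
        have := hmem.2
        field_simp at this
        linarith
  · have := IsValue.deadline_eq_zero hf.mem hz
    subst this
    exact h.regret_zero_le hf.isControl hz

/-- The strict inequality is assumed pointwise in time because in the knife-edge case it can fail at
`q`, where the slope vanishes and the control is not determined. -/
theorem ae_off (h : IsOwnValue lam r S ψ lo k hi q φ) (hθ : IsControl θ)
    (hle : regret r S ψ (path lam z₀ θ) T ≤ ENNReal.ofReal (φ z₀)) :
    ∀ᵐ t, t ∈ before T → r * φ (path lam z₀ θ t) < S (path lam z₀ θ t) →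
      (path lam z₀ θ t < k → θ t = -1) ∧ (k < path lam z₀ θ t → θ t = 1) := by
  have hlam := h.lam_pos
  filter_upwards [ae_eq_neg_one h.continuous_flow h.lam_pos hθ (h.total_eq hθ hle),
    ae_eq_one h.continuous_flow h.lam_pos hθ (h.total_eq hθ hle)] with t h1 h2 ht hlt
  have hm := h.path_mem hθ hle ht
  refine ⟨fun hk => h1 ht _ (h.rising _ ⟨hm.1.le, hk⟩) (div_pos (by linarith) hlam) ?_,
    fun hk => h2 ht _ (h.falling _ ⟨hk, hm.2.le⟩)
      (neg_neg_of_pos (div_pos (by linarith) hlam)) ?_⟩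
  · field_simp; ring
  · field_simp; ring

theorem followsOwn (h : IsOwnValue lam r S ψ lo k hi q φ)
    (hlt : ∀ z ∈ Icc lo hi, r * φ z < S z) (hθ : IsControl θ) (hz : z₀ ∈ Ioo lo hi)
    (hle : regret r S ψ (path lam z₀ θ) T ≤ ENNReal.ofReal (φ z₀)) :
    FollowsOwn lam lo k hi z₀ θ T where
  isControl := hθ
  mem _ ht := h.path_mem hθ hle ht
  notMem := h.end_notMem hθ hle
  down := (h.ae_off hθ hle).mono fun t h1 ht =>
    (h1 ht (hlt _ (Ioo_subset_Icc_self (h.path_mem hθ hle ht)))).1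
  up := (h.ae_off hθ hle).mono fun t h1 ht =>
    (h1 ht (hlt _ (Ioo_subset_Icc_self (h.path_mem hθ hle ht)))).2
  leaves hk := by
    have h0 : (0 : ℝ) ∈ before T := by
      refine ⟨le_rfl, ?_⟩
      rw [ENNReal.ofReal_zero, pos_iff_ne_zero]
      rintro rfl
      have := h.end_notMem hθ hle (by simp)
      rw [ENNReal.toReal_zero, path_zero] at this
      exact this hz
    obtain ⟨e, he, -, h1⟩ := leaves_of_total_eq h.continuous_flow h.lam_pos hθ
      (h.total_eq hθ hle) (hlt _ (Ioo_subset_Icc_self hz)) h0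
    rw [hk] at *
    exact ⟨e, he, h1⟩

/-- Since `rφ ≤ S` for a subsolution, `φ` increases up to `k` and decreases after it. -/
theorem isLocalMax (h : IsOwnValue lam r S ψ lo k hi q φ) : IsLocalMax φ k := by
  have hlam := h.lam_pos
  have hle : ∀ z, r * φ z ≤ S z := fun z => (h.sub z).mul_le hlam
  have hmono : MonotoneOn φ (Icc lo k) := by
    refine monotoneOn_of_deriv_nonneg (convex_Icc _ _) h.continuous.continuousOn ?_ ?_
    · intro z hz
      rw [interior_Icc] at hz
      exact (h.rising z ⟨hz.1.le, hz.2⟩).differentiableAt.differentiableWithinAt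
    · intro z hz
      rw [interior_Icc] at hz
      rw [(h.rising z ⟨hz.1.le, hz.2⟩).deriv]
      exact div_nonneg (by linarith [hle z]) hlam.le
  have hanti : AntitoneOn φ (Icc k hi) := by
    refine antitoneOn_of_deriv_nonpos (convex_Icc _ _) h.continuous.continuousOn ?_ ?_
    · intro z hz
      rw [interior_Icc] at hz
      exact (h.falling z ⟨hz.1, hz.2.le⟩).differentiableAt.differentiableWithinAt
    · intro z hz
      rw [interior_Icc] at hz
      rw [(h.falling z ⟨hz.1, hz.2.le⟩).deriv]
      exact neg_nonpos.2 (div_nonneg (by linarith [hle z]) hlam.le)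
  filter_upwards [Icc_mem_nhds h.lo_lt h.lt_hi] with z hz
  rcases le_total z k with hk | hk
  · exact hmono ⟨hz.1, hk⟩ ⟨h.lo_lt.le, le_rfl⟩ hk
  · exact hanti ⟨le_rfl, h.lt_hi.le⟩ ⟨hk, hz.2⟩ hk

end IsOwnValue

/-- The control `θ` follows own-biased learning below `kl` and above `kr` and opposite-biased
learning with reference point `q` in between, until the deadline `T`, which is at an exit from
`(lo, hi)`. -/
structure FollowsMixed (lam lo kl q kr hi z₀ : ℝ) (θ : ℝ → ℝ) (T : ℝ≥0∞) : Prop where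
  isControl : IsControl θ
  mem : ∀ t ∈ before T, path lam z₀ θ t ∈ Ioo lo hi
  notMem : T ≠ ∞ → path lam z₀ θ T.toReal ∉ Ioo lo hi
  down : ∀ᵐ t, t ∈ before T → path lam z₀ θ t < kl → θ t = -1
  up : ∀ᵐ t, t ∈ before T → kr < path lam z₀ θ t → θ t = 1
  right : ∀ᵐ t, t ∈ before T → kl < path lam z₀ θ t → path lam z₀ θ t < q → θ t = 1
  left : ∀ᵐ t, t ∈ before T → q < path lam z₀ θ t → path lam z₀ θ t < kr → θ t = -1
  leaves_left : z₀ = kl → ∃ e > 0, (∀ t ∈ Ioo 0 e, path lam z₀ θ t < kl) ∨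
    ∀ t ∈ Ioo 0 e, kl < path lam z₀ θ t
  leaves_right : z₀ = kr → ∃ e > 0, (∀ t ∈ Ioo 0 e, path lam z₀ θ t < kr) ∨
    ∀ t ∈ Ioo 0 e, kr < path lam z₀ θ t

/-- The control moves at constant speed `κ` to the point `q` and waits there for ever. -/
def WaitsAt (lam z₀ κ q : ℝ) (θ : ℝ → ℝ) (T : ℝ≥0∞) : Prop :=
  T = ∞ ∧ ∀ᵐ t, t ∈ before T → θ t = if t < (q - z₀) / (lam * κ) then κ else 0

theorem WaitsAt.unique {lam z₀ κ e : ℝ} {θ θ' : ℝ → ℝ} {T T' : ℝ≥0∞}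
    (h : WaitsAt lam z₀ κ e θ T) (h' : WaitsAt lam z₀ κ e θ' T') :
    T = T' ∧ ∀ᵐ t, t ∈ before T → θ t = θ' t := by
  have hT : T = T' := h.1.trans h'.1.symm
  subst hT
  refine ⟨rfl, ?_⟩
  filter_upwards [h.2, h'.2] with t h1 h2 ht
  rw [h1 ht, h2 ht]

/-- A start at `kl` or `kr` is compatible with two of the four alternatives; `leaves_left` and
`leaves_right` decide which one occurs. -/
theorem FollowsMixed.cases {lam lo kl q kr hi z₀ : ℝ} {θ : ℝ → ℝ} {T : ℝ≥0∞} (hlam : 0 < lam)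
    (hlo : lo < kl) (hkl : kl < q) (hkr : q < kr) (hhi : kr < hi) (hz : z₀ ∈ Ioo lo hi)
    (h : FollowsMixed lam lo kl q kr hi z₀ θ T) :
    ((z₀ < kl ∨ z₀ = kl ∧ ∃ e > 0, ∀ t ∈ Ioo 0 e, path lam z₀ θ t < kl) ∧
      MovesTo lam z₀ (-1) lo θ T) ∨
    ((kl < z₀ ∧ z₀ ≤ q ∨ z₀ = kl ∧ ∃ e > 0, ∀ t ∈ Ioo 0 e, kl < path lam z₀ θ t) ∧
      WaitsAt lam z₀ 1 q θ T) ∨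
    ((q < z₀ ∧ z₀ < kr ∨ z₀ = kr ∧ ∃ e > 0, ∀ t ∈ Ioo 0 e, path lam z₀ θ t < kr) ∧
      WaitsAt lam z₀ (-1) q θ T) ∨
    ((kr < z₀ ∨ z₀ = kr ∧ ∃ e > 0, ∀ t ∈ Ioo 0 e, kr < path lam z₀ θ t) ∧
      MovesTo lam z₀ 1 hi θ T) := by
  have hc := h.isControl
  have hdown : (z₀ < kl ∨ z₀ = kl ∧ ∃ e > 0, ∀ t ∈ Ioo 0 e, path lam z₀ θ t < kl) →
      MovesTo lam z₀ (-1) lo θ T := fun hs => by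
    have := descent hlam hc (fun t ht => (h.mem t ht).1) h.notMem (by linarith) h.down hz.1 hs
    exact ⟨by rw [this.1]; congr 1; field_simp; ring, this.2⟩
  have hup : (kr < z₀ ∨ z₀ = kr ∧ ∃ e > 0, ∀ t ∈ Ioo 0 e, kr < path lam z₀ θ t) →
      MovesTo lam z₀ 1 hi θ T := fun hs => by
    have := ascent hlam hc (fun t ht => (h.mem t ht).2) h.notMem (by linarith) h.up hz.2 hs
    exact ⟨by rw [this.1]; congr 1; field_simp, this.2⟩
  have hright : (kl < z₀ ∧ z₀ ≤ q ∨ z₀ = kl ∧ ∃ e > 0, ∀ t ∈ Ioo 0 e, kl < path lam z₀ θ t) →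
      WaitsAt lam z₀ 1 q θ T := fun hs => by
    have := approach_left hlam hc h.notMem hlo hkr (hkr.trans hhi) h.right h.left
      (by
        rcases hs with h | h
        · exact h.2
        · exact h.1.le.trans hkl.le)
      (hs.imp_left And.left)
    exact ⟨this.1, by rw [mul_one]; exact this.2⟩
  have hleft : (q < z₀ ∧ z₀ < kr ∨ z₀ = kr ∧ ∃ e > 0, ∀ t ∈ Ioo 0 e, path lam z₀ θ t < kr) →
      WaitsAt lam z₀ (-1) q θ T := fun hs => by
    have := approach_right hlam hc h.notMem hhi hkl (hlo.trans hkl) h.right h.left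
      (by
        rcases hs with h | h
        · exact h.1.le
        · exact hkr.le.trans h.1.ge)
      (hs.imp_left And.right)
    refine ⟨this.1, ?_⟩
    rw [show (q - z₀) / (lam * -1) = (z₀ - q) / lam by field_simp; ring]
    exact this.2
  rcases lt_trichotomy z₀ kl with h1 | h1 | h1
  · exact Or.inl ⟨Or.inl h1, hdown (Or.inl h1)⟩
  · obtain ⟨e, he, h2 | h2⟩ := h.leaves_left h1
    · exact Or.inl ⟨Or.inr ⟨h1, e, he, h2⟩, hdown (Or.inr ⟨h1, e, he, h2⟩)⟩
    · exact Or.inr (Or.inl ⟨Or.inr ⟨h1, e, he, h2⟩, hright (Or.inr ⟨h1, e, he, h2⟩)⟩)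
  rcases le_or_gt z₀ q with h2 | h2
  · exact Or.inr (Or.inl ⟨Or.inl ⟨h1, h2⟩, hright (Or.inl ⟨h1, h2⟩)⟩)
  rcases lt_trichotomy z₀ kr with h3 | h3 | h3
  · exact Or.inr (Or.inr (Or.inl ⟨Or.inl ⟨h2, h3⟩, hleft (Or.inl ⟨h2, h3⟩)⟩))
  · obtain ⟨e, he, h4 | h4⟩ := h.leaves_right h3
    · exact Or.inr (Or.inr (Or.inl ⟨Or.inr ⟨h3, e, he, h4⟩, hleft (Or.inr ⟨h3, e, he, h4⟩)⟩))
    · exact Or.inr (Or.inr (Or.inr ⟨Or.inr ⟨h3, e, he, h4⟩, hup (Or.inr ⟨h3, e, he, h4⟩)⟩))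
  · exact Or.inr (Or.inr (Or.inr ⟨Or.inl h3, hup (Or.inl h3)⟩))

/-- On the way to `q` the path follows the dynamic programming equation; from then on `rφ = S` at
`q` means that the constant continuation value has the right rate, namely zero. -/
theorem IsValue.regret_le_of_waitsAt {lam r lo hi z₀ q κ : ℝ} {S ψ φ θ : ℝ → ℝ} {T : ℝ≥0∞}
    (h : IsValue lam r S ψ lo hi φ) (hθ : IsControl θ) (hw : WaitsAt lam z₀ κ q θ T)
    (hκ : κ ≠ 0) (hτ : 0 ≤ (q - z₀) / (lam * κ)) (hq : r * φ q = S q)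
    (hd : ∀ t ∈ Ioo 0 ((q - z₀) / (lam * κ)), ∃ d, HasDerivAt φ d (z₀ + lam * κ * t) ∧
      d * (lam * κ) = r * φ (z₀ + lam * κ * t) - S (z₀ + lam * κ * t)) :
    regret r S ψ (path lam z₀ θ) T ≤ ENNReal.ofReal (φ z₀) := by
  obtain ⟨rfl, hae⟩ := hw
  have hlam := h.lam_pos
  set τ := (q - z₀) / (lam * κ) with hτdef
  have hae1 : ∀ᵐ t, t ∈ before (ENNReal.ofReal τ) → θ t = κ := by
    filter_upwards [hae] with t ht htm
    rw [ht ⟨htm.1, htm.2.trans_le le_top⟩, if_pos]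
    exact (ENNReal.ofReal_lt_ofReal_iff'.1 htm.2).1
  have hpath : ∀ t ∈ Icc 0 τ, path lam z₀ θ t = z₀ + lam * κ * t := fun t ht =>
    before_ae_eq_path hθ hae1 ht.1 (ENNReal.ofReal_le_ofReal ht.2)
  have hpτ : path lam z₀ θ τ = q := by
    rw [hpath τ ⟨hτ, le_rfl⟩, hτdef]
    field_simp
    ring
  have hstay : ∀ t, τ ≤ t → path lam z₀ θ t = q := by
    intro t ht
    rw [path_eq_of_ae (k := 0) hθ ht, hpτ]
    · ring
    · filter_upwards [hae] with v hv hvm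
      rw [hv (by rw [before_top]; exact hτ.trans hvm.1.le), if_neg (not_lt.2 hvm.1.le)]
  have h1 := regret_le_of_total_eq (T := ∞) (ψ := ψ) (r := r) h.continuous_flow
    h.flow_nonneg h.continuous h.nonneg h.le_terminal (hθ.continuous_path (z₀ := z₀) h.lam_pos)
    (fun t ht => by
      rw [path_zero]
      rcases le_total t τ with h2 | h2
      · exact h.total_eq_of_straight hθ hpath hd t ⟨ht.1, h2⟩
      · rw [total_eq_of_hasDerivAt h.continuous_flow h.continuous (hθ.continuous_path h.lam_pos) h2]
        · exact h.total_eq_of_straight hθ hpath hd τ ⟨hτ, le_rfl⟩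
        · intro v hv
          rw [hstay v hv.1.le, hq, sub_self]
          exact (hasDerivAt_const v (φ q)).congr_of_eventuallyEq
            ((lt_mem_nhds hv.1).mono fun w hw => by simp only [hstay w (le_of_lt hw)]))
    (fun hne => absurd rfl hne)
  rwa [path_zero] at h1

namespace IsMixedValue

variable {lam r lo kl q kr hi z₀ : ℝ} {S ψ φ θ : ℝ → ℝ} {T : ℝ≥0∞}

theorem regret_le (h : IsMixedValue lam r S ψ lo kl q kr hi φ)
    (hf : FollowsMixed lam lo kl q kr hi z₀ θ T) :
    regret r S ψ (path lam z₀ θ) T ≤ ENNReal.ofReal (φ z₀) := by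
  have hlam := h.lam_pos
  by_cases hz : z₀ ∈ Ioo lo hi
  · rcases hf.cases hlam h.lo_lt h.kl_lt h.lt_kr h.lt_hi hz with
      ⟨hs, hT, hae⟩ | ⟨hs, hw⟩ | ⟨hs, hw⟩ | ⟨hs, hT, hae⟩
    · have hzk : z₀ ≤ kl := by
        rcases hs with h | h
        · exact h.le
        · exact h.1.le
      subst hT
      refine h.regret_le_of_straight hf.isControl
        (div_nonneg_of_nonpos (by linarith [hz.1]) (by linarith)) hae (fun t ht => ?_) ?_
      · have h1 := ht.2
        have h0 := mul_pos hlam ht.1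
        rw [lt_div_iff_of_neg (by linarith)] at h1
        refine ⟨_, h.rising _ ⟨by linarith, by linarith⟩, ?_⟩
        field_simp
        ring
      · intro hmem
        have := hmem.1
        field_simp at this
        linarith
    · have hzk : kl ≤ z₀ ∧ z₀ ≤ q := by
        rcases hs with h' | h'
        · exact ⟨h'.1.le, h'.2⟩
        · exact ⟨h'.1.ge, h'.1.le.trans h.kl_lt.le⟩
      refine h.regret_le_of_waitsAt hf.isControl hw one_ne_zero
        (div_nonneg (by linarith) (by linarith)) h.eq_flow fun t ht => ?_
      have h1 := ht.2
      have h0 := mul_pos hlam ht.1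
      rw [lt_div_iff₀ (by linarith)] at h1
      refine ⟨_, h.falling_left _ ⟨by linarith, by linarith⟩, ?_⟩
      field_simp
      ring
    · have hzk : q ≤ z₀ ∧ z₀ ≤ kr := by
        rcases hs with h' | h'
        · exact ⟨h'.1.le, h'.2.le⟩
        · exact ⟨h.lt_kr.le.trans h'.1.ge, h'.1.le⟩
      refine h.regret_le_of_waitsAt hf.isControl hw (by norm_num)
        (div_nonneg_of_nonpos (by linarith) (by linarith)) h.eq_flow fun t ht => ?_
      have h1 := ht.2
      have h0 := mul_pos hlam ht.1
      rw [lt_div_iff_of_neg (by linarith)] at h1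
      refine ⟨_, h.rising_right _ ⟨by linarith, by linarith⟩, ?_⟩
      field_simp
      ring
    · have hzk : kr ≤ z₀ := by
        rcases hs with h | h
        · exact h.le
        · exact h.1.ge
      subst hT
      refine h.regret_le_of_straight hf.isControl
        (div_nonneg (by linarith [hz.2]) (by linarith)) hae (fun t ht => ?_) ?_
      · have h1 := ht.2
        have h0 := mul_pos hlam ht.1
        rw [lt_div_iff₀ (by linarith)] at h1
        refine ⟨_, h.falling _ ⟨by linarith, by linarith⟩, ?_⟩
        field_simp
        ring
      · intro hmem
        have := hmem.2
        field_simp at this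
        linarith
  · have := IsValue.deadline_eq_zero hf.mem hz
    subst this
    exact h.regret_zero_le hf.isControl hz

theorem followsMixed (h : IsMixedValue lam r S ψ lo kl q kr hi φ) (hθ : IsControl θ)
    (hz : z₀ ∈ Ioo lo hi)
    (hle : regret r S ψ (path lam z₀ θ) T ≤ ENNReal.ofReal (φ z₀)) :
    FollowsMixed lam lo kl q kr hi z₀ θ T := by
  have hlam := h.lam_pos
  have hm : ∀ t ∈ before T, path lam z₀ θ t ∈ Ioo lo hi := fun t ht => h.path_mem hθ hle ht
  have hlt : ∀ t ∈ before T, path lam z₀ θ t ≠ q →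
      0 < (S (path lam z₀ θ t) - r * φ (path lam z₀ θ t)) / lam := fun t ht hne =>
    div_pos (sub_pos.2 (h.lt_flow _ (Ioo_subset_Icc_self (hm t ht)) hne)) hlam
  have hdown := ae_eq_neg_one h.continuous_flow h.lam_pos hθ (h.total_eq hθ hle)
  have hup := ae_eq_one h.continuous_flow h.lam_pos hθ (h.total_eq hθ hle)
  have h1 := h.kl_lt
  have h2 := h.lt_kr
  have h0 : (0 : ℝ) ∈ before T := by
    refine ⟨le_rfl, ?_⟩
    rw [ENNReal.ofReal_zero, pos_iff_ne_zero]
    rintro rfl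
    have := h.end_notMem hθ hle (by simp)
    rw [ENNReal.toReal_zero, path_zero] at this
    exact this hz
  have hleave : z₀ ≠ q → ∃ e > 0, (∀ t ∈ Ioo 0 e, path lam z₀ θ t < z₀) ∨
      ∀ t ∈ Ioo 0 e, z₀ < path lam z₀ θ t := fun hne => by
    obtain ⟨e, he, -, h1⟩ := leaves_of_total_eq h.continuous_flow h.lam_pos hθ
      (h.total_eq hθ hle) (h.lt_flow _ (Ioo_subset_Icc_self hz) hne) h0
    exact ⟨e, he, h1⟩
  refine ⟨hθ, hm, h.end_notMem hθ hle, ?_, ?_, ?_, ?_, ?_, ?_⟩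
  · filter_upwards [hdown] with t ht htT hk
    refine ht htT _ (h.rising _ ⟨(hm t htT).1.le, hk⟩) (hlt t htT (hk.trans h1).ne) ?_
    field_simp; ring
  · filter_upwards [hup] with t ht htT hk
    refine ht htT _ (h.falling _ ⟨hk, (hm t htT).2.le⟩)
      (neg_neg_of_pos (hlt t htT (h2.trans hk).ne')) ?_
    field_simp; ring
  · filter_upwards [hup] with t ht htT hk hk'
    refine ht htT _ (h.falling_left _ ⟨hk, hk'⟩) (neg_neg_of_pos (hlt t htT hk'.ne)) ?_
    field_simp; ring
  · filter_upwards [hdown] with t ht htT hk hk'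
    refine ht htT _ (h.rising_right _ ⟨hk, hk'⟩) (hlt t htT hk.ne') ?_
    field_simp; ring
  · intro hk
    have := hleave (by rw [hk]; exact h1.ne)
    rwa [hk] at this ⊢
  · intro hk
    have := hleave (by rw [hk]; exact h2.ne')
    rwa [hk] at this ⊢

end IsMixedValue

/-! ### The belief equation in log-likelihood ratios. -/

/-- Two continuous solutions of the belief equation with the same attention coincide. -/
theorem belief_eq_unique {θ : ℝ → ℝ} (hθ : IsControl θ) {lam p₀ : ℝ} {f g : ℝ → ℝ}
    (hf : Continuous f) (hg : Continuous g)
    (hf' : ∀ t, 0 ≤ t → f t = p₀ + ∫ s in (0 : ℝ)..t, θ s * (lam * (f s * (1 - f s))))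
    (hg' : ∀ t, 0 ≤ t → g t = p₀ + ∫ s in (0 : ℝ)..t, θ s * (lam * (g s * (1 - g s))))
    {t : ℝ} (ht : 0 ≤ t) : f t = g t := by
  obtain ⟨M, hM⟩ := (isCompact_Icc (a := 0) (b := t)).exists_bound_of_continuousOn
    (f := fun s => lam * (1 - f s - g s)) (by fun_prop)
  have hint : ∀ (k : ℝ → ℝ), Continuous k → ∀ s, IntervalIntegrable (fun v => θ v * k v) volume 0 s :=
    fun k hk s => (hθ.intervalIntegrable 0 s).mul_continuousOn hk.continuousOn
  have hc : Continuous fun s => |f s - g s| := by fun_prop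
  -- The difference of the two vector fields has the factor `1 − f − g`, bounded on `[0, t]` by
  -- continuity; this gives an integral inequality of Grönwall type for `|f − g|`.
  have hG : ∀ s ∈ Icc 0 t, |f s - g s| ≤ M * ∫ v in (0 : ℝ)..s, |f v - g v| := by
    intro s hs
    rw [hf' s hs.1, hg' s hs.1, add_sub_add_left_eq_sub, ← intervalIntegral.integral_sub
      (hint _ (by fun_prop) s) (hint _ (by fun_prop) s), ← intervalIntegral.integral_const_mul]
    rw [← Real.norm_eq_abs]
    refine intervalIntegral.norm_integral_le_of_norm_le hs.1 ?_
      ((hc.const_mul M).intervalIntegrable _ _)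
    refine Eventually.of_forall fun v hv => ?_
    have h1 : θ v * (lam * (f v * (1 - f v))) - θ v * (lam * (g v * (1 - g v))) =
        θ v * ((lam * (1 - f v - g v)) * (f v - g v)) := by ring
    have h2 : |lam * (1 - f v - g v)| ≤ M := hM v ⟨hv.1.le, hv.2.trans hs.2⟩
    rw [h1, Real.norm_eq_abs, abs_mul, abs_mul]
    calc |θ v| * (|lam * (1 - f v - g v)| * |f v - g v|)
        ≤ 1 * (|lam * (1 - f v - g v)| * |f v - g v|) := by
          gcongr; exact hθ.abs_le_one v
      _ ≤ M * |f v - g v| := by rw [one_mul]; gcongr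
  have hM0 : 0 ≤ M := (norm_nonneg _).trans (hM 0 ⟨le_rfl, ht⟩)
  have hGd : ∀ s, HasDerivAt (fun s => ∫ v in (0 : ℝ)..s, |f v - g v|) |f s - g s| s := fun s =>
    (hc.integral_hasStrictDerivAt 0 s).hasDerivAt
  have hzero := eq_zero_of_abs_deriv_le_mul_abs_self_of_eq_zero_right (K := M) (a := 0) (b := t)
    (f := fun s => ∫ v in (0 : ℝ)..s, |f v - g v|)
    (fun s _ => (hGd s).continuousAt.continuousWithinAt)
    (fun s _ => (hGd s).hasDerivWithinAt) (by simp)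
    (fun s hs => by
      have h0 : 0 ≤ ∫ v in (0 : ℝ)..s, |f v - g v| :=
        intervalIntegral.integral_nonneg hs.1 fun _ _ => abs_nonneg _
      rw [Real.norm_eq_abs, Real.norm_eq_abs, abs_abs, abs_of_nonneg h0]
      exact hG s ⟨hs.1, hs.2.le⟩)
  have h1 := hG t ⟨ht, le_rfl⟩
  rw [hzero t ⟨ht, le_rfl⟩, mul_zero] at h1
  exact sub_eq_zero.1 (abs_nonpos_iff.1 h1)

/-- The log-likelihood ratio of a belief. -/
def logit (p : ℝ) : ℝ := Real.log (p / (1 - p))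

theorem exp_logit {p : ℝ} (hp : p ∈ Ioo (0 : ℝ) 1) : Real.exp (logit p) = p / (1 - p) :=
  Real.exp_log (div_pos hp.1 (sub_pos.2 hp.2))

theorem sigmoid_logit {p : ℝ} (hp : p ∈ Ioo (0 : ℝ) 1) : Real.sigmoid (logit p) = p := by
  have h1 : 1 - p ≠ 0 := (sub_pos.2 hp.2).ne'
  have h2 : p ≠ 0 := hp.1.ne'
  rw [Real.sigmoid_def, Real.exp_neg, exp_logit hp]
  field_simp
  ring

/-- The control that corresponds to an attention function. -/
def control (α : ℝ → ℝ) (t : ℝ) : ℝ := 1 - 2 * α t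

theorem isControl_control {α : ℝ → ℝ} (hm : Measurable α) (hα : ∀ t, α t ∈ Icc (0 : ℝ) 1) :
    IsControl (control α) :=
  ⟨measurable_const.sub (hm.const_mul 2), fun t => by
    have := hα t
    unfold control
    rw [abs_le]; constructor <;> linarith [this.1, this.2]⟩

/-- The logistic function has derivative σ(1 − σ), so it turns a path with velocity `lam * θ` into a
solution of the belief equation. -/
theorem sigmoid_path_eq {lam z₀ : ℝ} {θ : ℝ → ℝ} (hθ : IsControl θ) (hlam : 0 < lam) (t : ℝ) :
    Real.sigmoid (path lam z₀ θ t) = Real.sigmoid z₀ + ∫ s in (0 : ℝ)..t, θ s *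
      (lam * (Real.sigmoid (path lam z₀ θ s) * (1 - Real.sigmoid (path lam z₀ θ s)))) := by
  have h := hθ.integral_deriv_comp_path (z₀ := z₀) hlam (F := Real.sigmoid)
    (F' := fun z => Real.sigmoid z * (1 - Real.sigmoid z)) Real.hasDerivAt_sigmoid
    (by have := continuous_sigmoid; fun_prop) 0 t
  rw [path_zero] at h
  rw [← sub_eq_iff_eq_add', ← h]
  exact intervalIntegral.integral_congr fun s _ => by ring

namespace Strategy

variable {lam p₀ : ℝ}

theorem isControl (σ : Strategy lam p₀) : IsControl (control σ.att) :=
  isControl_control σ.measurable_att σ.att_mem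

theorem learningTimes_eq (σ : Strategy lam p₀) : σ.learningTimes = before σ.deadline := rfl

/-- The path of the log-likelihood ratio. -/
def trajectory (σ : Strategy lam p₀) : ℝ → ℝ := path lam (logit p₀) (control σ.att)

/-- A continuous solution of the belief equation is the belief path of the strategy. -/
theorem belief_eq_of_solution (σ : Strategy lam p₀) {g : ℝ → ℝ} (hg : Continuous g)
    (hg' : ∀ t, 0 ≤ t → g t = p₀ + ∫ s in (0 : ℝ)..t,
      control σ.att s * (lam * (g s * (1 - g s)))) {t : ℝ} (ht : 0 ≤ t) : σ.belief t = g t := by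
  -- The belief is constrained only for nonnegative times; it is frozen at its initial value before
  -- 0 to obtain a continuous function on the line.
  have hf : Continuous fun t => σ.belief (max t 0) :=
    σ.continuousOn_belief.comp_continuous (by fun_prop) fun t => le_max_right t 0
  have := belief_eq_unique σ.isControl (lam := lam) (p₀ := p₀) hf hg (fun t ht => ?_) hg' ht
  · simpa [max_eq_left ht] using this
  · simp only [max_eq_left ht]
    rw [σ.belief_eq t ht]
    congr 1
    refine intervalIntegral.integral_congr fun s hs => ?_
    rw [uIcc_of_le ht] at hs
    simp only [control, max_eq_left hs.1]
    ring

theorem belief_eq_sigmoid (σ : Strategy lam p₀) (hlam : 0 < lam) (hp : p₀ ∈ Ioo (0 : ℝ) 1) {t : ℝ}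
    (ht : 0 ≤ t) : σ.belief t = Real.sigmoid (σ.trajectory t) := by
  refine σ.belief_eq_of_solution
    (continuous_sigmoid.comp (σ.isControl.continuous_path hlam)) (fun t _ => ?_) ht
  have := sigmoid_path_eq σ.isControl hlam (z₀ := logit p₀) t
  rwa [sigmoid_logit hp] at this

/-- The probability that the state is `R` and there is no breakthrough by time `t`. -/
def massR (σ : Strategy lam p₀) (t : ℝ) : ℝ :=
  p₀ * Real.exp (-(lam * ∫ s in (0 : ℝ)..t, σ.att s))

/-- The probability that the state is `L` and there is no breakthrough by time `t`. -/
def massL (σ : Strategy lam p₀) (t : ℝ) : ℝ :=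
  (1 - p₀) * Real.exp (-(lam * ∫ s in (0 : ℝ)..t, (1 - σ.att s)))

theorem survival_eq (σ : Strategy lam p₀) (t : ℝ) : σ.survival t = σ.massR t + σ.massL t := rfl

theorem integral_att_eq (σ : Strategy lam p₀) (t : ℝ) :
    ∫ s in (0 : ℝ)..t, σ.att s = (t - ∫ s in (0 : ℝ)..t, control σ.att s) / 2 := by
  have h : ∀ s, σ.att s = (1 - control σ.att s) / 2 := fun s => by unfold control; ring
  simp_rw [h]
  rw [intervalIntegral.integral_div, intervalIntegral.integral_sub
    (_root_.intervalIntegrable_const) (σ.isControl.intervalIntegrable 0 t)]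
  simp

theorem integral_one_sub_att_eq (σ : Strategy lam p₀) (t : ℝ) :
    ∫ s in (0 : ℝ)..t, (1 - σ.att s) = (t + ∫ s in (0 : ℝ)..t, control σ.att s) / 2 := by
  have h : ∀ s, 1 - σ.att s = (1 + control σ.att s) / 2 := fun s => by unfold control; ring
  simp_rw [h]
  rw [intervalIntegral.integral_div, intervalIntegral.integral_add
    (_root_.intervalIntegrable_const) (σ.isControl.intervalIntegrable 0 t)]
  simp

/-- The scale factor of the normalized problem. -/
def scale (p : ℝ) : ℝ := p * Real.exp (-logit p / 2)

theorem scale_pos {p : ℝ} (hp : p ∈ Ioo (0 : ℝ) 1) : 0 < scale p :=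
  mul_pos hp.1 (Real.exp_pos _)

/-- The integral of the attention is half of `t` minus the integral of the control. The first part
becomes the extra discount rate `lam / 2`, the second the exponential of half the trajectory. -/
theorem massR_eq (σ : Strategy lam p₀) (t : ℝ) :
    σ.massR t = scale p₀ * (Real.exp (-(lam / 2 * t)) * Real.exp (σ.trajectory t / 2)) := by
  rw [massR, integral_att_eq, scale, mul_assoc, ← Real.exp_add, ← Real.exp_add, trajectory, path]
  congr 2
  ring

theorem massL_eq (σ : Strategy lam p₀) (hp : p₀ ∈ Ioo (0 : ℝ) 1) (t : ℝ) :
    σ.massL t = scale p₀ * (Real.exp (-(lam / 2 * t)) * Real.exp (-σ.trajectory t / 2)) := by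
  -- The same scale factor serves both states, because p₀ e^{−z/2} = (1 − p₀) e^{z/2} at the
  -- log-likelihood ratio z of p₀.
  have h0 : scale p₀ = (1 - p₀) * Real.exp (logit p₀ / 2) := by
    have h1 := exp_logit hp
    have h2 : 1 - p₀ ≠ 0 := (sub_pos.2 hp.2).ne'
    rw [scale, exp_half_eq_mul (logit p₀), h1]
    field_simp
  rw [massL, integral_one_sub_att_eq, h0, mul_assoc, ← Real.exp_add, ← Real.exp_add, trajectory,
    path]
  congr 2
  ring

/-- Bayes' rule. The priors 0 and 1 are treated apart, since they have no log-likelihood ratio; the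
belief is constant there. -/
theorem belief_mul_survival (σ : Strategy lam p₀) (hlam : 0 < lam) (hp : p₀ ∈ Icc (0 : ℝ) 1) {t : ℝ}
    (ht : 0 ≤ t) : σ.belief t * σ.survival t = σ.massR t := by
  rcases hp.1.eq_or_lt with h0 | h0
  · have h1 := σ.belief_eq_of_solution (g := fun _ => 0) continuous_const
      (fun t _ => by simp [← h0]) ht
    simp [h1, massR, ← h0]
  rcases hp.2.eq_or_lt with h1 | h1
  · have h2 := σ.belief_eq_of_solution (g := fun _ => 1) continuous_const
      (fun t _ => by simp [h1]) ht
    simp [h2, survival_eq, massL, h1]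
  · have hp' : p₀ ∈ Ioo (0 : ℝ) 1 := ⟨h0, h1⟩
    rw [σ.belief_eq_sigmoid hlam hp' ht, survival_eq, massR_eq, σ.massL_eq hp', Real.sigmoid_def,
      Real.exp_neg, exp_half_eq_mul (σ.trajectory t)]
    have := Real.exp_pos (σ.trajectory t)
    field_simp

end Strategy

/-! ### The payoff as a constant minus an expected loss. -/

section Decay

variable {f : ℝ → ℝ} {lam rho : ℝ}

theorem isControl_of_mem (hf : Measurable f) (hf' : ∀ t, f t ∈ Icc (0 : ℝ) 1) : IsControl f :=
  ⟨hf, fun t => by rw [abs_of_nonneg (hf' t).1]; exact (hf' t).2⟩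

/-- The exponent −ρt − λ∫f is itself a path, of maximal speed `rho + lam`; thus
`integral_deriv_comp_path` integrates the discounted hazard rate exactly, in `integral_decay`. -/
theorem isControl_decay (hf : Measurable f) (hf' : ∀ t, f t ∈ Icc (0 : ℝ) 1) (hlam : 0 < lam)
    (hrho : 0 ≤ rho) : IsControl fun t => -((rho + lam * f t) / (rho + lam)) :=
  ⟨((hf.const_mul lam).const_add rho |>.div_const _).neg, fun t => by
    have := hf' t
    rw [abs_neg, abs_of_nonneg (div_nonneg (by nlinarith [this.1]) (by linarith)),
      div_le_one (by linarith)]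
    nlinarith [this.2]⟩

theorem path_decay (hf : Measurable f) (hf' : ∀ t, f t ∈ Icc (0 : ℝ) 1) (hlam : 0 < lam)
    (hrho : 0 ≤ rho) (t : ℝ) :
    path (rho + lam) 0 (fun t => -((rho + lam * f t) / (rho + lam))) t =
      -(rho * t) + -(lam * ∫ s in (0 : ℝ)..t, f s) := by
  have hi : IntervalIntegrable f volume 0 t := (isControl_of_mem hf hf').intervalIntegrable 0 t
  have h0 : rho + lam ≠ 0 := by linarith
  rw [path, intervalIntegral.integral_neg, intervalIntegral.integral_div,
    intervalIntegral.integral_add _root_.intervalIntegrable_const (hi.const_mul lam),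
    intervalIntegral.integral_const_mul, intervalIntegral.integral_const]
  field_simp
  simp only [smul_eq_mul]
  ring

theorem intervalIntegrable_decay (hf : Measurable f) (hf' : ∀ t, f t ∈ Icc (0 : ℝ) 1)
    {k : ℝ → ℝ} (hk : Continuous k) (s t : ℝ) :
    IntervalIntegrable (fun v => k v * (rho + lam * f v)) volume s t := by
  have hi : IntervalIntegrable f volume s t := (isControl_of_mem hf hf').intervalIntegrable s t
  exact ((_root_.intervalIntegrable_const).add (hi.const_mul lam)).continuousOn_mul hk.continuousOn

theorem integral_decay (hf : Measurable f) (hf' : ∀ t, f t ∈ Icc (0 : ℝ) 1) (hlam : 0 < lam)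
    (hrho : 0 ≤ rho) (t : ℝ) :
    ∫ v in (0 : ℝ)..t, Real.exp (-(rho * v)) * Real.exp (-(lam * ∫ s in (0 : ℝ)..v, f s)) *
      (rho + lam * f v) =
      1 - Real.exp (-(rho * t)) * Real.exp (-(lam * ∫ s in (0 : ℝ)..t, f s)) := by
  have h := (isControl_decay hf hf' hlam hrho).integral_deriv_comp_path (z₀ := 0)
    (lam := rho + lam) (by linarith) Real.hasDerivAt_exp Real.continuous_exp 0 t
  simp only [path_decay hf hf' hlam hrho, Real.exp_add] at h
  have h0 : rho + lam ≠ 0 := by linarith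
  have h1 : ∀ v, Real.exp (-(rho * v)) * Real.exp (-(lam * ∫ s in (0 : ℝ)..v, f s)) *
      (rho + lam * f v) = -(Real.exp (-(rho * v)) * Real.exp (-(lam * ∫ s in (0 : ℝ)..v, f s)) *
      ((rho + lam) * -((rho + lam * f v) / (rho + lam)))) := fun v => by field_simp
  simp_rw [h1]
  rw [intervalIntegral.integral_neg, h]
  simp

theorem continuous_decay (hf : Measurable f) (hf' : ∀ t, f t ∈ Icc (0 : ℝ) 1) :
    Continuous fun t => Real.exp (-(lam * ∫ s in (0 : ℝ)..t, f s)) := by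
  have hi : ∀ a b, IntervalIntegrable f volume a b := fun a b => (isControl_of_mem hf hf').intervalIntegrable a b
  have := intervalIntegral.continuous_primitive hi 0
  fun_prop

end Decay

namespace Strategy

variable {lam p₀ : ℝ} (u : Payoffs) (rho c : ℝ) (σ : Strategy lam p₀)

theorem measurable_one_sub_att : Measurable fun t => 1 - σ.att t :=
  measurable_const.sub σ.measurable_att

theorem one_sub_att_mem (t : ℝ) : 1 - σ.att t ∈ Icc (0 : ℝ) 1 :=
  ⟨by linarith [(σ.att_mem t).2], by linarith [(σ.att_mem t).1]⟩

theorem continuous_massR : Continuous σ.massR :=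
  (continuous_decay σ.measurable_att σ.att_mem).const_mul p₀

theorem continuous_massL : Continuous σ.massL :=
  (continuous_decay σ.measurable_one_sub_att σ.one_sub_att_mem).const_mul (1 - p₀)

theorem massR_nonneg (hp : p₀ ∈ Icc (0 : ℝ) 1) (t : ℝ) : 0 ≤ σ.massR t :=
  mul_nonneg hp.1 (Real.exp_pos _).le

theorem massL_nonneg (hp : p₀ ∈ Icc (0 : ℝ) 1) (t : ℝ) : 0 ≤ σ.massL t :=
  mul_nonneg (sub_nonneg.2 hp.2) (Real.exp_pos _).le

/-- The discounted payoff of a hypothetical correct action at time `t`. -/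
def correct (t : ℝ) : ℝ := Real.exp (-(rho * t)) * (σ.massR t * u.rR + σ.massL t * u.lL)

/-- The discounted rate of payoffs from breakthroughs. -/
def gain (t : ℝ) : ℝ := Real.exp (-(rho * t)) *
  (σ.massR t * lam * σ.att t * u.rR + σ.massL t * lam * (1 - σ.att t) * u.lL)

theorem continuous_correct : Continuous (σ.correct u rho) := by
  have := σ.continuous_massR
  have := σ.continuous_massL
  unfold correct
  fun_prop

theorem gain_eq (hlam : 0 < lam) (hp : p₀ ∈ Icc (0 : ℝ) 1) {t : ℝ} (ht : 0 ≤ t) :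
    Real.exp (-(rho * t)) * σ.survival t * (σ.belief t * lam * σ.att t * u.rR +
      (1 - σ.belief t) * lam * (1 - σ.att t) * u.lL) = σ.gain u rho t := by
  have h1 := σ.belief_mul_survival hlam hp ht
  have h2 := σ.survival_eq t
  rw [gain]
  linear_combination Real.exp (-(rho * t)) * lam * ((σ.att t * u.rR - (1 - σ.att t) * u.lL) * h1 +
    (1 - σ.att t) * u.lL * h2)

/-- Breakthrough gains plus interest on the payoff of a correct action are a total derivative in
each state. Thus `correct` decreases exactly by the integral of this sum, and gains can be traded
for interest losses. -/
theorem gain_add_eq (t : ℝ) : σ.gain u rho t + rho * σ.correct u rho t =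
    u.rR * p₀ * (Real.exp (-(rho * t)) * Real.exp (-(lam * ∫ s in (0 : ℝ)..t, σ.att s)) *
      (rho + lam * σ.att t)) +
    u.lL * (1 - p₀) * (Real.exp (-(rho * t)) * Real.exp (-(lam * ∫ s in (0 : ℝ)..t, (1 - σ.att s))) *
      (rho + lam * (1 - σ.att t))) := by
  simp only [gain, correct, massR, massL]
  ring

theorem intervalIntegrable_gain_add (s t : ℝ) :
    IntervalIntegrable (fun v => σ.gain u rho v + rho * σ.correct u rho v) volume s t := by
  simp_rw [gain_add_eq]
  have h1 := continuous_decay (lam := lam) σ.measurable_att σ.att_mem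
  have h2 := continuous_decay (lam := lam) σ.measurable_one_sub_att σ.one_sub_att_mem
  exact ((intervalIntegrable_decay σ.measurable_att σ.att_mem (by fun_prop) s t).const_mul _).add
    ((intervalIntegrable_decay σ.measurable_one_sub_att σ.one_sub_att_mem
      (by fun_prop) s t).const_mul _)

theorem intervalIntegrable_gain (s t : ℝ) : IntervalIntegrable (σ.gain u rho) volume s t := by
  have := (σ.intervalIntegrable_gain_add u rho s t).sub
    (((σ.continuous_correct u rho).const_mul rho).intervalIntegrable s t)
  refine this.congr fun v _ => ?_
  simp

theorem integral_gain_add {rho : ℝ} (hlam : 0 < lam) (hrho : 0 ≤ rho) (t : ℝ) :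
    ∫ v in (0 : ℝ)..t, (σ.gain u rho v + rho * σ.correct u rho v) =
      (p₀ * u.rR + (1 - p₀) * u.lL) - σ.correct u rho t := by
  simp_rw [gain_add_eq]
  have h1 := continuous_decay (lam := lam) σ.measurable_att σ.att_mem
  have h2 := continuous_decay (lam := lam) σ.measurable_one_sub_att σ.one_sub_att_mem
  rw [intervalIntegral.integral_add
    ((intervalIntegrable_decay σ.measurable_att σ.att_mem (by fun_prop) 0 t).const_mul _)
    ((intervalIntegrable_decay σ.measurable_one_sub_att σ.one_sub_att_mem
      (by fun_prop) 0 t).const_mul _), intervalIntegral.integral_const_mul,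
    intervalIntegral.integral_const_mul, integral_decay σ.measurable_att σ.att_mem hlam hrho,
    integral_decay σ.measurable_one_sub_att σ.one_sub_att_mem hlam hrho]
  simp only [correct, massR, massL]
  ring

/-- The discounted rate of losses, relative to knowing the state, before the deadline. -/
def running (t : ℝ) : ℝ := Real.exp (-(rho * t)) *
  ((rho * u.rR + c) * σ.massR t + (rho * u.lL + c) * σ.massL t)

/-- The discounted loss from the action at `t`, relative to knowing the state. -/
def ending (t : ℝ) : ℝ := Real.exp (-(rho * t)) *
  min ((u.rR - u.lR) * σ.massR t) ((u.lL - u.rL) * σ.massL t)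

/-- The expected loss relative to knowing the state. -/
def loss : ℝ≥0∞ :=
  (∫⁻ t in before σ.deadline, ENNReal.ofReal (σ.running u rho c t)) +
    if σ.deadline = ∞ then 0 else ENNReal.ofReal (σ.ending u rho σ.deadline.toReal)

theorem running_eq (t : ℝ) : σ.running u rho c t =
    rho * σ.correct u rho t + Real.exp (-(rho * t)) * σ.survival t * c := by
  rw [running, correct, survival_eq]; ring

theorem ending_eq (hlam : 0 < lam) (hp : p₀ ∈ Icc (0 : ℝ) 1) {t : ℝ} (ht : 0 ≤ t) :
    Real.exp (-(rho * t)) * σ.survival t * u.immediate (σ.belief t) =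
      σ.correct u rho t - σ.ending u rho t := by
  have h1 := σ.belief_mul_survival hlam hp ht
  have h2 := σ.survival_eq t
  have h3 : 0 ≤ σ.survival t := by
    rw [h2]; exact add_nonneg (σ.massR_nonneg hp t) (σ.massL_nonneg hp t)
  rw [mul_assoc, Payoffs.immediate, mul_max_of_nonneg _ _ h3, correct, ending, ← mul_sub]
  congr 1
  have e1 : σ.survival t * (σ.belief t * u.rR + (1 - σ.belief t) * u.rL) =
      σ.massR t * u.rR + σ.massL t * u.lL - (u.lL - u.rL) * σ.massL t := by
    linear_combination (u.rR - u.rL) * h1 + u.rL * h2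
  have e2 : σ.survival t * (σ.belief t * u.lR + (1 - σ.belief t) * u.lL) =
      σ.massR t * u.rR + σ.massL t * u.lL - (u.rR - u.lR) * σ.massR t := by
    linear_combination (u.lR - u.lL) * h1 + u.lL * h2
  rw [e1, e2, max_sub_sub_left, min_comm]

variable {u rho c}

theorem gain_nonneg (hlam : 0 < lam) (hp : p₀ ∈ Icc (0 : ℝ) 1) (hR : 0 ≤ u.rR) (hL : 0 ≤ u.lL)
    (t : ℝ) : 0 ≤ σ.gain u rho t := by
  have h1 := σ.massR_nonneg hp t
  have h2 := σ.massL_nonneg hp t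
  have h3 := (σ.att_mem t).1
  have h4 := (σ.one_sub_att_mem t).1
  unfold gain
  positivity

theorem correct_nonneg (hp : p₀ ∈ Icc (0 : ℝ) 1) (hR : 0 ≤ u.rR) (hL : 0 ≤ u.lL)
    (t : ℝ) : 0 ≤ σ.correct u rho t := by
  have h1 := σ.massR_nonneg hp t
  have h2 := σ.massL_nonneg hp t
  unfold correct
  positivity

theorem cost_nonneg (hp : p₀ ∈ Icc (0 : ℝ) 1) (hc : 0 ≤ c) (t : ℝ) :
    0 ≤ Real.exp (-(rho * t)) * σ.survival t * c := by
  have h1 := σ.massR_nonneg hp t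
  have h2 := σ.massL_nonneg hp t
  rw [survival_eq]
  positivity

theorem continuous_cost : Continuous fun t => Real.exp (-(rho * t)) * σ.survival t * c := by
  have := σ.continuous_massR
  have := σ.continuous_massL
  simp_rw [survival_eq]
  fun_prop

theorem continuous_running : Continuous (σ.running u rho c) := by
  have := σ.continuous_massR
  have := σ.continuous_massL
  unfold running
  fun_prop

theorem ending_nonneg (hp : p₀ ∈ Icc (0 : ℝ) 1) (hA : 0 ≤ u.rR - u.lR) (hB : 0 ≤ u.lL - u.rL)
    (t : ℝ) : 0 ≤ σ.ending u rho t :=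
  mul_nonneg (Real.exp_pos _).le (le_min (mul_nonneg hA (σ.massR_nonneg hp t))
    (mul_nonneg hB (σ.massL_nonneg hp t)))

theorem running_nonneg (hp : p₀ ∈ Icc (0 : ℝ) 1) (hR : 0 ≤ u.rR) (hL : 0 ≤ u.lL)
    (hrho : 0 ≤ rho) (hc : 0 ≤ c) (t : ℝ) : 0 ≤ σ.running u rho c t := by
  have h1 := σ.massR_nonneg hp t
  have h2 := σ.massL_nonneg hp t
  unfold running
  positivity

theorem _root_.EReal.coe_sub_coe_ofReal (x : ℝ) {y : ℝ} (hy : 0 ≤ y) :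
    (x : EReal) - ((ENNReal.ofReal y : ℝ≥0∞) : EReal) = ((x - y : ℝ) : EReal) := by
  rw [EReal.coe_ennreal_ofReal, max_eq_left hy, EReal.coe_sub]

theorem payoff_eq_of_ne_top (hlam : 0 < lam) (hp : p₀ ∈ Icc (0 : ℝ) 1) (hR : 0 ≤ u.rR)
    (hL : 0 ≤ u.lL) (hA : 0 ≤ u.rR - u.lR) (hB : 0 ≤ u.lL - u.rL) (hrho : 0 ≤ rho) (hc : 0 ≤ c)
    (hT : σ.deadline ≠ ∞) :
    σ.payoff u rho c = ((p₀ * u.rR + (1 - p₀) * u.lL : ℝ) : EReal) - (σ.loss u rho c : EReal) := by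
  set τ := σ.deadline.toReal with hτ
  have hτ0 : 0 ≤ τ := ENNReal.toReal_nonneg
  have h1 : σ.breakthroughPayoff u rho = ∫ t in (0 : ℝ)..τ, σ.gain u rho t := by
    rw [breakthroughPayoff, learningTimes_eq, before_of_ne_top hT, integral_Ico_eq_integral_Ioo,
      ← integral_Ioc_eq_integral_Ioo, ← intervalIntegral.integral_of_le hτ0]
    refine intervalIntegral.integral_congr fun t ht => ?_
    rw [uIcc_of_le hτ0] at ht
    exact σ.gain_eq u rho hlam hp ht.1
  have h2 : σ.flowCost rho c =
      ENNReal.ofReal (∫ t in (0 : ℝ)..τ, Real.exp (-(rho * t)) * σ.survival t * c) := by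
    rw [flowCost, learningTimes_eq, before_of_ne_top hT,
      lintegral_Ico_ofReal σ.continuous_cost (σ.cost_nonneg hp hc) hτ0]
  have h3 : σ.loss u rho c = ENNReal.ofReal ((∫ t in (0 : ℝ)..τ, σ.running u rho c t) +
      σ.ending u rho τ) := by
    rw [loss, if_neg hT, before_of_ne_top hT, lintegral_Ico_ofReal σ.continuous_running
      (σ.running_nonneg hp hR hL hrho hc) hτ0, ENNReal.ofReal_add
      (intervalIntegral.integral_nonneg hτ0 fun t _ => σ.running_nonneg hp hR hL hrho hc t)
      (σ.ending_nonneg hp hA hB τ)]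
  have h4 : ∫ t in (0 : ℝ)..τ, σ.running u rho c t =
      (∫ t in (0 : ℝ)..τ, rho * σ.correct u rho t) +
        ∫ t in (0 : ℝ)..τ, Real.exp (-(rho * t)) * σ.survival t * c := by
    simp_rw [running_eq]
    exact intervalIntegral.integral_add
      (((σ.continuous_correct u rho).const_mul rho).intervalIntegrable _ _)
      (σ.continuous_cost.intervalIntegrable _ _)
  have h5 := σ.integral_gain_add u hlam hrho τ
  rw [intervalIntegral.integral_add (σ.intervalIntegrable_gain u rho 0 τ)
    (((σ.continuous_correct u rho).const_mul rho).intervalIntegrable _ _)] at h5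
  have h6 : σ.deadlinePayoff u rho = σ.correct u rho τ - σ.ending u rho τ := by
    rw [deadlinePayoff, if_neg hT, σ.ending_eq u rho hlam hp hτ0]
  rw [payoff, h1, h2, h3, h6, EReal.coe_sub_coe_ofReal _ (intervalIntegral.integral_nonneg hτ0
    fun t _ => σ.cost_nonneg hp hc t), EReal.coe_sub_coe_ofReal _ (add_nonneg
    (intervalIntegral.integral_nonneg hτ0 fun t _ => σ.running_nonneg hp hR hL hrho hc t)
    (σ.ending_nonneg hp hA hB τ)), h4]
  congr 1
  linarith

theorem integrableOn_Ioi_of_bounded {f : ℝ → ℝ} {C : ℝ} (hf : ∀ t, IntervalIntegrable f volume 0 t)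
    (hf0 : ∀ t, 0 ≤ f t) (hC : ∀ t, 0 ≤ t → ∫ s in (0 : ℝ)..t, f s ≤ C) : IntegrableOn f (Ioi 0) := by
  refine integrableOn_Ioi_of_intervalIntegral_norm_bounded C 0 (fun t => (hf t).1) tendsto_id ?_
  filter_upwards [eventually_ge_atTop 0] with t ht
  simpa [Real.norm_eq_abs, abs_of_nonneg (hf0 _)] using hC t ht

/-- If the expected cost is infinite, both sides are `⊥`. Otherwise the finite-horizon identity is
passed to the limit, which requires that the payoff still to be earned by a correct action vanishes
at infinity. -/
theorem payoff_eq_of_eq_top (hlam : 0 < lam) (hp : p₀ ∈ Icc (0 : ℝ) 1) (hR : 0 ≤ u.rR)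
    (hL : 0 ≤ u.lL) (hrho : 0 ≤ rho) (hc : 0 ≤ c) (hpos : 0 < rho ∨ 0 < c)
    (hT : σ.deadline = ∞) :
    σ.payoff u rho c = ((p₀ * u.rR + (1 - p₀) * u.lL : ℝ) : EReal) - (σ.loss u rho c : EReal) := by
  have hk0 : ∀ t, 0 ≤ Real.exp (-(rho * t)) * σ.survival t * c := σ.cost_nonneg hp hc
  have hQ0 := σ.correct_nonneg (rho := rho) hp hR hL
  have hg0 := σ.gain_nonneg (rho := rho) hlam hp hR hL
  have hQi : ∀ t, IntervalIntegrable (σ.correct u rho) volume 0 t := fun t =>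
    (σ.continuous_correct u rho).intervalIntegrable _ _
  have hloss : σ.loss u rho c = (∫⁻ t in Ici 0, ENNReal.ofReal (rho * σ.correct u rho t)) +
      σ.flowCost rho c := by
    rw [loss, if_pos hT, hT, before_top, add_zero, flowCost, learningTimes_eq, hT, before_top,
      ← lintegral_add_left
        (((σ.continuous_correct u rho).const_mul rho).measurable.ennreal_ofReal)]
    refine lintegral_congr fun t => ?_
    rw [running_eq, ENNReal.ofReal_add (mul_nonneg hrho (hQ0 t)) (hk0 t)]
  by_cases htop : σ.flowCost rho c = ∞
  · rw [payoff, hloss, htop]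
    simp
  have hsum := σ.integral_gain_add u hlam hrho
  have hgQ : IntegrableOn (fun v => σ.gain u rho v + rho * σ.correct u rho v) (Ioi 0) :=
    integrableOn_Ioi_of_bounded (C := p₀ * u.rR + (1 - p₀) * u.lL)
      (σ.intervalIntegrable_gain_add u rho 0)
      (fun t => add_nonneg (hg0 t) (mul_nonneg hrho (hQ0 t)))
      fun t _ => by rw [hsum]; linarith [hQ0 t]
  have hh : IntegrableOn (fun v => rho * σ.correct u rho v) (Ioi 0) := by
    refine Integrable.mono' hgQ ((σ.continuous_correct u rho).const_mul rho).aestronglyMeasurable ?_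
    refine Eventually.of_forall fun t => ?_
    rw [Real.norm_eq_abs, abs_of_nonneg (mul_nonneg hrho (hQ0 t))]
    linarith [hg0 t]
  have hg : IntegrableOn (σ.gain u rho) (Ioi 0) := by
    refine (hgQ.sub hh).congr (Eventually.of_forall fun t => ?_)
    simp
  have hk : IntegrableOn (fun t => Real.exp (-(rho * t)) * σ.survival t * c) (Ioi 0) := by
    refine ⟨σ.continuous_cost.aestronglyMeasurable, ?_⟩
    rw [hasFiniteIntegral_iff_ofReal (Eventually.of_forall hk0)]
    rw [flowCost, learningTimes_eq, hT, before_top] at htop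
    exact (lintegral_mono_set Ioi_subset_Ici_self).trans_lt (lt_top_iff_ne_top.2 htop)
  -- Here it matters that `rho` and `c` are not both zero: integrability comes from the interest
  -- term if `rho > 0`, and from the finite expected cost if `rho = 0 < c`.
  have hQ : IntegrableOn (σ.correct u rho) (Ioi 0) := by
    rcases hrho.eq_or_lt with h0 | h0
    · have hc' : 0 < c := by
        rcases hpos with h | h
        · exact absurd h0 h.ne
        · exact h
      refine Integrable.mono' (hk.const_mul ((u.rR + u.lL) / c))
        (σ.continuous_correct u rho).aestronglyMeasurable (Eventually.of_forall fun t => ?_)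
      rw [Real.norm_eq_abs, abs_of_nonneg (hQ0 t), correct, survival_eq]
      have h1 := σ.massR_nonneg hp t
      have h2 := σ.massL_nonneg hp t
      have e : (u.rR + u.lL) / c * (Real.exp (-(rho * t)) * (σ.massR t + σ.massL t) * c) =
          Real.exp (-(rho * t)) * ((u.rR + u.lL) * (σ.massR t + σ.massL t)) := by field_simp
      rw [e]
      gcongr
      nlinarith [mul_nonneg h1 hL, mul_nonneg h2 hR]
    · refine (hh.const_mul rho⁻¹).congr (Eventually.of_forall fun t => ?_)
      simp only
      field_simp
  have hlim := intervalIntegral_tendsto_integral_Ioi 0 hgQ tendsto_id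
  simp only [id, hsum] at hlim
  have hlim' : Tendsto (σ.correct u rho) atTop (𝓝 (p₀ * u.rR + (1 - p₀) * u.lL -
      ∫ v in Ioi 0, (σ.gain u rho v + rho * σ.correct u rho v))) := by
    simpa using hlim.const_sub (p₀ * u.rR + (1 - p₀) * u.lL)
  -- An integrable function that has a limit at infinity has limit zero.
  have hz := IntegrableAtFilter.eq_zero_of_tendsto (μ := volume)
    ⟨Ioi 0, Ioi_mem_atTop 0, hQ⟩ (fun s hs => by
      obtain ⟨x, hx⟩ := mem_atTop_sets.1 hs
      exact measure_mono_top (show Ici x ⊆ s from hx) Real.volume_Ici) hlim'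
  rw [integral_add hg hh] at hz
  have h1 : σ.breakthroughPayoff u rho = ∫ t in Ioi 0, σ.gain u rho t := by
    rw [breakthroughPayoff, learningTimes_eq, hT, before_top, integral_Ici_eq_integral_Ioi]
    exact setIntegral_congr_fun measurableSet_Ioi fun t ht => σ.gain_eq u rho hlam hp (le_of_lt ht)
  have h2 : σ.flowCost rho c =
      ENNReal.ofReal (∫ t in Ioi 0, Real.exp (-(rho * t)) * σ.survival t * c) := by
    rw [flowCost, learningTimes_eq, hT, before_top, setLIntegral_congr Ioi_ae_eq_Ici.symm,
      ofReal_integral_eq_lintegral_ofReal hk (Eventually.of_forall hk0)]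
  have h3 : (∫⁻ t in Ici 0, ENNReal.ofReal (rho * σ.correct u rho t)) =
      ENNReal.ofReal (∫ t in Ioi 0, rho * σ.correct u rho t) := by
    rw [setLIntegral_congr Ioi_ae_eq_Ici.symm, ofReal_integral_eq_lintegral_ofReal hh
      (Eventually.of_forall fun t => mul_nonneg hrho (hQ0 t))]
  have hk0' : 0 ≤ ∫ t in Ioi 0, Real.exp (-(rho * t)) * σ.survival t * c :=
    integral_nonneg hk0
  have hh0 : 0 ≤ ∫ t in Ioi 0, rho * σ.correct u rho t :=
    integral_nonneg fun t => mul_nonneg hrho (hQ0 t)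
  rw [payoff, hloss, h3, h2, ← ENNReal.ofReal_add hh0 hk0', h1, deadlinePayoff, if_pos hT,
    EReal.coe_sub_coe_ofReal _ hk0', EReal.coe_sub_coe_ofReal _ (add_nonneg hh0 hk0')]
  congr 1
  linarith

theorem payoff_eq (hlam : 0 < lam) (hp : p₀ ∈ Icc (0 : ℝ) 1) (hR : 0 ≤ u.rR)
    (hL : 0 ≤ u.lL) (hA : 0 ≤ u.rR - u.lR) (hB : 0 ≤ u.lL - u.rL) (hrho : 0 ≤ rho) (hc : 0 ≤ c)
    (hpos : 0 < rho ∨ 0 < c) :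
    σ.payoff u rho c = ((p₀ * u.rR + (1 - p₀) * u.lL : ℝ) : EReal) - (σ.loss u rho c : EReal) := by
  by_cases hT : σ.deadline = ∞
  · exact σ.payoff_eq_of_eq_top hlam hp hR hL hrho hc hpos hT
  · exact σ.payoff_eq_of_ne_top hlam hp hR hL hA hB hrho hc hT

/-- Subtraction from a finite constant reverses the order also in the extended reals; the infinite
losses are separated because there the payoff is `⊥`. -/
theorem isOptimal_iff (hlam : 0 < lam) (hp : p₀ ∈ Icc (0 : ℝ) 1) (hR : 0 ≤ u.rR)
    (hL : 0 ≤ u.lL) (hA : 0 ≤ u.rR - u.lR) (hB : 0 ≤ u.lL - u.rL) (hrho : 0 ≤ rho) (hc : 0 ≤ c)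
    (hpos : 0 < rho ∨ 0 < c) :
    σ.IsOptimal u rho c ↔ ∀ τ : Strategy lam p₀, σ.loss u rho c ≤ τ.loss u rho c := by
  refine forall_congr' fun τ => ?_
  rw [τ.payoff_eq hlam hp hR hL hA hB hrho hc hpos, σ.payoff_eq hlam hp hR hL hA hB hrho hc hpos]
  generalize τ.loss u rho c = y
  generalize σ.loss u rho c = x
  generalize p₀ * u.rR + (1 - p₀) * u.lL = r
  refine ⟨fun h => ?_, fun h => EReal.sub_le_sub le_rfl (EReal.coe_ennreal_le_coe_ennreal_iff.2 h)⟩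
  induction y with
  | top => exact le_top
  | coe y =>
    rw [EReal.coe_nnreal_eq_coe_real, ← EReal.coe_sub] at h
    induction x with
    | top =>
      rw [EReal.coe_ennreal_top, sub_eq_add_neg (r : EReal) ⊤, EReal.neg_top, EReal.add_bot,
        le_bot_iff] at h
      exact absurd h (EReal.coe_ne_bot _)
    | coe x =>
      rw [EReal.coe_nnreal_eq_coe_real, ← EReal.coe_sub, EReal.coe_le_coe_iff] at h
      exact_mod_cast show (x : ℝ) ≤ y by linarith

end Strategy

/-! ### Standing assumptions and the normalized problem. -/

/-- The standing assumptions on utilities and parameters. -/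
structure Standing (u : Payoffs) (lam rho c : ℝ) : Prop where
  lam_pos : 0 < lam
  right : max 0 u.lR < u.rR
  left : max 0 u.rL < u.lL
  rho_nonneg : 0 ≤ rho
  c_nonneg : 0 ≤ c
  pos : 0 < rho ∨ 0 < c

namespace Standing

variable {u : Payoffs} {lam rho c : ℝ}

theorem rR_pos (s : Standing u lam rho c) : 0 < u.rR := (le_max_left _ _).trans_lt s.right

theorem lL_pos (s : Standing u lam rho c) : 0 < u.lL := (le_max_left _ _).trans_lt s.left

theorem A_pos (s : Standing u lam rho c) : 0 < u.rR - u.lR :=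
  sub_pos.2 ((le_max_right _ _).trans_lt s.right)

theorem B_pos (s : Standing u lam rho c) : 0 < u.lL - u.rL :=
  sub_pos.2 ((le_max_right _ _).trans_lt s.left)

theorem a_pos (s : Standing u lam rho c) : 0 < rho * u.rR + c := by
  rcases s.pos with h | h
  · exact add_pos_of_pos_of_nonneg (mul_pos h s.rR_pos) s.c_nonneg
  · exact add_pos_of_nonneg_of_pos (mul_nonneg s.rho_nonneg s.rR_pos.le) h

theorem b_pos (s : Standing u lam rho c) : 0 < rho * u.lL + c := by
  rcases s.pos with h | h
  · exact add_pos_of_pos_of_nonneg (mul_pos h s.lL_pos) s.c_nonneg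
  · exact add_pos_of_nonneg_of_pos (mul_nonneg s.rho_nonneg s.lL_pos.le) h

end Standing

namespace Strategy

variable {u : Payoffs} {lam rho c p₀ : ℝ}

theorem isOptimal_iff_loss_le (s : Standing u lam rho c) (hp : p₀ ∈ Icc (0 : ℝ) 1)
    (σ : Strategy lam p₀) :
    σ.IsOptimal u rho c ↔ ∀ τ : Strategy lam p₀, σ.loss u rho c ≤ τ.loss u rho c :=
  σ.isOptimal_iff s.lam_pos hp s.rR_pos.le s.lL_pos.le s.A_pos.le s.B_pos.le s.rho_nonneg s.c_nonneg
    s.pos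

/-- The regret of a strategy in the normalized problem. -/
def normalized (u : Payoffs) (rho c : ℝ) (σ : Strategy lam p₀) : ℝ≥0∞ :=
  regret (rho + lam / 2) (flow (rho * u.rR + c) (rho * u.lL + c))
    (stopLoss (u.rR - u.lR) (u.lL - u.rL)) σ.trajectory σ.deadline

theorem loss_eq (hp : p₀ ∈ Ioo (0 : ℝ) 1) (σ : Strategy lam p₀) :
    σ.loss u rho c = ENNReal.ofReal (scale p₀) * σ.normalized u rho c := by
  have hs := (scale_pos hp).le
  have hexp : ∀ t, Real.exp (-((rho + lam / 2) * t)) =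
      Real.exp (-(rho * t)) * Real.exp (-(lam / 2 * t)) := fun t => by
    rw [← Real.exp_add]; congr 1; ring
  have h1 : ∀ t, σ.running u rho c t = scale p₀ * (Real.exp (-((rho + lam / 2) * t)) *
      flow (rho * u.rR + c) (rho * u.lL + c) (σ.trajectory t)) := fun t => by
    rw [running, massR_eq, σ.massL_eq hp, hexp, flow]; ring
  have h2 : ∀ t, σ.ending u rho t = scale p₀ * (Real.exp (-((rho + lam / 2) * t)) *
      stopLoss (u.rR - u.lR) (u.lL - u.rL) (σ.trajectory t)) := fun t => by
    rw [ending, massR_eq, σ.massL_eq hp, hexp, stopLoss,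
      mul_min_of_nonneg _ _ (mul_pos (Real.exp_pos _) (Real.exp_pos _)).le,
      mul_min_of_nonneg _ _ (Real.exp_pos _).le, mul_min_of_nonneg _ _ hs]
    congr 1 <;> ring
  rw [loss, normalized, regret, mul_add]
  simp_rw [h1, h2, ENNReal.ofReal_mul hs]
  rw [lintegral_const_mul' _ _ ENNReal.ofReal_ne_top]
  split_ifs <;> simp

theorem isOptimal_iff_normalized_le (s : Standing u lam rho c) (hp : p₀ ∈ Ioo (0 : ℝ) 1)
    (σ : Strategy lam p₀) : σ.IsOptimal u rho c ↔
      ∀ τ : Strategy lam p₀, σ.normalized u rho c ≤ τ.normalized u rho c := by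
  rw [isOptimal_iff_loss_le s (Ioo_subset_Icc_self hp)]
  refine forall_congr' fun τ => ?_
  rw [loss_eq hp, loss_eq hp, ENNReal.mul_le_mul_iff_right
    (ENNReal.ofReal_pos.2 (scale_pos hp)).ne' ENNReal.ofReal_ne_top]

theorem trajectory_zero (σ : Strategy lam p₀) : σ.trajectory 0 = logit p₀ := path_zero _ _ _

theorem belief_zero (σ : Strategy lam p₀) : σ.belief 0 = p₀ := by
  simpa using σ.belief_eq 0 le_rfl

/-- There is a strategy with any given attention and deadline. -/
theorem exists_of_att (hlam : 0 < lam) (hp : p₀ ∈ Icc (0 : ℝ) 1) {α : ℝ → ℝ} (hm : Measurable α)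
    (hα : ∀ t, α t ∈ Icc (0 : ℝ) 1) (T : ℝ≥0∞) :
    ∃ σ : Strategy lam p₀, σ.att = α ∧ σ.deadline = T := by
  rcases hp.1.eq_or_lt with h0 | h0
  · exact ⟨⟨α, hm, hα, T, fun _ => 0, continuousOn_const, fun t _ => by simp [← h0]⟩, rfl, rfl⟩
  rcases hp.2.eq_or_lt with h1 | h1
  · exact ⟨⟨α, hm, hα, T, fun _ => 1, continuousOn_const, fun t _ => by simp [h1]⟩, rfl, rfl⟩
  have hc := isControl_control hm hα
  refine ⟨⟨α, hm, hα, T, fun t => Real.sigmoid (path lam (logit p₀) (control α) t),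
    (continuous_sigmoid.comp (hc.continuous_path hlam)).continuousOn, fun t _ => ?_⟩, rfl, rfl⟩
  rw [sigmoid_path_eq hc hlam, sigmoid_logit ⟨h0, h1⟩]
  congr 1
  refine intervalIntegral.integral_congr fun s _ => ?_
  simp only [control]
  ring

theorem exists_deadline_zero (hlam : 0 < lam) (hp : p₀ ∈ Icc (0 : ℝ) 1) :
    ∃ σ : Strategy lam p₀, σ.deadline = 0 := by
  obtain ⟨σ, -, h⟩ := exists_of_att hlam hp (α := fun _ => 0) measurable_const
    (fun _ => ⟨le_rfl, zero_le_one⟩) 0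
  exact ⟨σ, h⟩

theorem same_of_deadline_eq_zero {σ τ : Strategy lam p₀} (h : σ.deadline = 0)
    (h' : τ.deadline = 0) : σ.Same τ :=
  ⟨h.trans h'.symm, Eventually.of_forall fun t ht => absurd ht.2 (by simp [h])⟩

theorem executes_of_deadline_eq_zero {π : Policy} (hπ : π p₀ = Decision.act) {σ : Strategy lam p₀}
    (h : σ.deadline = 0) : Executes π σ :=
  ⟨fun t ht => absurd ht.2 (by simp [h]), fun _ => by simp [h, belief_zero, hπ]⟩

theorem zero_mem_before {σ : Strategy lam p₀} (h : σ.deadline ≠ 0) : (0 : ℝ) ∈ before σ.deadline :=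
  ⟨le_rfl, by simpa using pos_iff_ne_zero.2 h⟩

theorem deadline_eq_zero_of_executes {π : Policy} (hπ : π p₀ = Decision.act)
    {σ : Strategy lam p₀} (h : Executes π σ) : σ.deadline = 0 := by
  by_contra hT
  have := (h.1 0 (zero_mem_before hT)).1
  rw [belief_zero, hπ] at this
  cases this

/-- When the state is known, the loss is positive unless the action is immediate. -/
theorem isOptimal_iff_of_known (s : Standing u lam rho c) (hp : p₀ = 0 ∨ p₀ = 1)
    (σ : Strategy lam p₀) : σ.IsOptimal u rho c ↔ σ.deadline = 0 := by
  have hp' : p₀ ∈ Icc (0 : ℝ) 1 := by rcases hp with rfl | rfl <;> simp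
  have hend : ∀ τ : Strategy lam p₀, ∀ t, τ.ending u rho t = 0 := fun τ t => by
    have h1 : 0 ≤ (u.rR - u.lR) * τ.massR t := mul_nonneg s.A_pos.le (τ.massR_nonneg hp' t)
    have h2 : 0 ≤ (u.lL - u.rL) * τ.massL t := mul_nonneg s.B_pos.le (τ.massL_nonneg hp' t)
    rcases hp with rfl | rfl
    · rw [ending, min_eq_left (by simpa [massR] using h2)]; simp [massR]
    · rw [ending, min_eq_right (by simpa [massL] using h1)]; simp [massL]
  have hzero : ∀ τ : Strategy lam p₀, τ.deadline = 0 → τ.loss u rho c = 0 := fun τ h => by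
    have : before 0 = ∅ := by ext; simp [before]
    rw [loss, h, this]
    simp [hend]
  -- With a known state stopping is free, while every moment of learning has a strictly positive
  -- cost from delay or effort.
  have hrun : ∀ t, 0 < σ.running u rho c t := fun t => by
    have := s.a_pos
    have := s.b_pos
    rcases hp with rfl | rfl
    · simp only [running, massR, massL]; simp only [zero_mul, mul_zero, zero_add, sub_zero, one_mul]
      positivity
    · simp only [running, massR, massL]; simp only [zero_mul, mul_zero, add_zero, sub_self, one_mul]
      positivity
  rw [isOptimal_iff_loss_le s hp']
  refine ⟨fun h => ?_, fun h τ => by rw [hzero σ h]; exact zero_le⟩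
  obtain ⟨τ, hτ⟩ := exists_deadline_zero s.lam_pos hp'
  have h0 := h τ
  rw [hzero τ hτ, loss] at h0
  have h1 := (add_eq_zero.1 (le_antisymm h0 zero_le)).1
  rw [setLIntegral_eq_zero_iff (measurableSet_before _)
    σ.continuous_running.measurable.ennreal_ofReal] at h1
  by_contra hT
  obtain ⟨s, -, -, hs, hs'⟩ := exists_mem_before_of_ae (zero_mem_before hT) zero_lt_one h1
  exact absurd (ENNReal.ofReal_eq_zero.1 hs') (not_le.2 (hrun s))

end Strategy

open Strategy

/-! ### Executions of policies. -/

section Policies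

variable {u : Payoffs} {lam rho c p₀ : ℝ} {π : Policy}

/-- Where a policy acts it is executed by immediate action only. -/
theorem exists_unique_executes_of_act (hlam : 0 < lam) (hp : p₀ ∈ Icc (0 : ℝ) 1)
    (hπ : π p₀ = Decision.act) :
    ∃ σ : Strategy lam p₀, Executes π σ ∧ ∀ τ : Strategy lam p₀, Executes π τ → τ.Same σ := by
  obtain ⟨σ, hσ⟩ := exists_deadline_zero hlam hp
  exact ⟨σ, executes_of_deadline_eq_zero hπ hσ, fun τ hτ =>
    same_of_deadline_eq_zero (deadline_eq_zero_of_executes hπ hτ) hσ⟩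

theorem exists_executes_of_deadline_eq_zero (hπ : π p₀ = Decision.act) {σ : Strategy lam p₀}
    (h : σ.deadline = 0) : ∃ τ : Strategy lam p₀, Executes π τ ∧ σ.Same τ :=
  ⟨σ, executes_of_deadline_eq_zero hπ h, rfl, Eventually.of_forall fun _ _ => rfl⟩

/-- A right-continuous attention function along whose path the policy prescribes it gives an
execution. -/
theorem exists_executes (hlam : 0 < lam) (hp : p₀ ∈ Ioo (0 : ℝ) 1) {α : ℝ → ℝ} (hm : Measurable α)
    (hα : ∀ t, α t ∈ Icc (0 : ℝ) 1) {T : ℝ≥0∞}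
    (hc : ∀ t ∈ before T, ContinuousWithinAt α (Ici t) t)
    (hlearn : ∀ t ∈ before T,
      π (Real.sigmoid (path lam (logit p₀) (control α) t)) = Decision.learn (α t))
    (hact : T ≠ ∞ → π (Real.sigmoid (path lam (logit p₀) (control α) T.toReal)) = Decision.act) :
    ∃ σ : Strategy lam p₀, Executes π σ ∧ σ.att = α ∧ σ.deadline = T := by
  obtain ⟨σ, rfl, rfl⟩ := exists_of_att hlam (Ioo_subset_Icc_self hp) hm hα T
  refine ⟨σ, ⟨fun t ht => ⟨?_, ?_⟩, fun hT => ?_⟩, rfl, rfl⟩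
  · rw [σ.belief_eq_sigmoid hlam hp ht.1]
    exact hlearn t ht
  · have h1 : ContinuousWithinAt (control σ.att) (Ici t) t :=
      continuousWithinAt_const.sub ((hc t ht).const_mul 2)
    have h2 := σ.isControl.hasDerivWithinAt_path (lam := lam) (z₀ := logit p₀) h1
    have h3 := (Real.hasDerivAt_sigmoid (path lam (logit p₀) (control σ.att) t)).comp_hasDerivWithinAt
      t h2
    refine (h3.congr (fun v hv => ?_) ?_).congr_deriv ?_
    · exact σ.belief_eq_sigmoid hlam hp (ht.1.trans hv)
    · exact σ.belief_eq_sigmoid hlam hp ht.1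
    · rw [σ.belief_eq_sigmoid hlam hp ht.1, trajectory]
      simp only [control]
      ring
  · rw [σ.belief_eq_sigmoid hlam hp ENNReal.toReal_nonneg]
    exact hact hT

theorem exists_executes_moving (hlam : 0 < lam) (hp : p₀ ∈ Ioo (0 : ℝ) 1) {α τ : ℝ}
    (hα : α ∈ Icc (0 : ℝ) 1) (hτ : 0 ≤ τ)
    (hlearn : ∀ t ∈ Ico 0 τ,
      π (Real.sigmoid (logit p₀ + lam * (1 - 2 * α) * t)) = Decision.learn α)
    (hact : π (Real.sigmoid (logit p₀ + lam * (1 - 2 * α) * τ)) = Decision.act) :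
    ∃ σ : Strategy lam p₀, Executes π σ ∧ σ.deadline = ENNReal.ofReal τ ∧ ∀ t, σ.att t = α := by
  have hpath : ∀ t, path lam (logit p₀) (control fun _ => α) t =
      logit p₀ + lam * (1 - 2 * α) * t := fun t => by
    simp [path, control]; ring
  obtain ⟨σ, h1, h2, h3⟩ := exists_executes (π := π) hlam hp (α := fun _ => α) (T := ENNReal.ofReal τ)
    measurable_const (fun _ => hα) (fun t _ => continuousWithinAt_const)
    (fun t ht => by
      rw [hpath]
      rw [before_of_ne_top ENNReal.ofReal_ne_top, ENNReal.toReal_ofReal hτ] at ht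
      exact hlearn t ht)
    (fun _ => by rwa [ENNReal.toReal_ofReal hτ, hpath])
  exact ⟨σ, h1, h3, fun t => by rw [h2]⟩

theorem exists_executes_waiting (hlam : 0 < lam) (hp : p₀ ∈ Ioo (0 : ℝ) 1) {α τ : ℝ}
    (hα : α ∈ Icc (0 : ℝ) 1) (hτ : 0 ≤ τ)
    (hlearn : ∀ t ∈ Ico 0 τ,
      π (Real.sigmoid (logit p₀ + lam * (1 - 2 * α) * t)) = Decision.learn α)
    (hwait : π (Real.sigmoid (logit p₀ + lam * (1 - 2 * α) * τ)) = Decision.learn (1 / 2)) :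
    ∃ σ : Strategy lam p₀, Executes π σ ∧ σ.deadline = ∞ ∧
      ∀ t, σ.att t = if t < τ then α else 1 / 2 := by
  -- The attention changes exactly at `τ` with `t < τ` strict, so that it is right-continuous there
  -- and the right derivative of the belief matches the prescription at `q`.
  set β : ℝ → ℝ := fun t => if t < τ then α else 1 / 2 with hβ
  have hβm : Measurable β := Measurable.ite measurableSet_Iio measurable_const measurable_const
  have hβ1 : ∀ t, β t ∈ Icc (0 : ℝ) 1 := fun t => by
    simp only [hβ]
    split_ifs
    · exact hα
    · norm_num
  have hβc := isControl_control hβm hβ1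
  have hbefore : ∀ t ∈ Icc 0 τ, path lam (logit p₀) (control β) t =
      logit p₀ + lam * (1 - 2 * α) * t := fun t ht => by
    rw [path_eq_of_ae (s := 0) (k := 1 - 2 * α) hβc ht.1, path_zero, sub_zero]
    exact Eventually.of_forall fun v hv => by simp [control, hβ, hv.2.trans_le ht.2]
  have hafter : ∀ t, τ ≤ t → path lam (logit p₀) (control β) t =
      logit p₀ + lam * (1 - 2 * α) * τ := fun t ht => by
    rw [path_eq_of_ae (s := τ) (k := 0) hβc ht, hbefore τ ⟨hτ, le_rfl⟩]
    · ring
    · exact Eventually.of_forall fun v hv => by simp [control, hβ, not_lt.2 hv.1.le]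
  obtain ⟨σ, h1, h2, h3⟩ := exists_executes (π := π) hlam hp (T := ∞) hβm hβ1
    (fun t _ => by
      rcases lt_or_ge t τ with h | h
      · refine (continuousWithinAt_const (b := α)).congr_of_eventuallyEq
          (mem_nhdsWithin_of_mem_nhds ?_) (if_pos h)
        exact (gt_mem_nhds h).mono fun w hw => if_pos hw
      · exact (continuousWithinAt_const (b := (1 / 2 : ℝ))).congr
          (fun w hw => if_neg (not_lt.2 (h.trans hw))) (if_neg (not_lt.2 h)))
    (fun t ht => by
      rcases lt_or_ge t τ with h | h
      · rw [hbefore t ⟨ht.1, h.le⟩, hlearn t ⟨ht.1, h⟩]; simp [hβ, h]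
      · rw [hafter t h, hwait]; simp [hβ, not_lt.2 h])
    (fun h => absurd rfl h)
  exact ⟨σ, h1, h3, fun t => by rw [h2]⟩

/-- At a prior at which the policy prescribes full attention to one source, an execution moves away
from the prior at once. -/
theorem Executes.eventually_lt_or_gt (hlam : 0 < lam) (hp : p₀ ∈ Ioo (0 : ℝ) 1)
    {σ : Strategy lam p₀} (h : Executes π σ) {a : ℝ} (hπ : π p₀ = Decision.learn a) :
    (1 / 2 < a → ∃ e > 0, ∀ t ∈ Ioo 0 e, σ.trajectory t < logit p₀) ∧
      (a < 1 / 2 → ∃ e > 0, ∀ t ∈ Ioo 0 e, logit p₀ < σ.trajectory t) := by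
  have hT : σ.deadline ≠ 0 := fun hT => by
    have := h.2 (by simp [hT])
    rw [hT, ENNReal.toReal_zero, belief_zero, hπ] at this
    cases this
  obtain ⟨h1, h2⟩ := h.1 0 (zero_mem_before hT)
  rw [belief_zero, hπ] at h1
  have ha : a = σ.att 0 := by injection h1
  rw [belief_zero, ← ha] at h2
  -- The pointwise right derivative required of an execution is what settles the direction at a
  -- switch point; an almost everywhere condition would not see time 0.
  have hs := (hasDerivWithinAt_iff_tendsto_slope' self_notMem_Ioi).1 (h2.mono Ioi_subset_Ici_self)
  have hpos : 0 < lam * (p₀ * (1 - p₀)) := mul_pos hlam (mul_pos hp.1 (sub_pos.2 hp.2))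
  have hb : ∀ t ∈ Ioi (0 : ℝ), slope σ.belief 0 t =
      (Real.sigmoid (σ.trajectory t) - Real.sigmoid (logit p₀)) / t := fun t ht => by
    rw [slope_def_field, sub_zero, belief_zero, σ.belief_eq_sigmoid hlam hp (le_of_lt ht),
      sigmoid_logit hp]
  constructor
  · intro ha'
    have h3 := hs.eventually (gt_mem_nhds (show -(lam * (2 * a - 1) * p₀ * (1 - p₀)) < 0 by nlinarith))
    obtain ⟨e, he, h4⟩ := mem_nhdsGT_iff_exists_Ioo_subset.1 h3
    refine ⟨e, he, fun t ht => ?_⟩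
    have h5 : slope σ.belief 0 t < 0 := h4 ht
    rw [hb t ht.1, div_neg_iff] at h5
    rcases h5 with h5 | h5
    · exact absurd ht.1 (not_lt.2 h5.2.le)
    · exact Real.sigmoid_lt_iff.1 (sub_neg.1 h5.1)
  · intro ha'
    have h3 := hs.eventually (lt_mem_nhds (show 0 < -(lam * (2 * a - 1) * p₀ * (1 - p₀)) by nlinarith))
    obtain ⟨e, he, h4⟩ := mem_nhdsGT_iff_exists_Ioo_subset.1 h3
    refine ⟨e, he, fun t ht => ?_⟩
    have h5 : 0 < slope σ.belief 0 t := h4 ht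
    rw [hb t ht.1, div_pos_iff] at h5
    rcases h5 with h5 | h5
    · exact Real.sigmoid_lt_iff.1 (sub_pos.1 h5.1)
    · exact absurd ht.1 (not_lt.2 h5.2.le)

/-- Strategies whose controls agree before a common deadline are the same. -/
theorem Strategy.same_of_control {σ τ : Strategy lam p₀}
    (h : σ.deadline = τ.deadline ∧
      ∀ᵐ t, t ∈ before σ.deadline → control σ.att t = control τ.att t) : σ.Same τ := by
  refine ⟨h.1, ?_⟩
  filter_upwards [h.2] with t ht hm
  have := ht hm
  simp only [control] at this
  linarith

end Policies

theorem logit_mem_Ioo_iff {p lo hi : ℝ} (hp : p ∈ Ioo (0 : ℝ) 1) :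
    logit p ∈ Ioo lo hi ↔ p ∈ Ioo (Real.sigmoid lo) (Real.sigmoid hi) := by
  rw [mem_Ioo, mem_Ioo, ← Real.sigmoid_lt_iff, ← Real.sigmoid_lt_iff (b := hi), sigmoid_logit hp]

/-- The value function `φ` solves the normalized problem of the decision maker. -/
abbrev Solves (u : Payoffs) (lam rho c lo hi : ℝ) (φ : ℝ → ℝ) : Prop :=
  IsValue lam (rho + lam / 2) (flow (rho * u.rR + c) (rho * u.lL + c))
    (stopLoss (u.rR - u.lR) (u.lL - u.rL)) lo hi φ

namespace Solves

variable {u : Payoffs} {lam rho c lo hi p₀ : ℝ} {φ : ℝ → ℝ} {π : Policy}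

theorem isOptimal (hv : Solves u lam rho c lo hi φ) (s : Standing u lam rho c)
    (hp : p₀ ∈ Ioo (0 : ℝ) 1) {σ : Strategy lam p₀}
    (h : σ.normalized u rho c ≤ ENNReal.ofReal (φ (logit p₀))) : σ.IsOptimal u rho c :=
  (isOptimal_iff_normalized_le s hp σ).2 fun τ => h.trans (hv.le_regret τ.isControl)

theorem isOptimal_iff_of_notMem (hv : Solves u lam rho c lo hi φ) (s : Standing u lam rho c)
    (hp : p₀ ∈ Icc (0 : ℝ) 1) (hp' : p₀ ∉ Ioo (Real.sigmoid lo) (Real.sigmoid hi))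
    {σ : Strategy lam p₀} : σ.IsOptimal u rho c ↔ σ.deadline = 0 := by
  rcases hp.1.eq_or_lt with h0 | h0
  · exact isOptimal_iff_of_known s (Or.inl h0.symm) σ
  rcases hp.2.eq_or_lt with h1 | h1
  · exact isOptimal_iff_of_known s (Or.inr h1) σ
  have hp2 : p₀ ∈ Ioo (0 : ℝ) 1 := ⟨h0, h1⟩
  rw [← logit_mem_Ioo_iff hp2] at hp'
  have hle : ∀ τ : Strategy lam p₀, τ.deadline = 0 →
      τ.normalized u rho c ≤ ENNReal.ofReal (φ (logit p₀)) := fun τ hτ => by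
    rw [normalized, hτ]
    exact hv.regret_zero_le τ.isControl hp'
  refine ⟨fun h => ?_, fun h => hv.isOptimal s hp2 (hle σ h)⟩
  obtain ⟨τ, hτ⟩ := exists_deadline_zero s.lam_pos hp
  have := ((isOptimal_iff_normalized_le s hp2 σ).1 h τ).trans (hle τ hτ)
  exact IsValue.deadline_eq_zero (fun t ht => hv.path_mem σ.isControl this ht) hp'

theorem isOptimalPolicy (hv : Solves u lam rho c lo hi φ) (s : Standing u lam rho c)
    (hπ : ∀ p ∉ Ioo (Real.sigmoid lo) (Real.sigmoid hi), π p = Decision.act)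
    (hex : ∀ p₀ ∈ Ioo (0 : ℝ) 1, logit p₀ ∈ Ioo lo hi → ∃ σ : Strategy lam p₀, Executes π σ ∧
      ∀ τ : Strategy lam p₀, Executes π τ → τ.Same σ)
    (hle : ∀ p₀ ∈ Ioo (0 : ℝ) 1, ∀ σ : Strategy lam p₀, Executes π σ →
      σ.normalized u rho c ≤ ENNReal.ofReal (φ (logit p₀))) :
    IsOptimalPolicy u lam rho c π := by
  intro p₀ hp
  by_cases hmem : p₀ ∈ Ioo (Real.sigmoid lo) (Real.sigmoid hi)
  · have hp' : p₀ ∈ Ioo (0 : ℝ) 1 :=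
      ⟨(Real.sigmoid_pos lo).trans hmem.1, hmem.2.trans (Real.sigmoid_lt_one hi)⟩
    exact ⟨hex p₀ hp' ((logit_mem_Ioo_iff hp').2 hmem), fun σ hσ =>
      hv.isOptimal s hp' (hle p₀ hp' σ hσ)⟩
  · exact ⟨exists_unique_executes_of_act s.lam_pos hp (hπ p₀ hmem), fun σ hσ =>
      (hv.isOptimal_iff_of_notMem s hp hmem).2 (deadline_eq_zero_of_executes (hπ p₀ hmem) hσ)⟩

/-- An optimal strategy costs no more than an execution of an optimal policy, and that execution
attains the verification bound. -/
theorem normalized_le (s : Standing u lam rho c) (hp : p₀ ∈ Ioo (0 : ℝ) 1)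
    (hπ : IsOptimalPolicy u lam rho c π)
    (hle : ∀ p₀ ∈ Ioo (0 : ℝ) 1, ∀ σ : Strategy lam p₀, Executes π σ →
      σ.normalized u rho c ≤ ENNReal.ofReal (φ (logit p₀)))
    {σ : Strategy lam p₀} (hσ : σ.IsOptimal u rho c) :
    σ.normalized u rho c ≤ ENNReal.ofReal (φ (logit p₀)) := by
  obtain ⟨⟨τ, hτ, -⟩, -⟩ := hπ p₀ (Ioo_subset_Icc_self hp)
  exact ((isOptimal_iff_normalized_le s hp σ).1 hσ τ).trans (hle p₀ hp τ hτ)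

theorem optimaComeFrom (hv : Solves u lam rho c lo hi φ) (s : Standing u lam rho c)
    {P : Set Policy} (hπP : π ∈ P)
    (hπ : ∀ p ∉ Ioo (Real.sigmoid lo) (Real.sigmoid hi), π p = Decision.act)
    (hopt : IsOptimalPolicy u lam rho c π)
    (hle : ∀ p₀ ∈ Ioo (0 : ℝ) 1, ∀ σ : Strategy lam p₀, Executes π σ →
      σ.normalized u rho c ≤ ENNReal.ofReal (φ (logit p₀)))
    (hin : ∀ p₀ ∈ Ioo (0 : ℝ) 1, logit p₀ ∈ Ioo lo hi → ∀ σ : Strategy lam p₀,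
      σ.normalized u rho c ≤ ENNReal.ofReal (φ (logit p₀)) →
        ∃ ϖ ∈ P, ∃ τ : Strategy lam p₀, Executes ϖ τ ∧ σ.Same τ) :
    OptimaComeFrom u lam rho c P := by
  intro p₀ hp σ hσ
  by_cases hmem : p₀ ∈ Ioo (Real.sigmoid lo) (Real.sigmoid hi)
  · have hp' : p₀ ∈ Ioo (0 : ℝ) 1 :=
      ⟨(Real.sigmoid_pos lo).trans hmem.1, hmem.2.trans (Real.sigmoid_lt_one hi)⟩
    exact hin p₀ hp' ((logit_mem_Ioo_iff hp').2 hmem) σ (normalized_le s hp' hopt hle hσ)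
  · exact ⟨π, hπP, exists_executes_of_deadline_eq_zero (hπ p₀ hmem)
      ((hv.isOptimal_iff_of_notMem s hp hmem).1 hσ)⟩

end Solves

theorem ownPolicy_sigmoid (lo k hi a z : ℝ) :
    ownPolicy (Real.sigmoid lo) (Real.sigmoid k) (Real.sigmoid hi) a (Real.sigmoid z) =
      if z ≤ lo ∨ hi ≤ z then Decision.act
      else if z < k then Decision.learn 1
      else if z = k then Decision.learn a
      else Decision.learn 0 := by
  simp only [ownPolicy, Real.sigmoid_le_iff, Real.sigmoid_lt_iff, Real.sigmoid_inj]

theorem ownPolicy_of_notMem {lo k hi a p : ℝ} (hp : p ∉ Ioo lo hi) :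
    ownPolicy lo k hi a p = Decision.act := by
  refine if_pos ?_
  by_contra h
  rw [not_or, not_le, not_le] at h
  exact hp h

theorem not_eventually_lt_and_gt {f : ℝ → ℝ} {z : ℝ} (h : ∃ e > 0, ∀ t ∈ Ioo 0 e, f t < z)
    (h' : ∃ e > 0, ∀ t ∈ Ioo 0 e, z < f t) : False := by
  obtain ⟨e, he, h⟩ := h
  obtain ⟨e', he', h'⟩ := h'
  obtain ⟨t, h0, ht⟩ := exists_between (lt_min he he')
  exact (h t ⟨h0, ht.trans_le (min_le_left _ _)⟩).not_gt
    (h' t ⟨h0, ht.trans_le (min_le_right _ _)⟩)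

/-! ### Executions and optimality of own-biased learning. -/

section Own

variable {lam lo k hi a p₀ : ℝ}

theorem Executes.followsOwn (hlam : 0 < lam) (hp : p₀ ∈ Ioo (0 : ℝ) 1) (hlo : lo < k) (hhi : k < hi)
    (ha : a = 0 ∨ a = 1) {σ : Strategy lam p₀}
    (h : Executes (ownPolicy (Real.sigmoid lo) (Real.sigmoid k) (Real.sigmoid hi) a) σ) :
    FollowsOwn lam lo k hi (logit p₀) (control σ.att) σ.deadline := by
  have hmem : ∀ t ∈ before σ.deadline, path lam (logit p₀) (control σ.att) t ∈ Ioo lo hi := by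
    intro t ht
    have h1 := (h.1 t ht).1
    rw [σ.belief_eq_sigmoid hlam hp ht.1, ownPolicy_sigmoid] at h1
    by_contra hz
    rw [if_pos (by by_contra h; rw [not_or, not_le, not_le] at h; exact hz h)] at h1
    cases h1
  have hlearn : ∀ t ∈ before σ.deadline,
      (if σ.trajectory t < k then Decision.learn 1
      else if σ.trajectory t = k then Decision.learn a
      else Decision.learn 0) = Decision.learn (σ.att t) := fun t ht => by
    have h1 := (h.1 t ht).1
    rwa [σ.belief_eq_sigmoid hlam hp ht.1, ownPolicy_sigmoid, if_neg
      (by rw [not_or, not_le, not_le]; exact hmem t ht)] at h1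
  refine ⟨σ.isControl, hmem, fun hT hz => ?_, Eventually.of_forall fun t ht hz => ?_,
    Eventually.of_forall fun t ht hz => ?_, fun hk => ?_⟩
  · have h1 := h.2 hT
    rw [σ.belief_eq_sigmoid hlam hp ENNReal.toReal_nonneg, ownPolicy_sigmoid, if_neg
      (by rw [not_or, not_le, not_le]; exact hz)] at h1
    split_ifs at h1
  · have h1 := hlearn t ht
    rw [trajectory, if_pos hz] at h1
    injection h1 with h1
    simp only [control, ← h1]; norm_num
  · have h1 := hlearn t ht
    rw [trajectory, if_neg (not_lt.2 (le_of_lt hz)), if_neg (ne_of_gt hz)] at h1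
    injection h1 with h1
    simp only [control, ← h1]; norm_num
  · have hπ : ownPolicy (Real.sigmoid lo) (Real.sigmoid k) (Real.sigmoid hi) a p₀ =
        Decision.learn a := by
      rw [← sigmoid_logit hp, hk, ownPolicy_sigmoid]
      simp [hlo, hhi]
    have h1 := h.eventually_lt_or_gt hlam hp hπ
    rw [hk] at h1 ⊢
    rcases ha with rfl | rfl
    · obtain ⟨e, he, h2⟩ := h1.2 (by norm_num)
      rw [trajectory, hk] at h2
      exact ⟨e, he, Or.inr h2⟩
    · obtain ⟨e, he, h2⟩ := h1.1 (by norm_num)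
      rw [trajectory, hk] at h2
      exact ⟨e, he, Or.inl h2⟩

/-- Refines `FollowsOwn.movesTo`: for a start at the switch point the value `a` of the policy there
determines the direction, which makes the execution unique. -/
theorem Executes.own_cases (hlam : 0 < lam) (hp : p₀ ∈ Ioo (0 : ℝ) 1) (hlo : lo < k) (hhi : k < hi)
    (ha : a = 0 ∨ a = 1) (hz : logit p₀ ∈ Ioo lo hi) {σ : Strategy lam p₀}
    (h : Executes (ownPolicy (Real.sigmoid lo) (Real.sigmoid k) (Real.sigmoid hi) a) σ) :
    ((logit p₀ < k ∨ logit p₀ = k ∧ a = 1) ∧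
      MovesTo lam (logit p₀) (-1) lo (control σ.att) σ.deadline) ∨
    ((k < logit p₀ ∨ logit p₀ = k ∧ a = 0) ∧
      MovesTo lam (logit p₀) 1 hi (control σ.att) σ.deadline) := by
  have hf := h.followsOwn hlam hp hlo hhi ha
  have hπ : logit p₀ = k → ownPolicy (Real.sigmoid lo) (Real.sigmoid k) (Real.sigmoid hi) a p₀ =
      Decision.learn a := fun hk => by
    rw [← sigmoid_logit hp, hk, ownPolicy_sigmoid]
    simp [hlo, hhi]
  refine (hf.movesTo hlam hlo hhi hz).imp (And.imp_left ?_) (And.imp_left ?_)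
  · refine Or.imp_right fun h1 => ⟨h1.1, ha.resolve_left ?_⟩
    rintro rfl
    have h2 := (h.eventually_lt_or_gt hlam hp (hπ h1.1)).2 (by norm_num)
    rw [h1.1] at h2
    exact not_eventually_lt_and_gt (h1.1 ▸ h1.2) (h1.1 ▸ h2)
  · refine Or.imp_right fun h1 => ⟨h1.1, ha.resolve_right ?_⟩
    rintro rfl
    have h2 := (h.eventually_lt_or_gt hlam hp (hπ h1.1)).1 (by norm_num)
    rw [h1.1] at h2
    exact not_eventually_lt_and_gt (h1.1 ▸ h2) (h1.1 ▸ h1.2)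

theorem exists_executes_own_down (hlam : 0 < lam) (hp : p₀ ∈ Ioo (0 : ℝ) 1) (hhi : k < hi)
    (hz : logit p₀ ∈ Ioo lo hi) (h : logit p₀ < k ∨ logit p₀ = k ∧ a = 1) :
    ∃ σ : Strategy lam p₀,
      Executes (ownPolicy (Real.sigmoid lo) (Real.sigmoid k) (Real.sigmoid hi) a) σ ∧
      MovesTo lam (logit p₀) (-1) lo (control σ.att) σ.deadline := by
  have hk : logit p₀ ≤ k := by
    rcases h with h | h
    · exact h.le
    · exact h.1.le
  have hlearn : ∀ t ∈ Ico 0 ((lo - logit p₀) / (lam * -1)), ownPolicy (Real.sigmoid lo) (Real.sigmoid k)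
      (Real.sigmoid hi) a (Real.sigmoid (logit p₀ + lam * (1 - 2 * 1) * t)) =
        Decision.learn 1 := by
    intro t ht
    have h4 := ht.2
    rw [lt_div_iff_of_neg (by linarith)] at h4
    have h5 := mul_nonneg hlam.le ht.1
    rw [ownPolicy_sigmoid, if_neg (by rw [not_or, not_le, not_le]; constructor <;> linarith)]
    -- Only at time 0 can the position be the switch point itself, where `a` is used.
    rcases ht.1.eq_or_lt with h0 | h0
    · rw [← h0]
      rcases h with h | ⟨h, rfl⟩
      · rw [if_pos (by linarith)]
      · rw [if_neg (by linarith), if_pos (by linarith)]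
    · rw [if_pos (by nlinarith)]
  have hact : ownPolicy (Real.sigmoid lo) (Real.sigmoid k) (Real.sigmoid hi) a
      (Real.sigmoid (logit p₀ + lam * (1 - 2 * 1) * ((lo - logit p₀) / (lam * -1)))) = Decision.act := by
    rw [ownPolicy_sigmoid, if_pos (Or.inl (le_of_eq _))]
    field_simp
    ring
  obtain ⟨σ, h1, h2, h3⟩ := exists_executes_moving hlam hp (by norm_num) (div_nonneg_of_nonpos (by linarith [hz.1]) (by linarith)) hlearn hact
  exact ⟨σ, h1, h2, Eventually.of_forall fun t _ => by simp only [control, h3]; norm_num⟩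

theorem exists_executes_own_up (hlam : 0 < lam) (hp : p₀ ∈ Ioo (0 : ℝ) 1) (hlo : lo < k)
    (hz : logit p₀ ∈ Ioo lo hi) (h : k < logit p₀ ∨ logit p₀ = k ∧ a = 0) :
    ∃ σ : Strategy lam p₀,
      Executes (ownPolicy (Real.sigmoid lo) (Real.sigmoid k) (Real.sigmoid hi) a) σ ∧
      MovesTo lam (logit p₀) 1 hi (control σ.att) σ.deadline := by
  have hk : k ≤ logit p₀ := by
    rcases h with h | h
    · exact h.le
    · exact h.1.ge
  have hlearn : ∀ t ∈ Ico 0 ((hi - logit p₀) / (lam * 1)), ownPolicy (Real.sigmoid lo) (Real.sigmoid k)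
      (Real.sigmoid hi) a (Real.sigmoid (logit p₀ + lam * (1 - 2 * 0) * t)) =
        Decision.learn 0 := by
    intro t ht
    have h4 := ht.2
    rw [lt_div_iff₀ (by linarith)] at h4
    have h5 := mul_nonneg hlam.le ht.1
    rw [ownPolicy_sigmoid, if_neg (by rw [not_or, not_le, not_le]; constructor <;> linarith),
      if_neg (by linarith)]
    rcases ht.1.eq_or_lt with h0 | h0
    · rw [← h0]
      rcases h with h | ⟨h, rfl⟩
      · rw [if_neg (by linarith)]
      · rw [if_pos (by linarith)]
    · rw [if_neg (by nlinarith)]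
  have hact : ownPolicy (Real.sigmoid lo) (Real.sigmoid k) (Real.sigmoid hi) a
      (Real.sigmoid (logit p₀ + lam * (1 - 2 * 0) * ((hi - logit p₀) / (lam * 1)))) = Decision.act := by
    rw [ownPolicy_sigmoid, if_pos (Or.inr (le_of_eq _))]
    field_simp
    ring
  obtain ⟨σ, h1, h2, h3⟩ := exists_executes_moving hlam hp (by norm_num) (div_nonneg (by linarith [hz.2]) (by linarith)) hlearn hact
  exact ⟨σ, h1, h2, Eventually.of_forall fun t _ => by simp only [control, h3]; norm_num⟩

end Own

section OwnValue

variable {u : Payoffs} {lam rho c lo k hi q a p₀ : ℝ} {φ : ℝ → ℝ}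

theorem isOptimalPolicy_ownPolicy (s : Standing u lam rho c)
    (hv : IsOwnValue lam (rho + lam / 2) (flow (rho * u.rR + c) (rho * u.lL + c))
      (stopLoss (u.rR - u.lR) (u.lL - u.rL)) lo k hi q φ) (ha : a = 0 ∨ a = 1) :
    IsOptimalPolicy u lam rho c
      (ownPolicy (Real.sigmoid lo) (Real.sigmoid k) (Real.sigmoid hi) a) := by
  have hlam := s.lam_pos
  refine Solves.isOptimalPolicy (φ := φ) hv.toIsValue s (fun p hp => ownPolicy_of_notMem hp)
    (fun p₀ hp hz => ?_)
    (fun p₀ hp σ hσ => hv.regret_le (hσ.followsOwn hlam hp hv.lo_lt hv.lt_hi ha))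
  by_cases hd : logit p₀ < k ∨ logit p₀ = k ∧ a = 1
  · obtain ⟨σ, h1, h2⟩ := exists_executes_own_down hlam hp hv.lt_hi hz hd
    refine ⟨σ, h1, fun τ hτ => same_of_control ?_⟩
    rcases hτ.own_cases hlam hp hv.lo_lt hv.lt_hi ha hz with ⟨-, h3⟩ | ⟨h3, -⟩
    · exact h3.unique h2
    · exfalso
      rcases hd with hd | ⟨hk, rfl⟩
      · rcases h3 with h3 | h3 <;> linarith
      · rcases h3 with h3 | ⟨-, h3⟩
        · exact h3.ne' hk
        · norm_num at h3
  · have hu : k < logit p₀ ∨ logit p₀ = k ∧ a = 0 := by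
      rw [not_or, not_and, not_lt] at hd
      rcases hd.1.eq_or_lt with h | h
      · exact Or.inr ⟨h.symm, ha.resolve_right (hd.2 h.symm)⟩
      · exact Or.inl h
    obtain ⟨σ, h1, h2⟩ := exists_executes_own_up hlam hp hv.lo_lt hz hu
    refine ⟨σ, h1, fun τ hτ => same_of_control ?_⟩
    rcases hτ.own_cases hlam hp hv.lo_lt hv.lt_hi ha hz with ⟨h3, -⟩ | ⟨-, h3⟩
    · exact absurd h3 hd
    · exact h3.unique h2

/-- An optimal path starting at the switch point may leave it in either direction; the downward one
executes the policy with `a = 1`, the upward one that with `a = 0`. -/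
theorem optimaComeFrom_ownPolicy (s : Standing u lam rho c)
    (hv : IsOwnValue lam (rho + lam / 2) (flow (rho * u.rR + c) (rho * u.lL + c))
      (stopLoss (u.rR - u.lR) (u.lL - u.rL)) lo k hi q φ)
    (hlt : ∀ z ∈ Icc lo hi, (rho + lam / 2) * φ z < flow (rho * u.rR + c) (rho * u.lL + c) z) :
    OptimaComeFrom u lam rho c {π | ∃ a ∈ ({0, 1} : Set ℝ),
      π = ownPolicy (Real.sigmoid lo) (Real.sigmoid k) (Real.sigmoid hi) a} := by
  have hlam := s.lam_pos
  refine Solves.optimaComeFrom (φ := φ) hv.toIsValue s ⟨0, by simp, rfl⟩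
    (fun p hp => ownPolicy_of_notMem hp) (isOptimalPolicy_ownPolicy s hv (Or.inl rfl))
    (fun p₀ hp σ hσ => hv.regret_le (hσ.followsOwn hlam hp hv.lo_lt hv.lt_hi (Or.inl rfl)))
    fun p₀ hp hz σ hσ => ?_
  rcases (hv.followsOwn hlt σ.isControl hz hσ).movesTo hlam hv.lo_lt hv.lt_hi hz with
    ⟨h1, h2⟩ | ⟨h1, h2⟩
  · obtain ⟨τ, h3, h4⟩ := exists_executes_own_down (a := 1) hlam hp hv.lt_hi hz
      (h1.imp_right fun h => ⟨h.1, rfl⟩)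
    exact ⟨_, ⟨1, by simp, rfl⟩, τ, h3, same_of_control (h2.unique h4)⟩
  · obtain ⟨τ, h3, h4⟩ := exists_executes_own_up (a := 0) hlam hp hv.lo_lt hz
      (h1.imp_right fun h => ⟨h.1, rfl⟩)
    exact ⟨_, ⟨0, by simp, rfl⟩, τ, h3, same_of_control (h2.unique h4)⟩

theorem followsOff_ownPolicy (s : Standing u lam rho c)
    (hv : IsOwnValue lam (rho + lam / 2) (flow (rho * u.rR + c) (rho * u.lL + c))
      (stopLoss (u.rR - u.lR) (u.lL - u.rL)) lo k hi q φ) (hp : p₀ ∈ Icc (0 : ℝ) 1)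
    {σ : Strategy lam p₀} (hσ : σ.IsOptimal u rho c) (a : ℝ) :
    FollowsOff (Real.sigmoid q)
      (ownPolicy (Real.sigmoid lo) (Real.sigmoid k) (Real.sigmoid hi) a) σ := by
  have hlam := s.lam_pos
  by_cases hmem : p₀ ∈ Ioo (Real.sigmoid lo) (Real.sigmoid hi)
  swap
  · have h0 := (Solves.isOptimal_iff_of_notMem (φ := φ) hv.toIsValue s hp hmem).1 hσ
    exact ⟨Eventually.of_forall fun t ht => absurd ht.2 (by simp [h0]),
      (executes_of_deadline_eq_zero (ownPolicy_of_notMem hmem) h0).2⟩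
  have hp' : p₀ ∈ Ioo (0 : ℝ) 1 :=
    ⟨(Real.sigmoid_pos lo).trans hmem.1, hmem.2.trans (Real.sigmoid_lt_one hi)⟩
  have hle := Solves.normalized_le (φ := φ) s hp' (isOptimalPolicy_ownPolicy s hv (Or.inl rfl))
    (fun p₀ hp σ hσ => hv.regret_le (hσ.followsOwn hlam hp hv.lo_lt hv.lt_hi (Or.inl rfl))) hσ
  refine ⟨?_, fun hT => ?_⟩
  · filter_upwards [hv.ae_off σ.isControl hle, ae_ne_real 0] with t h1 h0 ht hq
    have hm := hv.path_mem σ.isControl hle ht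
    rw [σ.belief_eq_sigmoid hlam hp' ht.1] at hq ⊢
    have hlt := hv.lt_flow _ (Ioo_subset_Icc_self hm) fun h => hq (congrArg _ h)
    have h2 := h1 ht hlt
    -- The switch is a local maximum of the value, and off `q` the strict inequality holds, so it
    -- cannot be visited at a positive time. Hence the prescription at the switch point is
    -- irrelevant.
    have hne : σ.trajectory t ≠ k := fun hk => by
      refine path_ne_of_isLocalMax hv.continuous_flow hlam σ.isControl
        (hv.total_eq σ.isControl hle) ?_ hv.isLocalMax ht (lt_of_le_of_ne ht.1 h0.symm) hk
      rw [trajectory] at hk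
      rwa [hk] at hlt
    rw [ownPolicy_sigmoid, if_neg (by rw [not_or, not_le, not_le]; exact hm)]
    rcases hne.lt_or_gt with h | h
    · have h3 := h2.1 h
      rw [if_pos h]
      simp only [control] at h3
      congr 1
      linarith
    · have h3 := h2.2 h
      rw [if_neg (not_lt.2 (le_of_lt h)), if_neg hne]
      simp only [control] at h3
      congr 1
      linarith
  · rw [σ.belief_eq_sigmoid hlam hp' ENNReal.toReal_nonneg]
    refine ownPolicy_of_notMem fun h => hv.end_notMem σ.isControl hle hT ?_
    exact ⟨Real.sigmoid_lt_iff.1 h.1, Real.sigmoid_lt_iff.1 h.2⟩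

end OwnValue

/-! ### Executions and optimality of mixed learning. -/

theorem mixedPolicy_sigmoid (lo kl q kr hi a b z : ℝ) :
    mixedPolicy (Real.sigmoid lo) (Real.sigmoid kl) (Real.sigmoid q) (Real.sigmoid kr)
      (Real.sigmoid hi) a b (Real.sigmoid z) =
      if z ≤ lo ∨ hi ≤ z then Decision.act
      else if z < kl then Decision.learn 1
      else if z = kl then Decision.learn a
      else if z < q then Decision.learn 0
      else if z = q then Decision.learn (1 / 2)
      else if z < kr then Decision.learn 1
      else if z = kr then Decision.learn b
      else Decision.learn 0 := by
  simp only [mixedPolicy, Real.sigmoid_le_iff, Real.sigmoid_lt_iff, Real.sigmoid_inj]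

theorem mixedPolicy_of_notMem {lo kl q kr hi a b p : ℝ} (hp : p ∉ Ioo lo hi) :
    mixedPolicy lo kl q kr hi a b p = Decision.act := by
  refine if_pos ?_
  by_contra h
  rw [not_or, not_le, not_le] at h
  exact hp h

section Mixed

variable {lam lo kl q kr hi a b p₀ : ℝ}

theorem Executes.followsMixed (hlam : 0 < lam) (hp : p₀ ∈ Ioo (0 : ℝ) 1) (hlo : lo < kl)
    (hkl : kl < q) (hkr : q < kr) (hhi : kr < hi) (ha : a = 0 ∨ a = 1) (hb : b = 0 ∨ b = 1)
    {σ : Strategy lam p₀}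
    (h : Executes (mixedPolicy (Real.sigmoid lo) (Real.sigmoid kl) (Real.sigmoid q)
      (Real.sigmoid kr) (Real.sigmoid hi) a b) σ) :
    FollowsMixed lam lo kl q kr hi (logit p₀) (control σ.att) σ.deadline := by
  have hlearn : ∀ t ∈ before σ.deadline, (if σ.trajectory t ≤ lo ∨ hi ≤ σ.trajectory t then
        Decision.act
      else if σ.trajectory t < kl then Decision.learn 1
      else if σ.trajectory t = kl then Decision.learn a
      else if σ.trajectory t < q then Decision.learn 0
      else if σ.trajectory t = q then Decision.learn (1 / 2)
      else if σ.trajectory t < kr then Decision.learn 1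
      else if σ.trajectory t = kr then Decision.learn b
      else Decision.learn 0) = Decision.learn (σ.att t) := fun t ht => by
    have h1 := (h.1 t ht).1
    rwa [σ.belief_eq_sigmoid hlam hp ht.1, mixedPolicy_sigmoid] at h1
  have hmem : ∀ t ∈ before σ.deadline, σ.trajectory t ∈ Ioo lo hi := by
    intro t ht
    have h1 := hlearn t ht
    by_contra hz
    rw [if_pos (by by_contra h; rw [not_or, not_le, not_le] at h; exact hz h)] at h1
    cases h1
  have hatt : ∀ t ∈ before σ.deadline,
      (σ.trajectory t < kl → control σ.att t = -1) ∧ (kr < σ.trajectory t → control σ.att t = 1) ∧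
      (kl < σ.trajectory t → σ.trajectory t < q → control σ.att t = 1) ∧
      (q < σ.trajectory t → σ.trajectory t < kr → control σ.att t = -1) := by
    intro t ht
    have h1 := hlearn t ht
    rw [if_neg (by rw [not_or, not_le, not_le]; exact hmem t ht)] at h1
    have h2 : ∀ {α : ℝ}, Decision.learn α = Decision.learn (σ.att t) →
        control σ.att t = 1 - 2 * α := fun h => by
      injection h with h
      rw [control, h]
    refine ⟨fun hz => ?_, fun hz => ?_, fun hz hz' => ?_, fun hz hz' => ?_⟩
    · rw [if_pos hz] at h1
      rw [h2 h1]; norm_num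
    · rw [if_neg (by linarith), if_neg (by linarith), if_neg (by linarith), if_neg (by linarith),
        if_neg (by linarith), if_neg (by linarith)] at h1
      rw [h2 h1]; norm_num
    · rw [if_neg (by linarith), if_neg (by linarith), if_pos hz'] at h1
      rw [h2 h1]; norm_num
    · rw [if_neg (by linarith), if_neg (by linarith), if_neg (by linarith), if_neg (by linarith),
        if_pos hz'] at h1
      rw [h2 h1]; norm_num
  have hdir : ∀ α : ℝ, α = 0 ∨ α = 1 →
      mixedPolicy (Real.sigmoid lo) (Real.sigmoid kl) (Real.sigmoid q) (Real.sigmoid kr)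
        (Real.sigmoid hi) a b p₀ = Decision.learn α →
      ∃ e > 0, (∀ t ∈ Ioo 0 e, σ.trajectory t < logit p₀) ∨
        ∀ t ∈ Ioo 0 e, logit p₀ < σ.trajectory t := by
    intro α hα hπ
    have h1 := h.eventually_lt_or_gt hlam hp hπ
    rcases hα with rfl | rfl
    · obtain ⟨e, he, h2⟩ := h1.2 (by norm_num)
      exact ⟨e, he, Or.inr h2⟩
    · obtain ⟨e, he, h2⟩ := h1.1 (by norm_num)
      exact ⟨e, he, Or.inl h2⟩
  refine ⟨σ.isControl, hmem, fun hT hz => ?_, Eventually.of_forall fun t ht => (hatt t ht).1,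
    Eventually.of_forall fun t ht => (hatt t ht).2.1,
    Eventually.of_forall fun t ht => (hatt t ht).2.2.1,
    Eventually.of_forall fun t ht => (hatt t ht).2.2.2, fun hk => ?_, fun hk => ?_⟩
  · have h1 := h.2 hT
    rw [σ.belief_eq_sigmoid hlam hp ENNReal.toReal_nonneg, mixedPolicy_sigmoid, if_neg
      (by rw [not_or, not_le, not_le]; exact hz)] at h1
    split_ifs at h1
  · have h1 := hdir a ha (by
      rw [← sigmoid_logit hp, hk, mixedPolicy_sigmoid,
        if_neg (by rw [not_or, not_le, not_le]; constructor <;> linarith), if_neg (lt_irrefl _),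
        if_pos rfl])
    rw [trajectory, hk] at h1
    rwa [hk]
  · have h1 := hdir b hb (by
      rw [← sigmoid_logit hp, hk, mixedPolicy_sigmoid,
        if_neg (by rw [not_or, not_le, not_le]; constructor <;> linarith), if_neg (by linarith),
        if_neg (by linarith), if_neg (by linarith), if_neg (by linarith), if_neg (lt_irrefl _),
        if_pos rfl])
    rw [trajectory, hk] at h1
    rwa [hk]

theorem Executes.mixed_cases (hlam : 0 < lam) (hp : p₀ ∈ Ioo (0 : ℝ) 1) (hlo : lo < kl)
    (hkl : kl < q) (hkr : q < kr) (hhi : kr < hi) (ha : a = 0 ∨ a = 1) (hb : b = 0 ∨ b = 1)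
    (hz : logit p₀ ∈ Ioo lo hi) {σ : Strategy lam p₀}
    (h : Executes (mixedPolicy (Real.sigmoid lo) (Real.sigmoid kl) (Real.sigmoid q)
      (Real.sigmoid kr) (Real.sigmoid hi) a b) σ) :
    ((logit p₀ < kl ∨ logit p₀ = kl ∧ a = 1) ∧
      MovesTo lam (logit p₀) (-1) lo (control σ.att) σ.deadline) ∨
    ((kl < logit p₀ ∧ logit p₀ ≤ q ∨ logit p₀ = kl ∧ a = 0) ∧
      WaitsAt lam (logit p₀) 1 q (control σ.att) σ.deadline) ∨
    ((q < logit p₀ ∧ logit p₀ < kr ∨ logit p₀ = kr ∧ b = 1) ∧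
      WaitsAt lam (logit p₀) (-1) q (control σ.att) σ.deadline) ∨
    ((kr < logit p₀ ∨ logit p₀ = kr ∧ b = 0) ∧
      MovesTo lam (logit p₀) 1 hi (control σ.att) σ.deadline) := by
  have hf := h.followsMixed hlam hp hlo hkl hkr hhi ha hb
  have hπl : logit p₀ = kl → mixedPolicy (Real.sigmoid lo) (Real.sigmoid kl) (Real.sigmoid q)
      (Real.sigmoid kr) (Real.sigmoid hi) a b p₀ = Decision.learn a := fun hk => by
    rw [← sigmoid_logit hp, hk, mixedPolicy_sigmoid,
      if_neg (by rw [not_or, not_le, not_le]; constructor <;> linarith), if_neg (lt_irrefl _),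
      if_pos rfl]
  have hπr : logit p₀ = kr → mixedPolicy (Real.sigmoid lo) (Real.sigmoid kl) (Real.sigmoid q)
      (Real.sigmoid kr) (Real.sigmoid hi) a b p₀ = Decision.learn b := fun hk => by
    rw [← sigmoid_logit hp, hk, mixedPolicy_sigmoid,
      if_neg (by rw [not_or, not_le, not_le]; constructor <;> linarith), if_neg (by linarith),
      if_neg (by linarith), if_neg (by linarith), if_neg (by linarith), if_neg (lt_irrefl _),
      if_pos rfl]
  have hup : ∀ {α k : ℝ}, logit p₀ = k → α = 0 ∨ α = 1 →
      mixedPolicy (Real.sigmoid lo) (Real.sigmoid kl) (Real.sigmoid q)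
        (Real.sigmoid kr) (Real.sigmoid hi) a b p₀ = Decision.learn α →
      (∃ e > 0, ∀ t ∈ Ioo 0 e, k < path lam (logit p₀) (control σ.att) t) → α = 0 := by
    rintro α _ rfl hα hπ h1
    refine hα.resolve_right ?_
    rintro rfl
    exact not_eventually_lt_and_gt ((h.eventually_lt_or_gt hlam hp hπ).1 (by norm_num)) h1
  have hdn : ∀ {α k : ℝ}, logit p₀ = k → α = 0 ∨ α = 1 →
      mixedPolicy (Real.sigmoid lo) (Real.sigmoid kl) (Real.sigmoid q)
        (Real.sigmoid kr) (Real.sigmoid hi) a b p₀ = Decision.learn α →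
      (∃ e > 0, ∀ t ∈ Ioo 0 e, path lam (logit p₀) (control σ.att) t < k) → α = 1 := by
    rintro α _ rfl hα hπ h1
    refine hα.resolve_left ?_
    rintro rfl
    exact not_eventually_lt_and_gt h1 ((h.eventually_lt_or_gt hlam hp hπ).2 (by norm_num))
  refine (hf.cases hlam hlo hkl hkr hhi hz).imp (And.imp_left ?_) (Or.imp (And.imp_left ?_)
    (Or.imp (And.imp_left ?_) (And.imp_left ?_)))
  · exact Or.imp_right fun h1 => ⟨h1.1, hdn h1.1 ha (hπl h1.1) h1.2⟩
  · exact Or.imp_right fun h1 => ⟨h1.1, hup h1.1 ha (hπl h1.1) h1.2⟩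
  · exact Or.imp_right fun h1 => ⟨h1.1, hdn h1.1 hb (hπr h1.1) h1.2⟩
  · exact Or.imp_right fun h1 => ⟨h1.1, hup h1.1 hb (hπr h1.1) h1.2⟩

theorem exists_executes_mixed_down (hlam : 0 < lam) (hp : p₀ ∈ Ioo (0 : ℝ) 1) (hkl : kl < hi)
    (hz : logit p₀ ∈ Ioo lo hi) (h : logit p₀ < kl ∨ logit p₀ = kl ∧ a = 1) :
    ∃ σ : Strategy lam p₀, Executes (mixedPolicy (Real.sigmoid lo) (Real.sigmoid kl)
        (Real.sigmoid q) (Real.sigmoid kr) (Real.sigmoid hi) a b) σ ∧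
      MovesTo lam (logit p₀) (-1) lo (control σ.att) σ.deadline := by
  have hk : logit p₀ ≤ kl := by
    rcases h with h | h
    · exact h.le
    · exact h.1.le
  have hlearn : ∀ t ∈ Ico 0 ((lo - logit p₀) / (lam * -1)), mixedPolicy (Real.sigmoid lo)
      (Real.sigmoid kl) (Real.sigmoid q) (Real.sigmoid kr) (Real.sigmoid hi) a b
      (Real.sigmoid (logit p₀ + lam * (1 - 2 * 1) * t)) = Decision.learn 1 := by
    intro t ht
    have h4 := ht.2
    rw [lt_div_iff_of_neg (by linarith)] at h4
    have h5 := mul_nonneg hlam.le ht.1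
    rw [mixedPolicy_sigmoid, if_neg (by rw [not_or, not_le, not_le]; constructor <;> linarith)]
    rcases ht.1.eq_or_lt with h0 | h0
    · rw [← h0]
      rcases h with h | ⟨h, rfl⟩
      · rw [if_pos (by linarith)]
      · rw [if_neg (by linarith), if_pos (by linarith)]
    · rw [if_pos (by nlinarith)]
  have hact : mixedPolicy (Real.sigmoid lo) (Real.sigmoid kl) (Real.sigmoid q) (Real.sigmoid kr)
      (Real.sigmoid hi) a b
      (Real.sigmoid (logit p₀ + lam * (1 - 2 * 1) * ((lo - logit p₀) / (lam * -1)))) =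
        Decision.act := by
    rw [mixedPolicy_sigmoid, if_pos (Or.inl (le_of_eq _))]
    field_simp
    ring
  obtain ⟨σ, h1, h2, h3⟩ := exists_executes_moving hlam hp (by norm_num)
    (div_nonneg_of_nonpos (by linarith [hz.1]) (by linarith)) hlearn hact
  exact ⟨σ, h1, h2, Eventually.of_forall fun t _ => by simp only [control, h3]; norm_num⟩

theorem exists_executes_mixed_up (hlam : 0 < lam) (hp : p₀ ∈ Ioo (0 : ℝ) 1) (hlo : lo < kl)
    (hkl : kl < q) (hkr : q < kr)
    (hz : logit p₀ ∈ Ioo lo hi) (h : kr < logit p₀ ∨ logit p₀ = kr ∧ b = 0) :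
    ∃ σ : Strategy lam p₀, Executes (mixedPolicy (Real.sigmoid lo) (Real.sigmoid kl)
        (Real.sigmoid q) (Real.sigmoid kr) (Real.sigmoid hi) a b) σ ∧
      MovesTo lam (logit p₀) 1 hi (control σ.att) σ.deadline := by
  have hk : kr ≤ logit p₀ := by
    rcases h with h | h
    · exact h.le
    · exact h.1.ge
  have hlearn : ∀ t ∈ Ico 0 ((hi - logit p₀) / (lam * 1)), mixedPolicy (Real.sigmoid lo)
      (Real.sigmoid kl) (Real.sigmoid q) (Real.sigmoid kr) (Real.sigmoid hi) a b
      (Real.sigmoid (logit p₀ + lam * (1 - 2 * 0) * t)) = Decision.learn 0 := by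
    intro t ht
    have h4 := ht.2
    rw [lt_div_iff₀ (by linarith)] at h4
    have h5 := mul_nonneg hlam.le ht.1
    rw [mixedPolicy_sigmoid, if_neg (by rw [not_or, not_le, not_le]; constructor <;> linarith),
      if_neg (by linarith), if_neg (by linarith), if_neg (by linarith), if_neg (by linarith),
      if_neg (by linarith)]
    rcases ht.1.eq_or_lt with h0 | h0
    · rw [← h0]
      rcases h with h | ⟨h, rfl⟩
      · rw [if_neg (by linarith)]
      · rw [if_pos (by linarith)]
    · rw [if_neg (by nlinarith)]
  have hact : mixedPolicy (Real.sigmoid lo) (Real.sigmoid kl) (Real.sigmoid q) (Real.sigmoid kr)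
      (Real.sigmoid hi) a b
      (Real.sigmoid (logit p₀ + lam * (1 - 2 * 0) * ((hi - logit p₀) / (lam * 1)))) =
        Decision.act := by
    rw [mixedPolicy_sigmoid, if_pos (Or.inr (le_of_eq _))]
    field_simp
    ring
  obtain ⟨σ, h1, h2, h3⟩ := exists_executes_moving hlam hp (by norm_num)
    (div_nonneg (by linarith [hz.2]) (by linarith)) hlearn hact
  exact ⟨σ, h1, h2, Eventually.of_forall fun t _ => by simp only [control, h3]; norm_num⟩

theorem mixedPolicy_reference (hlo : lo < kl) (hkl : kl < q) (hkr : q < kr) (hhi : kr < hi) :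
    mixedPolicy (Real.sigmoid lo) (Real.sigmoid kl) (Real.sigmoid q) (Real.sigmoid kr)
      (Real.sigmoid hi) a b (Real.sigmoid q) = Decision.learn (1 / 2) := by
  rw [mixedPolicy_sigmoid, if_neg (by rw [not_or, not_le, not_le]; constructor <;> linarith),
    if_neg (by linarith), if_neg (by linarith), if_neg (lt_irrefl _), if_pos rfl]

theorem exists_executes_mixed_right (hlam : 0 < lam) (hp : p₀ ∈ Ioo (0 : ℝ) 1) (hlo : lo < kl)
    (hkl : kl < q) (hkr : q < kr) (hhi : kr < hi)
    (h : kl < logit p₀ ∧ logit p₀ ≤ q ∨ logit p₀ = kl ∧ a = 0) :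
    ∃ σ : Strategy lam p₀, Executes (mixedPolicy (Real.sigmoid lo) (Real.sigmoid kl)
        (Real.sigmoid q) (Real.sigmoid kr) (Real.sigmoid hi) a b) σ ∧
      WaitsAt lam (logit p₀) 1 q (control σ.att) σ.deadline := by
  have hk : kl ≤ logit p₀ ∧ logit p₀ ≤ q := by
    rcases h with h | h
    · exact ⟨h.1.le, h.2⟩
    · exact ⟨h.1.ge, by linarith⟩
  have hlearn : ∀ t ∈ Ico 0 ((q - logit p₀) / (lam * 1)), mixedPolicy (Real.sigmoid lo)
      (Real.sigmoid kl) (Real.sigmoid q) (Real.sigmoid kr) (Real.sigmoid hi) a b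
      (Real.sigmoid (logit p₀ + lam * (1 - 2 * 0) * t)) = Decision.learn 0 := by
    intro t ht
    have h4 := ht.2
    rw [lt_div_iff₀ (by linarith)] at h4
    have h5 := mul_nonneg hlam.le ht.1
    rw [mixedPolicy_sigmoid, if_neg (by rw [not_or, not_le, not_le]; constructor <;> linarith),
      if_neg (by linarith)]
    rcases ht.1.eq_or_lt with h0 | h0
    · rw [← h0] at h4 ⊢
      rcases h with h | ⟨h, rfl⟩
      · rw [if_neg (by linarith), if_pos (by linarith)]
      · rw [if_pos (by linarith)]
    · rw [if_neg (by nlinarith), if_pos (by linarith)]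
  have hwait : mixedPolicy (Real.sigmoid lo) (Real.sigmoid kl) (Real.sigmoid q) (Real.sigmoid kr)
      (Real.sigmoid hi) a b
      (Real.sigmoid (logit p₀ + lam * (1 - 2 * 0) * ((q - logit p₀) / (lam * 1)))) =
        Decision.learn (1 / 2) := by
    rw [show logit p₀ + lam * (1 - 2 * 0) * ((q - logit p₀) / (lam * 1)) = q by field_simp; ring]
    exact mixedPolicy_reference hlo hkl hkr hhi
  obtain ⟨σ, h1, h2, h3⟩ := exists_executes_waiting hlam hp (by norm_num)
    (div_nonneg (by linarith) (by linarith)) hlearn hwait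
  refine ⟨σ, h1, h2, Eventually.of_forall fun t _ => ?_⟩
  simp only [control, h3]
  split_ifs <;> norm_num

theorem exists_executes_mixed_left (hlam : 0 < lam) (hp : p₀ ∈ Ioo (0 : ℝ) 1) (hlo : lo < kl)
    (hkl : kl < q) (hkr : q < kr) (hhi : kr < hi)
    (h : q < logit p₀ ∧ logit p₀ < kr ∨ logit p₀ = kr ∧ b = 1) :
    ∃ σ : Strategy lam p₀, Executes (mixedPolicy (Real.sigmoid lo) (Real.sigmoid kl)
        (Real.sigmoid q) (Real.sigmoid kr) (Real.sigmoid hi) a b) σ ∧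
      WaitsAt lam (logit p₀) (-1) q (control σ.att) σ.deadline := by
  have hk : q < logit p₀ ∧ logit p₀ ≤ kr := by
    rcases h with h | h
    · exact ⟨h.1, h.2.le⟩
    · exact ⟨by linarith, h.1.le⟩
  have hlearn : ∀ t ∈ Ico 0 ((q - logit p₀) / (lam * -1)), mixedPolicy (Real.sigmoid lo)
      (Real.sigmoid kl) (Real.sigmoid q) (Real.sigmoid kr) (Real.sigmoid hi) a b
      (Real.sigmoid (logit p₀ + lam * (1 - 2 * 1) * t)) = Decision.learn 1 := by
    intro t ht
    have h4 := ht.2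
    rw [lt_div_iff_of_neg (by linarith)] at h4
    have h5 := mul_nonneg hlam.le ht.1
    rw [mixedPolicy_sigmoid, if_neg (by rw [not_or, not_le, not_le]; constructor <;> linarith),
      if_neg (by linarith), if_neg (by linarith), if_neg (by linarith), if_neg (by linarith)]
    rcases ht.1.eq_or_lt with h0 | h0
    · rw [← h0] at h4 ⊢
      rcases h with h | ⟨h, rfl⟩
      · rw [if_pos (by linarith)]
      · rw [if_neg (by linarith), if_pos (by linarith)]
    · rw [if_pos (by nlinarith)]
  have hwait : mixedPolicy (Real.sigmoid lo) (Real.sigmoid kl) (Real.sigmoid q) (Real.sigmoid kr)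
      (Real.sigmoid hi) a b
      (Real.sigmoid (logit p₀ + lam * (1 - 2 * 1) * ((q - logit p₀) / (lam * -1)))) =
        Decision.learn (1 / 2) := by
    rw [show logit p₀ + lam * (1 - 2 * 1) * ((q - logit p₀) / (lam * -1)) = q by field_simp; ring]
    exact mixedPolicy_reference hlo hkl hkr hhi
  obtain ⟨σ, h1, h2, h3⟩ := exists_executes_waiting hlam hp (by norm_num)
    (div_nonneg_of_nonpos (by linarith) (by linarith)) hlearn hwait
  refine ⟨σ, h1, h2, Eventually.of_forall fun t _ => ?_⟩
  simp only [control, h3]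
  split_ifs <;> norm_num

end Mixed

section MixedValue

variable {u : Payoffs} {lam rho c lo kl q kr hi a b p₀ : ℝ} {φ : ℝ → ℝ}

theorem isOptimalPolicy_mixedPolicy (s : Standing u lam rho c)
    (hv : IsMixedValue lam (rho + lam / 2) (flow (rho * u.rR + c) (rho * u.lL + c))
      (stopLoss (u.rR - u.lR) (u.lL - u.rL)) lo kl q kr hi φ) (ha : a = 0 ∨ a = 1)
    (hb : b = 0 ∨ b = 1) :
    IsOptimalPolicy u lam rho c (mixedPolicy (Real.sigmoid lo) (Real.sigmoid kl) (Real.sigmoid q)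
      (Real.sigmoid kr) (Real.sigmoid hi) a b) := by
  have hlam := s.lam_pos
  have hlo := hv.lo_lt
  have hkl := hv.kl_lt
  have hkr := hv.lt_kr
  have hhi := hv.lt_hi
  refine Solves.isOptimalPolicy (φ := φ) hv.toIsValue s (fun p hp => mixedPolicy_of_notMem hp)
    (fun p₀ hp hz => ?_)
    (fun p₀ hp σ hσ => hv.regret_le (hσ.followsMixed hlam hp hlo hkl hkr hhi ha hb))
  have hstart : (logit p₀ < kl ∨ logit p₀ = kl ∧ a = 1) ∨
      (kl < logit p₀ ∧ logit p₀ ≤ q ∨ logit p₀ = kl ∧ a = 0) ∨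
      (q < logit p₀ ∧ logit p₀ < kr ∨ logit p₀ = kr ∧ b = 1) ∨
      (kr < logit p₀ ∨ logit p₀ = kr ∧ b = 0) := by
    rcases lt_trichotomy (logit p₀) kl with h | h | h
    · exact Or.inl (Or.inl h)
    · rcases ha with h' | h'
      · exact Or.inr (Or.inl (Or.inr ⟨h, h'⟩))
      · exact Or.inl (Or.inr ⟨h, h'⟩)
    rcases le_or_gt (logit p₀) q with h2 | h2
    · exact Or.inr (Or.inl (Or.inl ⟨h, h2⟩))
    rcases lt_trichotomy (logit p₀) kr with h | h | h
    · exact Or.inr (Or.inr (Or.inl (Or.inl ⟨h2, h⟩)))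
    · rcases hb with h' | h'
      · exact Or.inr (Or.inr (Or.inr (Or.inr ⟨h, h'⟩)))
      · exact Or.inr (Or.inr (Or.inl (Or.inr ⟨h, h'⟩)))
    · exact Or.inr (Or.inr (Or.inr (Or.inl h)))
  rcases hstart with hs | hs | hs | hs
  · obtain ⟨σ, h1, h2⟩ := exists_executes_mixed_down (q := q) (kr := kr) (b := b) hlam hp
      (by linarith) hz hs
    refine ⟨σ, h1, fun τ hτ => same_of_control ?_⟩
    rcases hτ.mixed_cases hlam hp hlo hkl hkr hhi ha hb hz with
      ⟨h3, h4⟩ | ⟨h3, h4⟩ | ⟨h3, h4⟩ | ⟨h3, h4⟩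
    · exact h4.unique h2
    all_goals exfalso; grind
  · obtain ⟨σ, h1, h2⟩ := exists_executes_mixed_right (b := b) hlam hp hlo hkl hkr hhi hs
    refine ⟨σ, h1, fun τ hτ => same_of_control ?_⟩
    rcases hτ.mixed_cases hlam hp hlo hkl hkr hhi ha hb hz with
      ⟨h3, h4⟩ | ⟨h3, h4⟩ | ⟨h3, h4⟩ | ⟨h3, h4⟩
    · exfalso; grind
    · exact h4.unique h2
    all_goals exfalso; grind
  · obtain ⟨σ, h1, h2⟩ := exists_executes_mixed_left (a := a) hlam hp hlo hkl hkr hhi hs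
    refine ⟨σ, h1, fun τ hτ => same_of_control ?_⟩
    rcases hτ.mixed_cases hlam hp hlo hkl hkr hhi ha hb hz with
      ⟨h3, h4⟩ | ⟨h3, h4⟩ | ⟨h3, h4⟩ | ⟨h3, h4⟩
    · exfalso; grind
    · exfalso; grind
    · exact h4.unique h2
    · exfalso; grind
  · obtain ⟨σ, h1, h2⟩ := exists_executes_mixed_up (a := a) hlam hp hlo hkl hkr hz hs
    refine ⟨σ, h1, fun τ hτ => same_of_control ?_⟩
    rcases hτ.mixed_cases hlam hp hlo hkl hkr hhi ha hb hz with
      ⟨h3, h4⟩ | ⟨h3, h4⟩ | ⟨h3, h4⟩ | ⟨h3, h4⟩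
    · exfalso; grind
    · exfalso; grind
    · exfalso; grind
    · exact h4.unique h2

theorem optimaComeFrom_mixedPolicy (s : Standing u lam rho c)
    (hv : IsMixedValue lam (rho + lam / 2) (flow (rho * u.rR + c) (rho * u.lL + c))
      (stopLoss (u.rR - u.lR) (u.lL - u.rL)) lo kl q kr hi φ) :
    OptimaComeFrom u lam rho c {π | ∃ a ∈ ({0, 1} : Set ℝ), ∃ b ∈ ({0, 1} : Set ℝ),
      π = mixedPolicy (Real.sigmoid lo) (Real.sigmoid kl) (Real.sigmoid q) (Real.sigmoid kr)
        (Real.sigmoid hi) a b} := by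
  have hlam := s.lam_pos
  have hlo := hv.lo_lt
  have hkl := hv.kl_lt
  have hkr := hv.lt_kr
  have hhi := hv.lt_hi
  have h00 : (0 : ℝ) = 0 ∨ (0 : ℝ) = 1 := Or.inl rfl
  refine Solves.optimaComeFrom (φ := φ) hv.toIsValue s ⟨0, by simp, 0, by simp, rfl⟩
    (fun p hp => mixedPolicy_of_notMem hp) (isOptimalPolicy_mixedPolicy s hv h00 h00)
    (fun p₀ hp σ hσ => hv.regret_le (hσ.followsMixed hlam hp hlo hkl hkr hhi h00 h00))
    fun p₀ hp hz σ hσ => ?_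
  -- The direction in which a start at `kl` or `kr` is left fixes `a` or `b`; a parameter that the
  -- trajectory does not meet is chosen arbitrarily.
  rcases (hv.followsMixed σ.isControl hz hσ).cases hlam hlo hkl hkr hhi hz with
    ⟨h1, h2⟩ | ⟨h1, h2⟩ | ⟨h1, h2⟩ | ⟨h1, h2⟩
  · obtain ⟨τ, h3, h4⟩ := exists_executes_mixed_down (a := 1) (b := 0) (q := q) (kr := kr) hlam hp
      (by linarith) hz (h1.imp_right fun h => ⟨h.1, rfl⟩)
    exact ⟨_, ⟨1, by simp, 0, by simp, rfl⟩, τ, h3, same_of_control (h2.unique h4)⟩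
  · obtain ⟨τ, h3, h4⟩ := exists_executes_mixed_right (a := 0) (b := 0) hlam hp hlo hkl hkr hhi
      (h1.imp_right fun h => ⟨h.1, rfl⟩)
    exact ⟨_, ⟨0, by simp, 0, by simp, rfl⟩, τ, h3, same_of_control (h2.unique h4)⟩
  · obtain ⟨τ, h3, h4⟩ := exists_executes_mixed_left (a := 0) (b := 1) hlam hp hlo hkl hkr hhi
      (h1.imp_right fun h => ⟨h.1, rfl⟩)
    exact ⟨_, ⟨0, by simp, 1, by simp, rfl⟩, τ, h3, same_of_control (h2.unique h4)⟩
  · obtain ⟨τ, h3, h4⟩ := exists_executes_mixed_up (a := 0) (b := 0) hlam hp hlo hkl hkr hz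
      (h1.imp_right fun h => ⟨h.1, rfl⟩)
    exact ⟨_, ⟨0, by simp, 0, by simp, rfl⟩, τ, h3, same_of_control (h2.unique h4)⟩

end MixedValue

/-! ### The stopping loss as value function when learning never pays. -/

section Stop

variable {lam rho a b A B z z₀ : ℝ}

theorem stopLoss_eq_ite (hA : 0 < A) (hB : 0 < B) :
    stopLoss A B = fun z => if z ≤ Real.log (B / A) then A * Real.exp (z / 2)
      else B * Real.exp (-z / 2) := by
  funext z
  have he := Real.exp_pos (-z / 2)
  have hdiv : 0 < B / A := div_pos hB hA
  rw [stopLoss]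
  split_ifs with h
  · rw [Real.le_log_iff_exp_le hdiv, le_div_iff₀ hA] at h
    refine min_eq_left ?_
    rw [exp_half_eq_mul]
    nlinarith
  · rw [not_le, Real.log_lt_iff_lt_exp hdiv, div_lt_iff₀ hA] at h
    refine min_eq_right ?_
    rw [exp_half_eq_mul z]
    nlinarith

theorem mul_stop_le_flow (hA : 0 < A) (hB : 0 < B) (hb : 0 < b)
    (h : (rho + lam) * A * B ≤ a * B + b * A) (hz : z ≤ Real.log (B / A)) :
    (rho + lam) * (A * Real.exp (z / 2)) ≤ flow a b z ∧
      (z ≠ Real.log (B / A) → (rho + lam) * (A * Real.exp (z / 2)) < flow a b z) := by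
  have hdiv : 0 < B / A := div_pos hB hA
  have he := Real.exp_pos (-z / 2)
  have hX : 0 < Real.exp z := Real.exp_pos z
  -- Up to positive factors the slack is a nonnegative multiple of the slack in the no-learning
  -- condition plus a multiple of the distance from the indifference point. The latter is strict off
  -- that point.
  have hkey : B * A * (a * Real.exp z + b - (rho + lam) * A * Real.exp z) =
      (A * Real.exp z) * (a * B + b * A - (rho + lam) * A * B) +
        b * A * (B - A * Real.exp z) := by ring
  have hfl : flow a b z - (rho + lam) * (A * Real.exp (z / 2)) =
      Real.exp (-z / 2) * (a * Real.exp z + b - (rho + lam) * A * Real.exp z) := by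
    rw [flow_eq_mul, exp_half_eq_mul z]; ring
  have h1 : 0 ≤ (A * Real.exp z) * (a * B + b * A - (rho + lam) * A * B) :=
    mul_nonneg (by positivity) (sub_nonneg.2 h)
  have hBA : 0 < B * A := mul_pos hB hA
  rw [← sub_nonneg, ← sub_pos, hfl]
  constructor
  · rw [Real.le_log_iff_exp_le hdiv, le_div_iff₀ hA] at hz
    have h2 : 0 ≤ b * A * (B - A * Real.exp z) := mul_nonneg (by positivity) (by linarith)
    exact mul_nonneg he.le (nonneg_of_mul_nonneg_right (by rw [hkey]; linarith) hBA)
  · intro hne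
    have hz := lt_of_le_of_ne hz hne
    rw [Real.lt_log_iff_exp_lt hdiv, lt_div_iff₀ hA] at hz
    have h2 : 0 < b * A * (B - A * Real.exp z) := mul_pos (by positivity) (by linarith)
    exact mul_pos he (pos_of_mul_pos_right (by rw [hkey]; linarith) hBA.le)

theorem log_div_comm (A B : ℝ) : Real.log (A / B) = -Real.log (B / A) := by
  rw [← Real.log_inv, inv_div]

theorem mul_stop_le_flow' (hA : 0 < A) (hB : 0 < B) (ha : 0 < a)
    (h : (rho + lam) * A * B ≤ a * B + b * A) (hz : Real.log (B / A) ≤ z) :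
    (rho + lam) * (B * Real.exp (-z / 2)) ≤ flow a b z ∧
      (z ≠ Real.log (B / A) → (rho + lam) * (B * Real.exp (-z / 2)) < flow a b z) := by
  have := mul_stop_le_flow (z := -z) (a := b) (b := a) hB hA ha (lam := lam) (rho := rho)
    (by linarith) (by rw [log_div_comm]; linarith)
  rw [flow_neg, log_div_comm, ne_eq, neg_inj] at this
  exact this

theorem stopLoss_sub (ha : 0 < a) (hb : 0 < b) (hA : 0 < A) (hB : 0 < B)
    (h : (rho + lam) * A * B ≤ a * B + b * A) (z : ℝ) :
    SubAt lam (rho + lam / 2) (flow a b) (stopLoss A B) z := by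
  have hdiv : 0 < B / A := div_pos hB hA
  rw [stopLoss_eq_ite hA hB]
  refine subAt_ite (fun hz => ?_) (fun hz => ?_) ?_
  · refine SubAt.of_hasDerivAt ((hasDerivAt_exp_half z).const_mul A) ?_
    rw [abs_of_pos (by positivity)]
    linarith [(mul_stop_le_flow hA hB hb h hz).1]
  · refine SubAt.of_hasDerivAt ((hasDerivAt_exp_neg_half z).const_mul B) ?_
    have he : 0 < Real.exp (-z / 2) := Real.exp_pos _
    rw [abs_of_neg (by nlinarith [mul_pos hB he])]
    linarith [(mul_stop_le_flow' hA hB ha h hz).1]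
  · rw [exp_half_eq_mul, Real.exp_log hdiv]
    field_simp

theorem stopLoss_strict (ha : 0 < a) (hb : 0 < b) (hA : 0 < A) (hB : 0 < B)
    (h : (rho + lam) * A * B ≤ a * B + b * A) {z : ℝ} (hz : z ≠ Real.log (B / A)) :
    ∃ d, HasDerivAt (stopLoss A B) d z ∧
      (rho + lam / 2) * stopLoss A B z + lam * |d| < flow a b z := by
  rw [stopLoss_eq_ite hA hB]
  rcases hz.lt_or_gt with h' | h'
  · refine ⟨_, hasDerivAt_ite_of_lt h' ((hasDerivAt_exp_half z).const_mul A), ?_⟩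
    simp only [if_pos h'.le]
    rw [abs_of_pos (by positivity)]
    linarith [(mul_stop_le_flow hA hB hb h h'.le).2 hz]
  · refine ⟨_, hasDerivAt_ite_of_gt h' ((hasDerivAt_exp_neg_half z).const_mul B), ?_⟩
    have he : 0 < Real.exp (-z / 2) := Real.exp_pos _
    simp only [if_neg (not_le.2 h')]
    rw [abs_of_neg (by nlinarith [mul_pos hB he])]
    linarith [(mul_stop_le_flow' hA hB ha h h'.le).2 hz]

theorem stopLoss_pos (hA : 0 < A) (hB : 0 < B) (z : ℝ) : 0 < stopLoss A B z :=
  lt_min (by positivity) (by positivity)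

end Stop

section Act

variable {u : Payoffs} {lam rho c p₀ : ℝ}

/-- Here ψ is its own subsolution, strict off the indifference point log (B / A). An optimal path
with a positive deadline would have to stay at that point; but `rψ < S` holds there too, so it would
have to leave at once. -/
theorem isOptimal_iff_deadline_eq_zero (s : Standing u lam rho c)
    (h : (rho + lam) * (u.rR - u.lR) * (u.lL - u.rL) ≤
      (rho * u.rR + c) * (u.lL - u.rL) + (rho * u.lL + c) * (u.rR - u.lR))
    (hp : p₀ ∈ Icc (0 : ℝ) 1) {σ : Strategy lam p₀} : σ.IsOptimal u rho c ↔ σ.deadline = 0 := by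
  rcases hp.1.eq_or_lt with h0 | h0
  · exact isOptimal_iff_of_known s (Or.inl h0.symm) σ
  rcases hp.2.eq_or_lt with h1 | h1
  · exact isOptimal_iff_of_known s (Or.inr h1) σ
  have hp' : p₀ ∈ Ioo (0 : ℝ) 1 := ⟨h0, h1⟩
  have hlam := s.lam_pos
  have hr : 0 < rho + lam / 2 := by linarith [s.rho_nonneg]
  have hS : ∀ z, 0 < flow (rho * u.rR + c) (rho * u.lL + c) z := flow_pos s.a_pos s.b_pos
  have hsub := stopLoss_sub (lam := lam) s.a_pos s.b_pos s.A_pos s.B_pos h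
  have hψ := stopLoss_pos s.A_pos s.B_pos
  have hzero : ∀ τ : Strategy lam p₀, τ.deadline = 0 → τ.normalized u rho c ≤
      ENNReal.ofReal (stopLoss (u.rR - u.lR) (u.lL - u.rL) (logit p₀)) := fun τ hτ => by
    have : before 0 = ∅ := by ext; simp [before]
    rw [normalized, regret, hτ, this]
    simp [trajectory_zero]
  rw [isOptimal_iff_normalized_le s hp']
  refine ⟨fun hopt => ?_, fun hσ τ => (hzero σ hσ).trans ?_⟩
  · obtain ⟨τ, hτ⟩ := exists_deadline_zero hlam hp
    have hle := (hopt τ).trans (hzero τ hτ)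
    have hE := (total_eq_of_regret_le hlam hr (continuous_flow _ _) (fun z => (hS z).le) hsub
      (fun z => (hψ z).le) (fun z => le_rfl) (stopLoss_le s.A_pos s.B_pos)
      (σ.isControl.continuous_path (z₀ := logit p₀) hlam) (σ.isControl.abs_path_sub_le hlam)
      (by rw [path_zero]; exact hle)).1
    have hne : ∀ t ∈ before σ.deadline, path lam (logit p₀) (control σ.att) t =
        Real.log ((u.lL - u.rL) / (u.rR - u.lR)) := fun t ht => by
      by_contra hz
      exact not_eventually_strict (continuous_flow _ _) hlam σ.isControl hE ht
        (Filter.mem_of_superset (isOpen_ne.mem_nhds hz) fun w hw =>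
          stopLoss_strict s.a_pos s.b_pos s.A_pos s.B_pos h hw)
    by_contra hT
    have hmem := zero_mem_before hT
    have hz := hne 0 hmem
    rw [path_zero] at hz
    obtain ⟨e, he, hin, hl⟩ := leaves_of_total_eq (continuous_flow _ _) hlam σ.isControl hE (by
      obtain ⟨⟨d, -, hd⟩, -⟩ := hsub (logit p₀)
      have h1 := (mul_stop_le_flow s.A_pos s.B_pos s.b_pos h hz.le).1
      have h2 : stopLoss (u.rR - u.lR) (u.lL - u.rL) (logit p₀) =
          (u.rR - u.lR) * Real.exp (logit p₀ / 2) := by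
        rw [stopLoss_eq_ite s.A_pos s.B_pos]; exact if_pos hz.le
      have h3 : 0 < (u.rR - u.lR) * Real.exp (logit p₀ / 2) := mul_pos s.A_pos (Real.exp_pos _)
      rw [h2]
      nlinarith) hmem
    have h5 : e / 2 ∈ Ioo 0 e := ⟨by linarith, by linarith⟩
    have h6 := hne _ (hin _ h5)
    rw [← hz] at h6
    rcases hl with hl | hl
    · exact absurd h6 (hl _ h5).ne
    · exact absurd h6 (hl _ h5).ne'
  · have := ofReal_le_regret (T := τ.deadline) hlam hr
      (continuous_flow (rho * u.rR + c) (rho * u.lL + c)) (fun z => (hS z).le) hsub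
      (fun z => (hψ z).le) (fun z => le_rfl) (stopLoss_le s.A_pos s.B_pos)
      (τ.isControl.continuous_path (z₀ := logit p₀) hlam) (τ.isControl.abs_path_sub_le hlam)
    rwa [path_zero] at this

theorem isOptimalPolicy_actPolicy (s : Standing u lam rho c)
    (h : (rho + lam) * (u.rR - u.lR) * (u.lL - u.rL) ≤
      (rho * u.rR + c) * (u.lL - u.rL) + (rho * u.lL + c) * (u.rR - u.lR)) :
    IsOptimalPolicy u lam rho c actPolicy := fun _ hp =>
  ⟨exists_unique_executes_of_act s.lam_pos hp rfl, fun _ hσ =>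
    (isOptimal_iff_deadline_eq_zero s h hp).2 (deadline_eq_zero_of_executes rfl hσ)⟩

theorem optimaComeFrom_actPolicy (s : Standing u lam rho c)
    (h : (rho + lam) * (u.rR - u.lR) * (u.lL - u.rL) ≤
      (rho * u.rR + c) * (u.lL - u.rL) + (rho * u.lL + c) * (u.rR - u.lR)) :
    OptimaComeFrom u lam rho c {actPolicy} := fun _ hp _ hσ =>
  ⟨actPolicy, rfl, exists_executes_of_deadline_eq_zero rfl
    ((isOptimal_iff_deadline_eq_zero s h hp).1 hσ)⟩

end Act

/-! ### The cutoffs and boundaries in the original parameters. -/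

theorem sigmoid_log {x : ℝ} (hx : 0 < x) : Real.sigmoid (Real.log x) = x / (1 + x) := by
  rw [Real.sigmoid_def, Real.exp_neg, Real.exp_log hx]
  field_simp
  ring

/-- The lower end of the experimentation region in log-likelihood ratios. -/
def low (u : Payoffs) (lam rho c : ℝ) : ℝ :=
  Real.log ((rho * u.lL + c) / ((rho + lam) * (u.rR - u.lR) - (rho * u.rR + c)))

/-- The upper end of the experimentation region in log-likelihood ratios. -/
def high (u : Payoffs) (lam rho c : ℝ) : ℝ :=
  Real.log (((rho + lam) * (u.lL - u.rL) - (rho * u.lL + c)) / (rho * u.rR + c))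

/-- The log-likelihood ratio of the absorbing belief. -/
def reference (u : Payoffs) (rho c : ℝ) : ℝ :=
  Real.log ((rho * u.lL + c) / (rho * u.rR + c))

theorem cKnife_eq {u : Payoffs} {lam rho : ℝ} (hlam : 0 < lam) (hrho : 0 ≤ rho) :
    cKnife u lam rho =
      min ((rho + lam) * (u.rR - u.lR) / (1 + Real.exp (logCutoff lam rho)) - rho * u.rR)
        ((rho + lam) * (u.lL - u.rL) / (1 + Real.exp (logCutoff lam rho)) - rho * u.lL) := by
  rcases hrho.eq_or_lt with rfl | h
  · have h2 : 0 < 1 + Real.exp 2 := by positivity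
    rw [cKnife, if_neg (lt_irrefl _), logCutoff, if_neg (lt_irrefl _),
      mul_min_of_nonneg _ _ (by positivity)]
    congr 1 <;> ring
  · have h2 : 0 < (2 * rho + lam) / lam := by positivity
    rw [cKnife, if_pos h, logCutoff, if_pos h, Real.rpow_def_of_pos h2, mul_comm (Real.log _)]

namespace Standing

variable {u : Payoffs} {lam rho c : ℝ}

/-- The condition says `(rho + lam) * ψ ≤ S` at the indifference point: learning does not pay even
there. The truncation of the cutoff at 0 is harmless because `c ≥ 0`. -/
theorem cUpper_le_iff (s : Standing u lam rho c) : cUpper u lam rho ≤ c ↔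
    (rho + lam) * (u.rR - u.lR) * (u.lL - u.rL) ≤
      (rho * u.rR + c) * (u.lL - u.rL) + (rho * u.lL + c) * (u.rR - u.lR) := by
  have h := add_pos s.A_pos s.B_pos
  rw [cUpper, max_le_iff, and_iff_right s.c_nonneg, div_le_iff₀ h, ← sub_nonneg,
    ← sub_nonneg (b := (rho + lam) * (u.rR - u.lR) * (u.lL - u.rL))]
  ring_nf

theorem cond_of_lt (s : Standing u lam rho c) (h : c < cUpper u lam rho) :
    (rho * u.rR + c) * (u.lL - u.rL) + (rho * u.lL + c) * (u.rR - u.lR) <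
      (rho + lam) * (u.rR - u.lR) * (u.lL - u.rL) := by
  rw [← not_le, ← s.cUpper_le_iff, not_le]
  exact h

theorem left_gap (s : Standing u lam rho c) (h : c < cUpper u lam rho) :
    0 < (rho + lam) * (u.rR - u.lR) - (rho * u.rR + c) := by
  have h1 := s.cond_of_lt h
  have h2 := mul_pos s.b_pos s.A_pos
  refine pos_of_mul_pos_left (b := u.lL - u.rL) ?_ s.B_pos.le
  linarith

theorem right_gap (s : Standing u lam rho c) (h : c < cUpper u lam rho) :
    0 < (rho + lam) * (u.lL - u.rL) - (rho * u.lL + c) := by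
  have h1 := s.cond_of_lt h
  have h2 := mul_pos s.a_pos s.B_pos
  refine pos_of_mul_pos_left (b := u.rR - u.lR) ?_ s.A_pos.le
  linarith

theorem model (s : Standing u lam rho c) (h : c < cUpper u lam rho) :
    Model lam rho (rho * u.rR + c) (rho * u.lL + c) (u.rR - u.lR) (u.lL - u.rL)
      (low u lam rho c) (high u lam rho c) (reference u rho c) where
  lam_pos := s.lam_pos
  rho_nonneg := s.rho_nonneg
  a_pos := s.a_pos
  b_pos := s.b_pos
  A_pos := s.A_pos
  B_pos := s.B_pos
  lt := s.cond_of_lt h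
  lo_eq := by
    have := s.left_gap h
    rw [low, Real.exp_log (div_pos s.b_pos this)]
    field_simp
  hi_eq := by
    have := s.right_gap h
    rw [high, Real.exp_neg, Real.exp_log (div_pos this s.a_pos)]
    field_simp
  q_eq := by
    have := s.a_pos
    rw [reference, Real.exp_log (div_pos s.b_pos s.a_pos)]
    field_simp

theorem pLow_eq (s : Standing u lam rho c) (h : c < cUpper u lam rho) :
    pLow u lam rho c = Real.sigmoid (low u lam rho c) := by
  have h1 := s.left_gap h
  have h2 := s.b_pos
  rw [low, sigmoid_log (div_pos h2 h1), pLow]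
  have h3 : rho * (u.lL - u.lR) + (u.rR - u.lR) * lam =
      ((rho + lam) * (u.rR - u.lR) - (rho * u.rR + c)) + (rho * u.lL + c) := by ring
  rw [h3, mul_comm u.lL]
  field_simp

theorem pHigh_eq (s : Standing u lam rho c) (h : c < cUpper u lam rho) :
    pHigh u lam rho c = Real.sigmoid (high u lam rho c) := by
  have h1 := s.right_gap h
  have h2 := s.a_pos
  rw [high, sigmoid_log (div_pos h1 h2), pHigh]
  have h3 : rho * (u.rR - u.rL) + (u.lL - u.rL) * lam =
      ((rho + lam) * (u.lL - u.rL) - (rho * u.lL + c)) + (rho * u.rR + c) := by ring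
  have h4 : (u.lL - u.rL) * lam - u.rL * rho - c =
      (rho + lam) * (u.lL - u.rL) - (rho * u.lL + c) := by ring
  rw [h3, h4]
  field_simp
  ring

theorem pStar_eq (s : Standing u lam rho c) :
    pStar u rho c = Real.sigmoid (reference u rho c) := by
  have h1 := s.a_pos
  have h2 := s.b_pos
  rw [reference, sigmoid_log (div_pos h2 h1), pStar, mul_comm u.lL, mul_comm u.rR]
  field_simp

theorem exp_reference_sub_low (s : Standing u lam rho c) (h : c < cUpper u lam rho) :
    Real.exp (reference u rho c - low u lam rho c) =
      ((rho + lam) * (u.rR - u.lR) - (rho * u.rR + c)) / (rho * u.rR + c) := by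
  have h1 := s.left_gap h
  have h2 := s.b_pos
  have h3 := s.a_pos
  rw [Real.exp_sub, reference, low, Real.exp_log (by positivity), Real.exp_log (by positivity)]
  field_simp

theorem exp_high_sub_reference (s : Standing u lam rho c) (h : c < cUpper u lam rho) :
    Real.exp (high u lam rho c - reference u rho c) =
      ((rho + lam) * (u.lL - u.rL) - (rho * u.lL + c)) / (rho * u.lL + c) := by
  have h1 := s.right_gap h
  have h2 := s.b_pos
  have h3 := s.a_pos
  rw [Real.exp_sub, reference, high, Real.exp_log (by positivity), Real.exp_log (by positivity)]
  field_simp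

/-- Exponentiated, the distance from `low` to the reference point is `((rho + lam) * A − a) / a`, so
exceeding log K means a (1 + K) < (ρ + λ) A, which is linear in `c`; likewise on the other side. -/
theorem lt_cKnife_iff (s : Standing u lam rho c) (h : c < cUpper u lam rho) :
    c < cKnife u lam rho ↔ logCutoff lam rho < reference u rho c - low u lam rho c ∧
      logCutoff lam rho < high u lam rho c - reference u rho c := by
  have hK : 0 < 1 + Real.exp (logCutoff lam rho) := by positivity
  rw [cKnife_eq s.lam_pos s.rho_nonneg, lt_min_iff, ← Real.exp_lt_exp (x := logCutoff lam rho)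
      (y := reference u rho c - low u lam rho c), ← Real.exp_lt_exp (x := logCutoff lam rho)
      (y := high u lam rho c - reference u rho c),
    s.exp_reference_sub_low h, s.exp_high_sub_reference h, lt_div_iff₀ s.a_pos,
    lt_div_iff₀ s.b_pos, lt_sub_iff_add_lt, lt_sub_iff_add_lt, lt_div_iff₀ hK, lt_div_iff₀ hK]
  refine and_congr ?_ ?_ <;> constructor <;> intro h <;> linarith

theorem cKnife_lt_iff (s : Standing u lam rho c) (h : c < cUpper u lam rho) :
    cKnife u lam rho < c ↔ reference u rho c - low u lam rho c < logCutoff lam rho ∨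
      high u lam rho c - reference u rho c < logCutoff lam rho := by
  have hK : 0 < 1 + Real.exp (logCutoff lam rho) := by positivity
  rw [cKnife_eq s.lam_pos s.rho_nonneg, min_lt_iff, ← Real.exp_lt_exp (y := logCutoff lam rho)
      (x := reference u rho c - low u lam rho c), ← Real.exp_lt_exp (y := logCutoff lam rho)
      (x := high u lam rho c - reference u rho c),
    s.exp_reference_sub_low h, s.exp_high_sub_reference h, div_lt_iff₀ s.a_pos,
    div_lt_iff₀ s.b_pos, sub_lt_iff_lt_add, sub_lt_iff_lt_add, div_lt_iff₀ hK, div_lt_iff₀ hK]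
  refine or_congr ?_ ?_ <;> constructor <;> intro h <;> linarith

end Standing

section Cutoffs

variable {u : Payoffs} {lam rho c : ℝ}

theorem cKnife_lt_cUpper (hlam : 0 < lam) (hR : max 0 u.lR < u.rR) (hL : max 0 u.rL < u.lL)
    (hrho : 0 ≤ rho) (h : 0 < cKnife u lam rho) : cKnife u lam rho < cUpper u lam rho := by
  -- The cutoff itself is used as the cost. Weighting the two bounds a (1 + K) ≤ (ρ + λ) A and b (1
  -- + K) ≤ (ρ + λ) B by B and A and adding gives (1 + K)(aB + bA) ≤ 2 (ρ + λ) AB, and K > 1.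
  have s : Standing u lam rho (cKnife u lam rho) := ⟨hlam, hR, hL, hrho, h.le, Or.inr h⟩
  have hK : 1 < Real.exp (logCutoff lam rho) := Real.one_lt_exp_iff.2 (logCutoff_pos hlam)
  have hK' : 0 < 1 + Real.exp (logCutoff lam rho) := by positivity
  rw [← not_le, s.cUpper_le_iff, not_le]
  have h1 := (cKnife_eq (u := u) hlam hrho).le
  rw [le_min_iff, le_sub_iff_add_le, le_sub_iff_add_le, le_div_iff₀ hK', le_div_iff₀ hK'] at h1
  have hA := s.A_pos
  have hB := s.B_pos
  have ha := s.a_pos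
  have hb := s.b_pos
  have h2 := mul_le_mul_of_nonneg_right h1.1 hB.le
  have h3 := mul_le_mul_of_nonneg_right h1.2 hA.le
  have h4 : 0 < ((rho * u.rR + cKnife u lam rho) * (u.lL - u.rL) +
      (rho * u.lL + cKnife u lam rho) * (u.rR - u.lR)) * (Real.exp (logCutoff lam rho) - 1) :=
    mul_pos (by positivity) (by linarith)
  nlinarith

/-- K is at most e² uniformly in `rho`, so the positive terms stay bounded away from zero while the
subtracted interest terms are linear in `rho`. -/
theorem exists_cKnife_pos (hlam : 0 < lam) (hR : max 0 u.lR < u.rR) (hL : max 0 u.rL < u.lL) :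
    ∃ rho₀ : ℝ, 0 < rho₀ ∧ ∀ rho : ℝ, 0 ≤ rho → rho < rho₀ → 0 < cKnife u lam rho := by
  have s : Standing u lam 0 1 := ⟨hlam, hR, hL, le_rfl, zero_le_one, Or.inr one_pos⟩
  have hA := s.A_pos
  have hB := s.B_pos
  have hrR := s.rR_pos
  have hlL := s.lL_pos
  have hE : 0 < 1 + Real.exp 2 := by positivity
  refine ⟨min (lam * (u.rR - u.lR) / (1 + Real.exp 2) / u.rR)
    (lam * (u.lL - u.rL) / (1 + Real.exp 2) / u.lL), by positivity, fun rho h0 h => ?_⟩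
  have hK' : 0 < 1 + Real.exp (logCutoff lam rho) := by positivity
  have hK : 1 + Real.exp (logCutoff lam rho) ≤ 1 + Real.exp 2 := by
    gcongr
    exact logCutoff_le hlam
  have key : ∀ {X y : ℝ}, 0 < X → 0 < y → rho < lam * X / (1 + Real.exp 2) / y →
      0 < (rho + lam) * X / (1 + Real.exp (logCutoff lam rho)) - rho * y := by
    intro X y hX hy h
    rw [lt_div_iff₀ hy] at h
    have h1 : lam * X / (1 + Real.exp 2) ≤ (rho + lam) * X / (1 + Real.exp (logCutoff lam rho)) := by
      gcongr
      linarith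
    linarith
  rw [lt_min_iff] at h
  rw [cKnife_eq hlam h0]
  exact lt_min (key hA hrR h.1) (key hB hlL h.2)

end Cutoffs

end Attention

end

theorem theorem1 (u : Attention.Payoffs) (lam : ℝ) (hlam : 0 < lam)
    (hR : max 0 u.lR < u.rR) (hL : max 0 u.rL < u.lL) :
    (∀ rho : ℝ, 0 ≤ rho →
      0 ≤ Attention.cLower u lam rho ∧ Attention.cLower u lam rho ≤ Attention.cUpper u lam rho) ∧
    (∃ rho₀ : ℝ, 0 < rho₀ ∧ ∀ rho : ℝ, 0 ≤ rho → rho < rho₀ →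
      0 < Attention.cLower u lam rho ∧ Attention.cLower u lam rho < Attention.cUpper u lam rho) ∧
    ∀ rho c : ℝ, 0 ≤ rho → 0 ≤ c → (0 < rho ∨ 0 < c) →
      -- no learning
      (Attention.cUpper u lam rho ≤ c →
        Attention.IsOptimalPolicy u lam rho c Attention.actPolicy ∧
        Attention.OptimaComeFrom u lam rho c {Attention.actPolicy}) ∧
      -- own-biased learning
      (Attention.cLower u lam rho ≤ c → c < Attention.cUpper u lam rho →
        0 < Attention.pLow u lam rho c ∧ Attention.pHigh u lam rho c < 1 ∧
        ∃ k : ℝ, Attention.pLow u lam rho c < k ∧ k < Attention.pHigh u lam rho c ∧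
          (∀ a ∈ ({0, 1} : Set ℝ), Attention.IsOptimalPolicy u lam rho c
            (Attention.ownPolicy (Attention.pLow u lam rho c) k
              (Attention.pHigh u lam rho c) a)) ∧
          (c ≠ Attention.cKnife u lam rho →
            Attention.OptimaComeFrom u lam rho c
              {π | ∃ a ∈ ({0, 1} : Set ℝ), π =
                Attention.ownPolicy (Attention.pLow u lam rho c) k
                  (Attention.pHigh u lam rho c) a}) ∧
          (c = Attention.cKnife u lam rho →
            ∀ p₀ ∈ Set.Icc (0 : ℝ) 1, ∀ σ : Attention.Strategy lam p₀,
              σ.IsOptimal u rho c →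
              Attention.FollowsOff (Attention.pStar u rho c)
                (Attention.ownPolicy (Attention.pLow u lam rho c) k
                  (Attention.pHigh u lam rho c) 0) σ)) ∧
      -- own-biased and opposite-biased learning
      (c < Attention.cLower u lam rho →
        0 < Attention.pLow u lam rho c ∧ Attention.pHigh u lam rho c < 1 ∧
        ∃ kl kr : ℝ, Attention.pLow u lam rho c < kl ∧ kl < Attention.pStar u rho c ∧
          Attention.pStar u rho c < kr ∧ kr < Attention.pHigh u lam rho c ∧
          (∀ a ∈ ({0, 1} : Set ℝ), ∀ b ∈ ({0, 1} : Set ℝ),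
            Attention.IsOptimalPolicy u lam rho c
              (Attention.mixedPolicy (Attention.pLow u lam rho c) kl (Attention.pStar u rho c) kr
                (Attention.pHigh u lam rho c) a b)) ∧
          Attention.OptimaComeFrom u lam rho c
            {π | ∃ a ∈ ({0, 1} : Set ℝ), ∃ b ∈ ({0, 1} : Set ℝ), π =
              Attention.mixedPolicy (Attention.pLow u lam rho c) kl (Attention.pStar u rho c) kr
                (Attention.pHigh u lam rho c) a b}) := by
  refine ⟨fun rho hrho => ⟨le_max_left _ _, max_le (le_max_left _ _) (min_le_left _ _)⟩, ?_, ?_⟩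
  · obtain ⟨rho₀, h0, h⟩ := Attention.exists_cKnife_pos hlam hR hL
    refine ⟨rho₀, h0, fun rho hrho hlt => ?_⟩
    have h1 := h rho hrho hlt
    have h2 := Attention.cKnife_lt_cUpper hlam hR hL hrho h1
    rw [Attention.cLower, min_eq_right h2.le, max_eq_right h1.le]
    exact ⟨h1, h2⟩
  · intro rho c hrho hc hpos
    have s : Attention.Standing u lam rho c := ⟨hlam, hR, hL, hrho, hc, hpos⟩
    refine ⟨fun h => ⟨Attention.isOptimalPolicy_actPolicy s (s.cUpper_le_iff.1 h),
      Attention.optimaComeFrom_actPolicy s (s.cUpper_le_iff.1 h)⟩, fun hlow hup => ?_,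
      fun hlow => ?_⟩
    · have m := s.model hup
      have hknife : Attention.cKnife u lam rho ≤ c :=
        ((min_le_iff.1 ((le_max_right _ _).trans hlow)).resolve_left (not_le.2 hup))
      -- `c` at or above the knife-edge cost means that the two distances from `q` do not both
      -- exceed the cutoff, so waiting at `q` fails to beat at least one of the one-sided values.
      obtain ⟨k, φ, hv, hstrict⟩ := m.exists_isOwnValue (by
        rw [← not_lt, ← not_lt, ← not_and_or, m.leftValue_flow_iff.1, m.rightValue_flow_iff.1,
          ← s.lt_cKnife_iff hup, not_lt]
        exact hknife)
      rw [s.pLow_eq hup, s.pHigh_eq hup, s.pStar_eq]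
      refine ⟨Real.sigmoid_pos _, Real.sigmoid_lt_one _, Real.sigmoid k,
        Real.sigmoid_lt hv.lo_lt, Real.sigmoid_lt hv.lt_hi,
        fun a ha => Attention.isOptimalPolicy_ownPolicy s hv ha, fun hne => ?_,
        fun _ p₀ hp σ hσ => Attention.followsOff_ownPolicy s hv hp hσ 0⟩
      -- Off the knife edge one of the comparisons at `q` is strict, which rules out resting
      -- anywhere.
      refine Attention.optimaComeFrom_ownPolicy s hv (hstrict ?_)
      rw [m.leftValue_flow_iff.2, m.rightValue_flow_iff.2, ← s.cKnife_lt_iff hup]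
      exact lt_of_le_of_ne hknife hne.symm
    · have hmin : c < min (Attention.cUpper u lam rho) (Attention.cKnife u lam rho) :=
        (lt_max_iff.1 hlow).resolve_left (not_lt.2 hc)
      have hup := hmin.trans_le (min_le_left _ _)
      have m := s.model hup
      obtain ⟨hl, hr⟩ := (s.lt_cKnife_iff hup).1 (hmin.trans_le (min_le_right _ _))
      obtain ⟨kl, kr, φ, hv⟩ := m.exists_isMixedValue (m.leftValue_flow_iff.1.2 hl)
        (m.rightValue_flow_iff.1.2 hr)
      rw [s.pLow_eq hup, s.pHigh_eq hup, s.pStar_eq]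
      exact ⟨Real.sigmoid_pos _, Real.sigmoid_lt_one _, Real.sigmoid kl, Real.sigmoid kr,
        Real.sigmoid_lt hv.lo_lt, Real.sigmoid_lt hv.kl_lt, Real.sigmoid_lt hv.lt_kr,
        Real.sigmoid_lt hv.lt_hi,
        fun a ha b hb => Attention.isOptimalPolicy_mixedPolicy s hv ha hb,
        Attention.optimaComeFrom_mixedPolicy s hv⟩
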